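/- Let $N \ge 2$, let $\mathcal M = \mathbb R^N \times \mathbb R_{>0}^N$ and $\mathcal M^{\mathbb C} = \{(b,a) \in \mathbb C^{2N} : \operatorname{Re} a_k > 0 \text{ for } 1 \le k \le N\}$, and extend $b$ and $a$ to $N$-periodic sequences. For $(b,a) \in \mathcal M^{\mathbb C}$ and $\lambda \in \mathbb C$ let $y_1(\cdot,\lambda)$, $y_2(\cdot,\lambda)$ be the solutions of $$a_{k-1} y(k-1) + b_k y(k) + a_k y(k+1) = \lambda y(k)$$ with $y_1(0)=1$, $y_1(1)=0$, $y_2(0)=0$, $y_2(1)=1$, and let $\Delta_\lambda = y_1(N,\lambda) + y_2(N+1,\lambda)$ be the discriminant, a polynomial in $\lambda$ of degree $N$ with derivative $\dot\Delta_\lambda$. Let $\lambda_1, \dots, \lambda_{2N}$ be the zeros of $\Delta_\lambda^2 - 4 = (\prod_k a_k)^{-2} \prod_{j=1}^{2N} (\lambda - \lambda_j)$, counted with multiplicity and listed in lexicographic order (by real part, then by imaginary part). For $1 \le n \le N-1$ let $\gamma_n = \lambda_{2n+1} - \lambda_{2n}$, $\tau_n = \frac12(\lambda_{2n} + \lambda_{2n+1})$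 and $D_n = \{\gamma_n = 0\}$. Let $\sqrt[+]{\cdot}$ be the principal branch of the square root on $\mathbb C \setminus (-\infty,0]$, and let $$\sqrt[c]{\Delta_\lambda^2-4} = \Big(\prod_k a_k\Big)^{-1} i\, \sqrt[+]{\lambda-\lambda_1}\, \sqrt[+]{\lambda_{2N}-\lambda} \prod_{m=1}^{N-1} (\lambda-\tau_m) \sqrt[+]{1 - \Big(\frac{\gamma_m/2}{\lambda-\tau_m}\Big)^2}$$ be the canonical root; for $(b,a) \in \mathcal M$ it is the branch of the square root of $\Delta_\lambda^2-4$ on $\mathbb C \setminus \big((-\infty,\lambda_1] \cup \bigcup_{m=1}^{N-1} [\lambda_{2m},\lambda_{2m+1}] \cup [\lambda_{2N},\infty)\big)$ with $-i\sqrt[c]{\Delta_\lambda^2-4} > 0$ for $\lambda_{2N-1} < \lambda < \lambda_{2N}$. Define the actions $$I_n = \frac{1}{2\pi} \int_{\Gamma_n} \lambda\, \frac{\dot\Delta_\lambda}{\sqrt[c]{\Delta_\lambda^2-4}}\, d\lambda \qquad (1 \le n \le N-1),$$ where $\Gamma_n$ is the counterclockwise circle with centre $\tau_n$ and radius $\frac12\big(\frac{|\gamma_n|}{2}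 + \min(|\tau_n-\lambda_{2n-1}|, |\lambda_{2n+2}-\tau_n|)\big)$; for $(b,a)$ in $\mathcal M$ it encloses $[\lambda_{2n},\lambda_{2n+1}]$ and no other $\lambda_j$. Then there is an open set $\mathcal W$ with $\mathcal M \subseteq \mathcal W \subseteq \mathcal M^{\mathbb C}$ such that for every $1 \le n \le N-1$ the quotient $I_n/\gamma_n^2$ extends analytically from $\mathcal M \setminus D_n$ to all of $\mathcal W$: there is an analytic function $F_n : \mathcal W \to \mathbb C$ with $F_n = I_n/\gamma_n^2$ on $\mathcal M \setminus D_n$ and, more generally, at every point of $\mathcal W$ where $\gamma_n \ne 0$. Moreover $\operatorname{Re} F_n > 0$ on $\mathcal W$, and consequently $\xi_n = \sqrt[+]{2F_n}$ (that is, $\sqrt[+]{2I_n/\gamma_n^2}$) is analytic and vanishes nowhere on $\mathcal W$. -/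

import Mathlib

open Polynomial

/-- The ambient space `ℂ^{2N}` of pairs `(b, a)` of `N`-periodic complex sequences; `b_k` is
`p.1 k`, `a_k` is `p.2 k`, with `k` read modulo `N` (so `b_N = b_0`, `a_N = a_0`). -/
abbrev TodaSpace (N : ℕ) : Type := (ZMod N → ℂ) × (ZMod N → ℂ)

/-- The complexified phase space: `Re a_k > 0` for all `k`. -/
def complexPhase (N : ℕ) : Set (TodaSpace N) := {p | ∀ k, 0 < (p.2 k).re}

/-- The real phase space `ℝ^N × ℝ_{>0}^N`, as a subset of `ℂ^{2N}`. -/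
def realPhase (N : ℕ) : Set (TodaSpace N) :=
  {p | ∀ k, (p.1 k).im = 0 ∧ (p.2 k).im = 0 ∧ 0 < (p.2 k).re}

/-- The principal branch of the square root. -/
noncomputable def principalSqrt (z : ℂ) : ℂ := z ^ (1 / 2 : ℂ)

namespace Toda

variable {N : ℕ}

/-- The solution `y(0), y(1), y(2), …` of `a_{k-1} y(k-1) + b_k y(k) + a_k y(k+1) = λ y(k)` with
`y(0) = u₀`, `y(1) = u₁`, as a polynomial in the spectral parameter `λ = X`. -/
noncomputable def solution (p : TodaSpace N) (u₀ u₁ : ℂ) : ℕ → ℂ[X]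
  | 0 => C u₀
  | 1 => C u₁
  | k + 2 => C (p.2 ((k + 1 : ℕ) : ZMod N))⁻¹ *
      ((X - C (p.1 ((k + 1 : ℕ) : ZMod N))) * solution p u₀ u₁ (k + 1)
        - C (p.2 (k : ZMod N)) * solution p u₀ u₁ k)

/-- The fundamental solution with `y₁(0) = 1`, `y₁(1) = 0`. -/
noncomputable def y₁ (p : TodaSpace N) (k : ℕ) : ℂ[X] := solution p 1 0 k

/-- The fundamental solution with `y₂(0) = 0`, `y₂(1) = 1`. -/
noncomputable def y₂ (p : TodaSpace N) (k : ℕ) : ℂ[X] := solution p 0 1 k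

/-- The discriminant `Δ(λ) = y₁(N, λ) + y₂(N + 1, λ)`. -/
noncomputable def discr (p : TodaSpace N) : ℂ[X] := y₁ p N + y₂ p (N + 1)

/-- The lexicographic ordering of complex numbers. -/
def lexLe (z w : ℂ) : Prop := z.re < w.re ∨ (z.re = w.re ∧ z.im ≤ w.im)

noncomputable instance : DecidableRel lexLe := Classical.decRel _

instance : IsTrans ℂ lexLe := ⟨by
  rintro x y z (h | ⟨h, h'⟩) (k | ⟨k, k'⟩)
  · exact Or.inl (h.trans k)
  · exact Or.inl (k ▸ h)
  · exact Or.inl (h ▸ k)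
  · exact Or.inr ⟨h.trans k, h'.trans k'⟩⟩

instance : Std.Antisymm lexLe := ⟨by
  rintro x y (h | ⟨h, h'⟩) (k | ⟨k, k'⟩)
  · exact absurd h (lt_asymm k)
  · exact absurd h (k ▸ lt_irrefl _)
  · exact absurd k (h ▸ lt_irrefl _)
  · exact Complex.ext h (le_antisymm h' k')⟩

instance : Std.Total lexLe := ⟨by
  intro x y
  rcases lt_trichotomy x.re y.re with h | h | h
  · exact Or.inl (Or.inl h)
  · rcases le_total x.im y.im with k | k
    · exact Or.inl (Or.inr ⟨h, k⟩)
    · exact Or.inr (Or.inr ⟨h.symm, k⟩)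
  · exact Or.inr (Or.inl h)⟩

/-- The zeros of `Δ² - 4`, repeated according to multiplicity, in lexicographic order. -/
noncomputable def eigList (p : TodaSpace N) : List ℂ :=
  (discr p ^ 2 - 4).roots.sort lexLe

/-- `eig p j` is `λ_j`, for `1 ≤ j ≤ 2N`. -/
noncomputable def eig (p : TodaSpace N) (j : ℕ) : ℂ := (eigList p).getD (j - 1) 0

/-- The gap length `γ_n = λ_{2n+1} - λ_{2n}`. -/
noncomputable def gap (p : TodaSpace N) (n : ℕ) : ℂ := eig p (2 * n + 1) - eig p (2 * n)

/-- The midpoint `τ_n` of the `n`-th gap. -/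
noncomputable def mid (p : TodaSpace N) (n : ℕ) : ℂ := (eig p (2 * n) + eig p (2 * n + 1)) / 2

/-- The set where the `n`-th gap is collapsed. -/
def collapsed (N n : ℕ) : Set (TodaSpace N) := {p | gap p n = 0}

/-- The branch of the square root of `(λ - λ_{2n}) (λ - λ_{2n+1})` which is analytic outside the
segment `[λ_{2n}, λ_{2n+1}]` and asymptotic to `λ` at infinity. -/
noncomputable def gapRoot (p : TodaSpace N) (n : ℕ) (z : ℂ) : ℂ :=
  (z - mid p n) * principalSqrt (1 - (gap p n / 2 / (z - mid p n)) ^ 2)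

/-- The canonical root of `Δ(λ)² - 4 = (∏ a_k)⁻² ∏_j (λ - λ_j)`: it is analytic off the segments
`[λ_{2n}, λ_{2n+1}]`, `1 ≤ n ≤ N - 1`, and the rays `λ_1 + (-∞, 0]` and `λ_{2N} + [0, ∞)`, and for
real `(b, a)` it lies in `i ℝ_{>0}` on the last band `(λ_{2N-1}, λ_{2N})`; see `cRoot_sq`,
`cRoot_differentiableAt` and `cRoot_sign`. -/
noncomputable def cRoot [NeZero N] (p : TodaSpace N) (z : ℂ) : ℂ :=
  (∏ k, p.2 k)⁻¹ *
    (Complex.I * principalSqrt (z - eig p 1) * principalSqrt (eig p (2 * N) - z)) *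
    ∏ m ∈ Finset.Icc 1 (N - 1), gapRoot p m z

/-- The radius of the contour `Γ_n`: the midpoint between half the gap length and the distance from
`τ_n` to the nearer one of the neighbouring zeros `λ_{2n-1}`, `λ_{2n+2}`. -/
noncomputable def contourRadius (p : TodaSpace N) (n : ℕ) : ℝ :=
  (‖gap p n‖ / 2 + min ‖mid p n - eig p (2 * n - 1)‖ ‖eig p (2 * n + 2) - mid p n‖) / 2

/-- The action `I_n = (2π)⁻¹ ∮_{Γ_n} λ Δ'(λ) / √(Δ(λ)² - 4) dλ`, where `Γ_n` is the
counterclockwise circle around the `n`-th gap with centre `τ_n` and radius `contourRadius p n`, and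
the root is the canonical one. -/
noncomputable def action [NeZero N] (p : TodaSpace N) (n : ℕ) : ℂ :=
  (2 * Real.pi : ℂ)⁻¹ *
    ∮ z in C(mid p n, contourRadius p n), z * (derivative (discr p)).eval z / cRoot p z

end Toda

lemma principalSqrt_sq (z : ℂ) : principalSqrt z ^ 2 = z := by
  unfold principalSqrt
  rw [one_div]
  exact_mod_cast Complex.cpow_nat_inv_pow z (two_ne_zero)

namespace Toda

variable {N : ℕ}

lemma solution_coeff (p : TodaSpace N) (u₀ u₁ : ℂ) (k : ℕ) :
    (solution p u₀ u₁ k).natDegree ≤ k - 1 ∧ (solution p u₀ u₁ (k + 1)).natDegree ≤ k ∧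
      (solution p u₀ u₁ (k + 1)).coeff k =
        u₁ * ∏ j ∈ Finset.range k, (p.2 ((j + 1 : ℕ) : ZMod N))⁻¹ := by
  induction k with
  | zero => simp [solution]
  | succ k ih =>
    obtain ⟨h0, h1, h2⟩ := ih
    refine ⟨by simpa using h1, ?_, ?_⟩
    · simp only [solution]
      refine (natDegree_C_mul_le _ _).trans ((natDegree_sub_le _ _).trans (max_le ?_ ?_))
      · refine natDegree_mul_le.trans ?_
        rw [natDegree_X_sub_C]; omega
      · exact (natDegree_C_mul_le _ _).trans (by omega)
    · simp only [solution]
      have h3 : (solution p u₀ u₁ k).coeff (k + 1) = 0 :=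
        coeff_eq_zero_of_natDegree_lt (by omega)
      have h4 : (solution p u₀ u₁ (k + 1)).coeff (k + 1) = 0 :=
        coeff_eq_zero_of_natDegree_lt (by omega)
      rw [coeff_C_mul, coeff_sub, sub_mul, coeff_sub, coeff_X_mul, coeff_C_mul, coeff_C_mul,
        h3, h4, h2, Finset.prod_range_succ]
      ring

lemma prod_range_zmod [NeZero N] (f : ZMod N → ℂ) :
    ∏ j ∈ Finset.range N, f ((j + 1 : ℕ) : ZMod N) = ∏ k, f k := by
  have h : ∏ k, f k = ∏ k, f (k + 1) := (Equiv.prod_comp (Equiv.addRight (1 : ZMod N)) f).symm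
  rw [h]
  refine Finset.prod_bij (fun j _ => (j : ZMod N)) (by simp) ?_ ?_ (by simp)
  · intro i hi j hj hij
    have := (ZMod.natCast_eq_natCast_iff' i j N).1 hij
    rwa [Nat.mod_eq_of_lt (Finset.mem_range.1 hi), Nat.mod_eq_of_lt (Finset.mem_range.1 hj)] at this
  · intro k _
    exact ⟨k.val, Finset.mem_range.2 (ZMod.val_lt k), ZMod.natCast_zmod_val k⟩

lemma discr_natDegree_coeff [NeZero N] (p : TodaSpace N) :
    (discr p).natDegree ≤ N ∧ (discr p).coeff N = (∏ k, p.2 k)⁻¹ := by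
  have h1 := solution_coeff p 1 0 N
  have h2 := solution_coeff p 0 1 N
  have hN := NeZero.pos N
  constructor
  · exact (natDegree_add_le _ _).trans (max_le (h1.1.trans (by omega)) h2.2.1)
  · have h3 : (y₁ p N).coeff N = 0 :=
      coeff_eq_zero_of_natDegree_lt (lt_of_le_of_lt h1.1 (by omega))
    have h4 := h2.2.2
    rw [prod_range_zmod (fun k => (p.2 k)⁻¹), Finset.prod_inv_distrib, one_mul] at h4
    rw [discr, coeff_add, h3, zero_add]
    exact h4

/-- `Δ² - 4` has degree `2N` and leading coefficient `(∏ a_k)⁻²`. -/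
lemma discr_sq_natDegree_leadingCoeff [NeZero N] {p : TodaSpace N} (hp : p ∈ complexPhase N) :
    (discr p ^ 2 - 4).natDegree = 2 * N ∧
      (discr p ^ 2 - 4).leadingCoeff = ((∏ k, p.2 k)⁻¹) ^ 2 := by
  obtain ⟨h1, h2⟩ := discr_natDegree_coeff p
  have ha : (∏ k, p.2 k)⁻¹ ≠ 0 := by
    refine inv_ne_zero (Finset.prod_ne_zero_iff.2 fun k _ h => ?_)
    have := hp k
    simp [h] at this
  have hN := NeZero.pos N
  have h4 : (4 : ℂ[X]) = C 4 := (map_ofNat C 4).symm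
  have hc : (discr p ^ 2 - 4).coeff (2 * N) = ((∏ k, p.2 k)⁻¹) ^ 2 := by
    rw [h4, coeff_sub, coeff_C, if_neg (by omega), sub_zero, ← h2]
    exact coeff_pow_of_natDegree_le h1
  have hd : (discr p ^ 2 - 4).natDegree = 2 * N := by
    refine natDegree_eq_of_le_of_coeff_ne_zero ?_ (by rw [hc]; exact pow_ne_zero _ ha)
    rw [h4, natDegree_sub_C]
    exact natDegree_pow_le_of_le 2 h1
  exact ⟨hd, by rw [leadingCoeff, hd, hc]⟩

lemma eigList_length [NeZero N] {p : TodaSpace N} (hp : p ∈ complexPhase N) :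
    (eigList p).length = 2 * N := by
  rw [eigList, Multiset.length_sort, ← (discr_sq_natDegree_leadingCoeff hp).1]
  exact (splits_iff_card_roots.1 (IsAlgClosed.splits _))

/-- The product representation `Δ² - 4 = (∏ a_k)⁻² ∏_j (λ - λ_j)`. -/
lemma discr_sq_eval [NeZero N] {p : TodaSpace N} (hp : p ∈ complexPhase N) (z : ℂ) :
    (discr p).eval z ^ 2 - 4 =
      ((∏ k, p.2 k)⁻¹) ^ 2 * ∏ j ∈ Finset.range (2 * N), (z - eig p (j + 1)) := by
  have h1 : (discr p).eval z ^ 2 - 4 = (discr p ^ 2 - 4).eval z := by simp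
  have h2 := (IsAlgClosed.splits (discr p ^ 2 - 4)).eval_eq_prod_roots z
  rw [h1, h2, (discr_sq_natDegree_leadingCoeff hp).2]
  congr 1
  have h3 : (discr p ^ 2 - 4).roots = (eigList p : Multiset ℂ) := (Multiset.sort_eq _ _).symm
  rw [h3, Multiset.map_coe, Multiset.prod_coe, ← eigList_length hp, Finset.prod_range,
    ← List.prod_ofFn]
  congr 1
  refine List.ext_getElem (by simp) fun i h _ => ?_
  simp at h
  simp [eig]

lemma prod_pairs (f : ℕ → ℂ) (M : ℕ) :
    ∏ j ∈ Finset.range (2 * (M + 1)), f (j + 1) =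
      f 1 * f (2 * (M + 1)) * ∏ m ∈ Finset.Icc 1 M, f (2 * m) * f (2 * m + 1) := by
  induction M with
  | zero => simp [Finset.prod_range_succ]
  | succ M ih =>
    rw [show 2 * (M + 1 + 1) = 2 * (M + 1) + 1 + 1 by ring, Finset.prod_range_succ,
      Finset.prod_range_succ, ih, Finset.prod_Icc_succ_top (by omega)]
    ring

lemma gapRoot_sq (p : TodaSpace N) (m : ℕ) (z : ℂ) (hz : z = mid p m → gap p m = 0) :
    gapRoot p m z ^ 2 = (z - eig p (2 * m)) * (z - eig p (2 * m + 1)) := by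
  rw [gapRoot, mul_pow, principalSqrt_sq]
  by_cases h : z = mid p m
  · have h0 := hz h
    have h1 : eig p (2 * m + 1) = eig p (2 * m) := sub_eq_zero.1 h0
    simp [h, h0, mid, h1]
  · have h' : z - mid p m ≠ 0 := sub_ne_zero.2 h
    have : (z - mid p m) ^ 2 * (1 - (gap p m / 2 / (z - mid p m)) ^ 2)
        = (z - mid p m) ^ 2 - (gap p m / 2) ^ 2 := by field_simp
    rw [this, mid, gap]; ring

/-- The square of the canonical root is `Δ² - 4`. -/
lemma cRoot_sq [NeZero N] {p : TodaSpace N} (hp : p ∈ complexPhase N) (z : ℂ)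
    (hz : ∀ m ∈ Finset.Icc 1 (N - 1), z = mid p m → gap p m = 0) :
    cRoot p z ^ 2 = (discr p).eval z ^ 2 - 4 := by
  have hN := NeZero.pos N
  obtain ⟨M, rfl⟩ : ∃ M, N = M + 1 := ⟨N - 1, by omega⟩
  rw [discr_sq_eval hp, prod_pairs (fun j => z - eig p j), cRoot, mul_pow, mul_pow, mul_pow,
    mul_pow, principalSqrt_sq, principalSqrt_sq, ← Finset.prod_pow,
    Finset.prod_congr rfl fun m hm => gapRoot_sq p m z (hz m hm)]
  simp only [Nat.add_sub_cancel, Complex.I_sq]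
  ring

lemma gapRoot_differentiableAt (p : TodaSpace N) (m : ℕ) (z : ℂ)
    (hz : z ∉ segment ℝ (eig p (2 * m)) (eig p (2 * m + 1))) :
    DifferentiableAt ℂ (gapRoot p m) z := by
  have key : ∀ t : ℝ, t ∈ Set.Icc (-1 : ℝ) 1 → z - mid p m ≠ t * (gap p m / 2) := by
    intro t ht h
    refine hz ⟨(1 - t) / 2, (1 + t) / 2, by linarith [ht.2], by linarith [ht.1], by ring, ?_⟩
    have : z = mid p m + t * (gap p m / 2) := by rw [← h]; ring
    rw [this, mid, gap]
    simp only [Complex.real_smul]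
    push_cast
    ring
  have hne : z - mid p m ≠ 0 := by simpa using key 0 (by norm_num)
  have hs : 1 - (gap p m / 2 / (z - mid p m)) ^ 2 ∈ Complex.slitPlane := by
    by_contra hcon
    rw [Complex.mem_slitPlane_iff, not_or, not_lt, not_not] at hcon
    set w := gap p m / 2 / (z - mid p m) with hw
    have him : (w ^ 2).im = 0 := by simpa using hcon.2
    have hre : 1 ≤ (w ^ 2).re := by
      have := hcon.1
      simp only [Complex.sub_re, Complex.one_re] at this
      linarith
    rw [pow_two, Complex.mul_im] at him
    rw [pow_two, Complex.mul_re] at hre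
    have h0 : w.re * w.im = 0 := by linarith
    have hwi : w.im = 0 := by
      rcases mul_eq_zero.1 h0 with h | h
      · rw [h] at hre; nlinarith [mul_self_nonneg w.im]
      · exact h
    have hsq : 1 ≤ w.re ^ 2 := by rw [hwi] at hre; nlinarith
    have hwr : w.re ≠ 0 := by rintro h; rw [h] at hsq; norm_num at hsq
    have hwre : w = (w.re : ℂ) := Complex.ext rfl (by simp [hwi])
    refine key w.re⁻¹ ?_ ?_
    · rw [Set.mem_Icc, ← abs_le, abs_inv]
      exact inv_le_one_of_one_le₀ ((one_le_sq_iff_one_le_abs _).1 hsq)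
    · have hg : gap p m / 2 = w * (z - mid p m) := by rw [hw]; field_simp
      rw [hg, Complex.ofReal_inv, ← hwre, inv_mul_cancel_left₀]
      rw [hwre]; exact_mod_cast hwr
  have e₀ : DifferentiableAt ℂ (fun z => z - mid p m) z := differentiableAt_id.sub_const _
  have e₁ : DifferentiableAt ℂ (fun z => 1 - (gap p m / 2 / (z - mid p m)) ^ 2) z :=
    (((differentiableAt_const _).div e₀ hne).pow 2).const_sub 1
  exact e₀.mul (e₁.cpow (differentiableAt_const _) hs)

/-- The canonical root is analytic off the closed gaps and the two outer rays. -/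
lemma cRoot_differentiableAt [NeZero N] (p : TodaSpace N) (z : ℂ)
    (h₁ : z - eig p 1 ∈ Complex.slitPlane) (h₂ : eig p (2 * N) - z ∈ Complex.slitPlane)
    (hz : ∀ m ∈ Finset.Icc 1 (N - 1), z ∉ segment ℝ (eig p (2 * m)) (eig p (2 * m + 1))) :
    DifferentiableAt ℂ (cRoot p) z := by
  have e₁ : DifferentiableAt ℂ (fun z => principalSqrt (z - eig p 1)) z :=
    DifferentiableAt.cpow (by fun_prop) (by fun_prop) h₁
  have e₂ : DifferentiableAt ℂ (fun z => principalSqrt (eig p (2 * N) - z)) z :=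
    DifferentiableAt.cpow (by fun_prop) (by fun_prop) h₂
  have e₃ : DifferentiableAt ℂ (fun z => ∏ m ∈ Finset.Icc 1 (N - 1), gapRoot p m z) z :=
    DifferentiableAt.fun_finsetProd fun m hm => gapRoot_differentiableAt p m z (hz m hm)
  unfold cRoot
  exact ((((differentiableAt_const _).mul e₁).mul e₂).const_mul _).mul e₃

lemma principalSqrt_ofReal {x : ℝ} (hx : 0 < x) : ∃ y : ℝ, 0 < y ∧ principalSqrt x = y := by
  refine ⟨x ^ (1 / 2 : ℝ), Real.rpow_pos_of_pos hx _, ?_⟩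
  rw [principalSqrt, Complex.ofReal_cpow hx.le]
  norm_num

/-- For real `(b, a)`, the canonical root is a positive multiple of `i` on the last band. -/
lemma cRoot_sign [NeZero N] {p : TodaSpace N} (hp : p ∈ realPhase N)
    (l : ℕ → ℝ) (hl : ∀ j, eig p j = l j) (hmono : MonotoneOn l (Set.Icc 1 (2 * N)))
    {x : ℝ} (hx₁ : l (2 * N - 1) < x) (hx₂ : x < l (2 * N)) :
    ∃ y : ℝ, 0 < y ∧ -Complex.I * cRoot p x = y := by
  have hN := NeZero.pos N
  have hle : ∀ j, 1 ≤ j → j ≤ 2 * N - 1 → l j < x := fun j h1 h2 =>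
    lt_of_le_of_lt (hmono ⟨h1, by omega⟩ ⟨by omega, by omega⟩ h2) hx₁
  obtain ⟨u, hu, hu'⟩ := principalSqrt_ofReal (sub_pos.2 (hle 1 le_rfl (by omega)))
  obtain ⟨v, hv, hv'⟩ := principalSqrt_ofReal (sub_pos.2 hx₂)
  have hg : ∀ m ∈ Finset.Icc 1 (N - 1), ∃ y : ℝ, 0 < y ∧ gapRoot p m x = y := by
    intro m hm
    rw [Finset.mem_Icc] at hm
    have a1 := hle (2 * m) (by omega) (by omega)
    have a2 := hle (2 * m + 1) (by omega) (by omega)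
    have a3 : l (2 * m) ≤ l (2 * m + 1) :=
      hmono ⟨by omega, by omega⟩ ⟨by omega, by omega⟩ (by omega)
    have hd : 0 < x - (l (2 * m) + l (2 * m + 1)) / 2 := by linarith
    have hq : 0 < 1 - ((l (2 * m + 1) - l (2 * m)) / 2 /
        (x - (l (2 * m) + l (2 * m + 1)) / 2)) ^ 2 := by
      rw [sub_pos, sq_lt_one_iff₀ (by apply div_nonneg <;> linarith), div_lt_one hd]
      linarith
    obtain ⟨s, hs, hs'⟩ := principalSqrt_ofReal hq
    refine ⟨_, mul_pos hd hs, ?_⟩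
    rw [gapRoot, mid, gap, hl, hl, Complex.ofReal_mul, ← hs']
    push_cast
    rfl
  choose! g hg0 hg1 using hg
  have ha : ∀ k, p.2 k = ((p.2 k).re : ℂ) := fun k => Complex.ext rfl (by simp [(hp k).2.1])
  refine ⟨(∏ k, (p.2 k).re)⁻¹ * (u * v) * ∏ m ∈ Finset.Icc 1 (N - 1), g m, ?_, ?_⟩
  · have := Finset.prod_pos fun m hm => hg0 m hm
    have h2 : 0 < ∏ k, (p.2 k).re := Finset.prod_pos fun k _ => (hp k).2.2
    positivity
  · rw [cRoot, Finset.prod_congr rfl hg1, hl, hl]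
    rw [show ∏ k, p.2 k = ((∏ k, (p.2 k).re : ℝ) : ℂ) by
      push_cast; exact Finset.prod_congr rfl fun k _ => ha k]
    rw [← Complex.ofReal_sub, ← Complex.ofReal_sub, hu', hv']
    push_cast
    linear_combination (-((∏ k, ((p.2 k).re : ℂ))⁻¹ * (u * v) *
      ∏ m ∈ Finset.Icc 1 (N - 1), (g m : ℂ))) * Complex.I_sq

end Toda

/-! Near the `n`-th gap the canonical root factors as `gapRoot p n * restRoot p n`. The first factor
satisfies `g ^ 2 = (z - τ) ^ 2 - γ ^ 2 / 4`. The second is analytic and zero-free in the vertical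
strip between the neighbouring eigenvalues. Since `z - τ - g = (γ ^ 2 / 4) / (z - τ + g)`, the
integrand of the action splits into `τ Δ' / √(Δ² - 4)`, the function `Δ' / restRoot`, which
integrates to zero by Cauchy's theorem, and `γ ^ 2 / 4` times `Δ' / (√(Δ² - 4) (z - τ + g))`. Once
the period `∮ Δ' / √(Δ² - 4)` is known to vanish, the action is `γ ^ 2` times `actionQuotient`, an
integral that makes sense for a collapsed gap as well.

The period lies in `2πi ℤ`, because `Δ' / √(Δ² - 4)` is the logarithmic derivative of `Δ + √(Δ² -
4)` (`Isolating.exists_int`). At real points it is also real: `circleIntegral_div_sqrt` turns the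
contour integral into an average over the gap with respect to the arcsine law, and the averaged
quotient is imaginary there. So it is zero at real points and, by continuity and integrality, at all
nearby points.

Analyticity rests on the fact that `gapRoot` involves only `τ` and `γ ^ 2`. These are polynomials in
the power sums of the pair `λ_{2n}`, `λ_{2n+1}`, which are contour integrals of the logarithmic
derivative of `Δ² - 4` (`analyticAt_sum_eig_pow`). The radius of the contour is merely continuous in
`p`, but it can be frozen by Cauchy's theorem, and then the integral is analytic in the parameter
(`analyticAt_circleIntegral`).

Positivity is checked at real points. A conserved current for Floquet solutions shows that `Δ⁻¹([-2,
2])` is real, and Laguerre's inequality then excludes critical points with value in `(-2, 2)`. Hence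
bands have positive length and each closed gap contains exactly one critical point `e`. Because the
period vanishes, `z` may be replaced by `z - e` in the action, and the average over an open gap
becomes that of `(x - e) ^ 2` times a positive function. A collapsed gap is computed directly.
Positivity persists nearby, and the union of these neighbourhoods gives the required open set. -/

/-! ### Analytic dependence of path and circle integrals on a parameter. -/

open MeasureTheory Filter Topology Set in
/-- Averaging the translates of an analytic function along a short path gives an analytic
function. -/
lemma HasFPowerSeriesOnBall.analyticAt_integral_translate {E F : Type*}
    [NormedAddCommGroup E] [NormedSpace ℂ E] [NormedAddCommGroup F] [NormedSpace ℂ F]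
    [CompleteSpace F] {f : E → F} {q : FormalMultilinearSeries ℂ E F} {x₀ : E} {r : ENNReal}
    (hf : HasFPowerSeriesOnBall f q x₀ r) {ρ : NNReal} (hρ0 : 0 < ρ) (hρ : (ρ + ρ : ENNReal) < r)
    {a b : ℝ} {y : ℝ → E} (hy : ContinuousOn y (uIcc a b)) (hyρ : ∀ t ∈ uIcc a b, ‖y t‖₊ ≤ ρ) :
    AnalyticAt ℂ (fun x => ∫ t in a..b, f (x + y t)) x₀ := by
  have hrad : (ρ + ρ : ENNReal) < q.radius := hρ.trans_le hf.r_le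
  have hρr : (ρ : ENNReal) < r := (le_add_right le_rfl).trans_lt hρ
  have hρrad : (ρ : ENNReal) < q.radius := (le_add_right le_rfl).trans_lt hrad
  -- A majorant, uniform in `t`, of the Taylor coefficients at the translated centre. Summability of
  -- `B k * ρ ^ k` uses that twice `ρ` is below the radius: one `ρ` for the translation, one for the
  -- variable.
  set B : ℕ → NNReal := fun k =>
    ∑' s : Σ l : ℕ, { s : Finset (Fin (k + l)) // s.card = l }, ‖q (k + s.1)‖₊ * ρ ^ s.1 with hB
  have hBsum : Summable fun k => B k * ρ ^ k := by
    simpa only [hB, ← NNReal.tsum_mul_right] using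
      (NNReal.summable_sigma.1 (q.changeOriginSeries_summable_aux₁ hrad)).2
  have hcB : ∀ k, ∀ t ∈ uIcc a b, ‖q.changeOrigin (y t) k‖₊ ≤ B k := by
    intro k t ht
    have h1 : (‖y t‖₊ : ENNReal) < q.radius :=
      lt_of_le_of_lt (by exact_mod_cast hyρ t ht) hρrad
    refine (q.nnnorm_changeOrigin_le k h1).trans ?_
    refine Summable.tsum_le_tsum (fun s => ?_) (q.changeOriginSeries_summable_aux₂ h1 k)
      (q.changeOriginSeries_summable_aux₂ hρrad k)
    gcongr
    exact hyρ t ht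
  have hcont : ∀ k, ContinuousOn (fun t => q.changeOrigin (y t) k) (uIcc a b) := by
    intro k
    refine (q.hasFPowerSeriesOnBall_changeOrigin k (hf.r_pos.trans_le hf.r_le)).continuousOn.comp
      hy fun t ht => ?_
    rw [mem_eball_zero_iff]
    exact lt_of_le_of_lt (by exact_mod_cast hyρ t ht) hρrad
  have hint : ∀ k, IntervalIntegrable (fun t => q.changeOrigin (y t) k) volume a b :=
    fun k => (hcont k).intervalIntegrable
  -- The series of the average is the average of the re-expanded series; the majorant allows
  -- exchanging sum and integral.
  let D : FormalMultilinearSeries ℂ E F := fun k => ∫ t in a..b, q.changeOrigin (y t) k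
  refine HasFPowerSeriesOnBall.analyticAt (p := D) (r := ρ) ⟨?_, by exact_mod_cast hρ0, ?_⟩
  · refine D.le_radius_of_summable ?_
    refine Summable.of_nonneg_of_le (fun k => by positivity) (fun k => ?_)
      ((NNReal.summable_coe.2 hBsum).mul_right |b - a|)
    have : ‖D k‖ ≤ B k * |b - a| := by
      refine intervalIntegral.norm_integral_le_of_norm_le_const fun t ht => ?_
      exact_mod_cast hcB k t (uIoc_subset_uIcc ht)
    push_cast
    calc ‖D k‖ * (ρ : ℝ) ^ k ≤ B k * |b - a| * (ρ : ℝ) ^ k := by gcongr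
      _ = _ := by ring
  · intro x hx
    have hx' : ‖x‖₊ < ρ := by rw [mem_eball_zero_iff, enorm_eq_nnnorm] at hx; exact_mod_cast hx
    have hD : ∀ k, D k (fun _ => x) = ∫ t in a..b, q.changeOrigin (y t) k fun _ => x := by
      intro k
      exact ((ContinuousMultilinearMap.apply ℂ (fun _ : Fin k => E) F
        (fun _ => x)).intervalIntegral_comp_comm (hint k)).symm
    simp only [hD]
    refine intervalIntegral.hasSum_integral_of_dominated_convergence
      (fun k _ => (B k : ℝ) * ρ ^ k) (fun k => ?_) (fun k => ?_) ?_ ?_ ?_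
    · refine ContinuousOn.aestronglyMeasurable ?_ measurableSet_uIoc
      exact ((ContinuousMultilinearMap.apply ℂ (fun _ : Fin k => E) F
        (fun _ => x)).continuous.comp_continuousOn (hcont k)).mono uIoc_subset_uIcc
    · refine Eventually.of_forall fun t ht => ?_
      refine (ContinuousMultilinearMap.le_opNorm _ _).trans ?_
      rw [Finset.prod_const, Finset.card_univ, Fintype.card_fin]
      have h1 : ‖q.changeOrigin (y t) k‖ ≤ B k := by
        exact_mod_cast hcB k t (uIoc_subset_uIcc ht)
      have h2 : ‖x‖ ≤ ρ := by exact_mod_cast hx'.le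
      gcongr
    · exact Eventually.of_forall fun t _ => by exact_mod_cast hBsum
    · exact intervalIntegrable_const
    · refine Eventually.of_forall fun t ht => ?_
      have h1 : ‖y t‖₊ ≤ ρ := hyρ t (uIoc_subset_uIcc ht)
      have h2 : (‖y t‖₊ : ENNReal) < r := lt_of_le_of_lt (by exact_mod_cast h1) hρr
      have h3 := (hf.changeOrigin h2).hasSum (y := x) (by
        rw [mem_eball_zero_iff, enorm_eq_nnnorm]
        refine lt_tsub_iff_right.2 (lt_of_le_of_lt ?_ hρ)
        gcongr)
      rwa [add_right_comm] at h3

open MeasureTheory Filter Topology Set in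
-- The path is absorbed into a translation by `(0, c t - v₀)` in the product space, so the averaging
-- lemma applies. The neighbourhood `U` is independent of the path, as required for gluing over a
-- subdivision; integrability is recorded because adjacent integrals will be added.
lemma AnalyticAt.exists_nhds_analyticAt_integral {E V F : Type*}
    [NormedAddCommGroup E] [NormedSpace ℂ E] [NormedAddCommGroup V] [NormedSpace ℂ V]
    [NormedAddCommGroup F] [NormedSpace ℂ F] [CompleteSpace F] {f : E × V → F} {p₀ : E} {v₀ : V}
    (hf : AnalyticAt ℂ f (p₀, v₀)) :
    ∃ U : Set V, IsOpen U ∧ v₀ ∈ U ∧ ∀ (a b : ℝ) (c : ℝ → V), ContinuousOn c (uIcc a b) →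
      (∀ t ∈ uIcc a b, c t ∈ U) →
      (∀ᶠ p in 𝓝 p₀, IntervalIntegrable (fun t => f (p, c t)) volume a b) ∧
      AnalyticAt ℂ (fun p => ∫ t in a..b, f (p, c t)) p₀ := by
  obtain ⟨q, r, hq⟩ := hf
  obtain ⟨s, hs0, hsr⟩ := ENNReal.lt_iff_exists_nnreal_btwn.1 hq.r_pos
  have hs0' : 0 < s := by exact_mod_cast hs0
  have hρ0 : 0 < s / 2 := half_pos hs0'
  have hρ : (((s / 2 : NNReal) : ENNReal) + ((s / 2 : NNReal) : ENNReal)) < r := by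
    rw [← ENNReal.coe_add, add_halves]; exact hsr
  have hlt : ((s / 2 : NNReal) : ENNReal) < r := (le_add_right le_rfl).trans_lt hρ
  refine ⟨Metric.ball v₀ (s / 2 : NNReal), Metric.isOpen_ball,
    Metric.mem_ball_self (by exact_mod_cast hρ0), fun a b c hc hcU => ⟨?_, ?_⟩⟩
  · filter_upwards [Metric.ball_mem_nhds p₀ (show (0 : ℝ) < (s / 2 : NNReal) by exact_mod_cast hρ0)]
      with p hp
    refine ContinuousOn.intervalIntegrable ?_
    refine hq.continuousOn.comp (continuousOn_const.prodMk hc) fun t ht => ?_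
    rw [Metric.mem_eball]
    refine lt_of_lt_of_le ?_ hlt.le
    rw [Prod.edist_eq, max_lt_iff, edist_lt_coe, edist_lt_coe]
    exact ⟨by exact_mod_cast hp, by exact_mod_cast hcU t ht⟩
  · have h := hq.analyticAt_integral_translate hρ0 hρ (a := a) (b := b)
      (y := fun t => (0, c t - v₀)) (continuousOn_const.prodMk (hc.sub continuousOn_const))
      fun t ht => by
        rw [Prod.nnnorm_def, nnnorm_zero, max_eq_right (by positivity)]
        have := hcU t ht
        rw [Metric.mem_ball, dist_eq_norm] at this
        exact_mod_cast this.le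
    have hg : AnalyticAt ℂ (fun p : E => (p, v₀)) p₀ := analyticAt_id.prod analyticAt_const
    have := AnalyticAt.fun_comp (g := fun x => ∫ t in a..b, f (x + (0, c t - v₀))) (f := fun p : E => (p, v₀)) h hg
    simpa using this

open MeasureTheory Filter Topology Set in
/-- The integral along a path of a jointly analytic function depends analytically on the
parameter. -/
theorem analyticAt_intervalIntegral {E V F : Type*}
    [NormedAddCommGroup E] [NormedSpace ℂ E] [NormedAddCommGroup V] [NormedSpace ℂ V]
    [NormedAddCommGroup F] [NormedSpace ℂ F] [CompleteSpace F] {f : E × V → F} {p₀ : E}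
    {a b : ℝ} (hab : a ≤ b) {c : ℝ → V} (hc : Continuous c)
    (hf : ∀ t ∈ Icc a b, AnalyticAt ℂ f (p₀, c t)) :
    AnalyticAt ℂ (fun p => ∫ t in a..b, f (p, c t)) p₀ := by
  choose U hUo hUm hU using fun t : Icc a b => (hf t t.2).exists_nhds_analyticAt_integral
  -- A Lebesgue number subdivision: each piece of the path stays in a single `U i`.
  obtain ⟨t, ht0, htm, ⟨m, hm⟩, hcov⟩ := exists_monotone_Icc_subset_open_cover_Icc hab
    (c := fun i => {s : Icc a b | c s ∈ U i})
    (fun i => (hUo i).preimage (hc.comp continuous_subtype_val))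
    (fun s _ => mem_iUnion.2 ⟨s, hUm s⟩)
  have hstep : ∀ n, (∀ᶠ p in 𝓝 p₀, IntervalIntegrable (fun s => f (p, c s)) volume a (t n)) ∧
      AnalyticAt ℂ (fun p => ∫ s in a..(t n), f (p, c s)) p₀ := by
    intro n
    induction n with
    | zero => simp [ht0, analyticAt_const]
    | succ n ih =>
      obtain ⟨i, hi⟩ := hcov n
      have hle : (t n : ℝ) ≤ t (n + 1) := htm n.le_succ
      obtain ⟨h1, h2⟩ := hU i (t n) (t (n + 1)) c hc.continuousOn fun s hs => by
        rw [uIcc_of_le hle] at hs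
        exact hi (a := ⟨s, (t n).2.1.trans hs.1, hs.2.trans (t (n + 1)).2.2⟩) ⟨hs.1, hs.2⟩
      refine ⟨?_, ?_⟩
      · filter_upwards [ih.1, h1] with p hp hp'
        exact hp.trans hp'
      · refine (ih.2.add h2).congr ?_
        filter_upwards [ih.1, h1] with p hp hp'
        exact intervalIntegral.integral_add_adjacent_intervals hp hp'
  have := (hstep m).2
  rwa [hm m le_rfl] at this

open Set in
/-- A circle integral of a jointly analytic function depends analytically on the parameter, even
if the centre of the circle moves analytically. -/
theorem analyticAt_circleIntegral {E : Type*} [NormedAddCommGroup E] [NormedSpace ℂ E]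
    {f : E × ℂ → ℂ} {p₀ : E} {c : E → ℂ} {R : ℝ} (hR : 0 ≤ R) (hc : AnalyticAt ℂ c p₀)
    (hf : ∀ z ∈ Metric.sphere (c p₀) R, AnalyticAt ℂ f (p₀, z)) :
    AnalyticAt ℂ (fun p => ∮ z in C(c p, R), f (p, z)) p₀ := by
  -- The path is the fixed circle around `0`. The moving centre goes into the integrand, and `q.2 *
  -- I` is the derivative of the parametrisation.
  have := analyticAt_intervalIntegral (f := fun q : E × ℂ => q.2 * Complex.I * f (q.1, c q.1 + q.2))
    (p₀ := p₀) Real.two_pi_pos.le (continuous_circleMap 0 R) fun t _ => by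
      have h1 : AnalyticAt ℂ (fun q : E × ℂ => (q.1, c q.1 + q.2)) (p₀, circleMap 0 R t) :=
        analyticAt_fst.prod ((AnalyticAt.fun_comp (g := c) hc analyticAt_fst).add analyticAt_snd)
      have h2 : AnalyticAt ℂ f (p₀, c p₀ + circleMap 0 R t) := hf _ (by simp [abs_of_nonneg hR])
      exact (analyticAt_snd.mul analyticAt_const).mul (AnalyticAt.fun_comp (g := f) h2 h1)
  simpa [circleIntegral, circleMap] using this

/-! ### The principal root, the arcsine average, and periods of logarithmic derivatives. -/

lemma principalSqrt_ne_zero {z : ℂ} (hz : z ≠ 0) : principalSqrt z ≠ 0 := by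
  intro h
  have := principalSqrt_sq z
  rw [h] at this
  exact hz (by simpa using this.symm)

lemma principalSqrt_re_pos {z : ℂ} (hz : z ∈ Complex.slitPlane) : 0 < (principalSqrt z).re := by
  have h0 : z ≠ 0 := Complex.slitPlane_ne_zero hz
  rw [principalSqrt, Complex.cpow_def_of_ne_zero h0, Complex.exp_re]
  refine mul_pos (Real.exp_pos _) (Real.cos_pos_of_mem_Ioo ?_)
  have h1 := Complex.neg_pi_lt_arg z
  have h2 := lt_of_le_of_ne (Complex.arg_le_pi z) (Complex.mem_slitPlane_iff_arg.1 hz).1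
  have : (Complex.log z * (1 / 2)).im = Complex.arg z / 2 := by
    rw [show Complex.log z * (1 / 2) = ((1 / 2 : ℝ) : ℂ) * Complex.log z by push_cast; ring,
      Complex.im_ofReal_mul, Complex.log_im]
    ring
  rw [this]
  constructor <;> linarith

lemma one_sub_sq_mem_slitPlane {q : ℂ} (hq : ‖q‖ < 1) : 1 - q ^ 2 ∈ Complex.slitPlane := by
  refine Complex.mem_slitPlane_iff.2 (Or.inl ?_)
  have h : (q ^ 2).re ≤ ‖q ^ 2‖ := Complex.re_le_norm _
  rw [norm_pow] at h
  have : ‖q‖ ^ 2 < 1 := by nlinarith [norm_nonneg q]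
  simp only [Complex.sub_re, Complex.one_re]
  linarith

/-- With `v = exp (iθ)` the denominator is `(1 - x v) (1 - x v⁻¹)`. Partial fractions reduce the
integral to the averages of `(1 - x v)⁻¹` and `(1 - x v⁻¹)⁻¹`; the first is `1` by the mean value
property, the second by the symmetry `v ↦ v⁻¹`. -/
lemma integral_inv_one_add_sq_sub_cos {x : ℂ} (hx : ‖x‖ < 1) :
    ∫ θ in (0 : ℝ)..2 * Real.pi, (1 + x ^ 2 - 2 * x * Complex.cos θ)⁻¹ =
      2 * (Real.pi : ℂ) * (1 - x ^ 2)⁻¹ := by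
  have hne : ∀ v : ℂ, ‖v‖ ≤ 1 → 1 - x * v ≠ 0 := by
    intro v hv h
    have h1 : x * v = 1 := (sub_eq_zero.1 h).symm
    have h2 : ‖x * v‖ = 1 := by rw [h1, norm_one]
    rw [norm_mul] at h2
    nlinarith [norm_nonneg x, norm_nonneg v]
  have hA : Real.circleAverage (fun v : ℂ => (1 - x * v)⁻¹) 0 1 = 1 := by
    have : DiffContOnCl ℂ (fun v : ℂ => (1 - x * v)⁻¹) (Metric.ball 0 |1|) := by
      refine DifferentiableOn.diffContOnCl fun v hv => DifferentiableAt.differentiableWithinAt ?_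
      rw [abs_one, closure_ball _ one_ne_zero, mem_closedBall_zero_iff] at hv
      exact DifferentiableAt.inv (by fun_prop) (hne v hv)
    rw [this.circleAverage]
    simp
  have hB : Real.circleAverage (fun v : ℂ => (1 - x * v⁻¹)⁻¹) 0 1 = 1 := by
    exact (Real.circleAverage_zero_one_congr_inv (f := fun v : ℂ => (1 - x * v)⁻¹)).trans hA
  have h1x : (1 - x ^ 2) ≠ 0 := by
    have h := one_sub_sq_mem_slitPlane hx
    exact Complex.slitPlane_ne_zero h
  have hcirc : ∀ θ : ℝ, ‖circleMap 0 1 θ‖ = 1 := by simp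
  have key : ∀ θ : ℝ, (1 + x ^ 2 - 2 * x * Complex.cos θ)⁻¹ =
      (1 - x ^ 2)⁻¹ * ((1 - x * circleMap 0 1 θ)⁻¹ + (1 - x * (circleMap 0 1 θ)⁻¹)⁻¹ - 1) := by
    intro θ
    have hv0 : circleMap 0 1 θ ≠ 0 := by
      rw [← norm_pos_iff, hcirc]; exact one_pos
    have e1 := hne (circleMap 0 1 θ) (hcirc θ).le
    have e2 := hne (circleMap 0 1 θ)⁻¹ (by rw [norm_inv, hcirc]; simp)
    have hcos : 2 * Complex.cos θ = circleMap 0 1 θ + (circleMap 0 1 θ)⁻¹ := by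
      rw [Complex.two_cos, circleMap, neg_mul, Complex.exp_neg]
      simp
    have hD : 1 + x ^ 2 - 2 * x * Complex.cos θ =
        (1 - x * circleMap 0 1 θ) * (1 - x * (circleMap 0 1 θ)⁻¹) := by
      have : 1 + x ^ 2 - 2 * x * Complex.cos θ = 1 + x ^ 2 - x * (2 * Complex.cos θ) := by ring
      rw [this, hcos]
      field_simp
      ring
    rw [hD, mul_inv]
    have : (1 - x * circleMap 0 1 θ)⁻¹ + (1 - x * (circleMap 0 1 θ)⁻¹)⁻¹ - 1 =
        (1 - x ^ 2) * ((1 - x * circleMap 0 1 θ)⁻¹ * (1 - x * (circleMap 0 1 θ)⁻¹)⁻¹) := by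
      generalize hw : (circleMap 0 1 θ)⁻¹ = w at *
      have hvw : circleMap 0 1 θ * w = 1 := by rw [← hw]; exact mul_inv_cancel₀ hv0
      field_simp
      linear_combination (-x ^ 2) * hvw
    rw [this, inv_mul_cancel_left₀ h1x]
  have i1 : IntervalIntegrable (fun θ : ℝ => (1 - x * circleMap 0 1 θ)⁻¹) MeasureTheory.volume
      0 (2 * Real.pi) := by
    refine Continuous.intervalIntegrable ?_ _ _
    exact Continuous.inv₀ (by fun_prop) fun θ => hne _ (hcirc θ).le
  have i2 : IntervalIntegrable (fun θ : ℝ => (1 - x * (circleMap 0 1 θ)⁻¹)⁻¹) MeasureTheory.volume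
      0 (2 * Real.pi) := by
    refine Continuous.intervalIntegrable ?_ _ _
    refine Continuous.inv₀ (continuous_const.sub (continuous_const.mul (Continuous.inv₀
      (by fun_prop) fun θ => ?_))) fun θ => hne _ (by rw [norm_inv, hcirc]; simp)
    rw [← norm_pos_iff, hcirc]; exact one_pos
  simp only [key]
  rw [intervalIntegral.integral_const_mul, intervalIntegral.integral_sub (i1.add i2) (by simp),
    intervalIntegral.integral_add i1 i2]
  have hpi : (Real.pi : ℂ) ≠ 0 := by exact_mod_cast Real.pi_ne_zero
  have hA' : ∫ θ in (0 : ℝ)..2 * Real.pi, (1 - x * circleMap 0 1 θ)⁻¹ = 2 * (Real.pi : ℂ) := by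
    rw [Real.circleAverage_def, Complex.real_smul] at hA
    push_cast at hA
    rwa [inv_mul_eq_one₀ (mul_ne_zero two_ne_zero hpi), eq_comm] at hA
  have hB' : ∫ θ in (0 : ℝ)..2 * Real.pi, (1 - x * (circleMap 0 1 θ)⁻¹)⁻¹ = 2 * (Real.pi : ℂ) := by
    rw [Real.circleAverage_def, Complex.real_smul] at hB
    push_cast at hB
    rwa [inv_mul_eq_one₀ (mul_ne_zero two_ne_zero hpi), eq_comm] at hB
  rw [hA', hB']
  simp
  ring

/-- The substitution `q = 2x / (1 + x ^ 2)` with `x = q / (1 + r)` and `r = √(1 - q ^ 2)` reduces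
this to the preceding integral. The point `x` lies in the unit disc because `x ^ 2 = (1 - r) / (1 +
r)` and `r` has positive real part. -/
lemma integral_inv_one_sub_mul_cos {q : ℂ} (hq : ‖q‖ < 1) :
    ∫ θ in (0 : ℝ)..2 * Real.pi, (1 - q * Complex.cos θ)⁻¹ =
      2 * (Real.pi : ℂ) * (principalSqrt (1 - q ^ 2))⁻¹ := by
  set r := principalSqrt (1 - q ^ 2) with hr
  have hs := one_sub_sq_mem_slitPlane hq
  have hre : 0 < r.re := principalSqrt_re_pos hs
  have hr2 : r ^ 2 = 1 - q ^ 2 := principalSqrt_sq _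
  have hr0 : r ≠ 0 := by rintro h; simp [h] at hre
  have h1r : 1 + r ≠ 0 := by
    intro h
    have := congrArg Complex.re h
    simp at this
    linarith
  have hx : ‖q / (1 + r)‖ < 1 := by
    have h1 : (q / (1 + r)) ^ 2 = (1 - r) / (1 + r) := by
      rw [div_pow, div_eq_div_iff (pow_ne_zero 2 h1r) h1r]
      linear_combination (1 + r) * hr2
    have h2 : ‖q / (1 + r)‖ ^ 2 < 1 := by
      rw [← norm_pow, h1, norm_div, div_lt_one (norm_pos_iff.2 h1r)]
      rw [← sq_lt_sq₀ (norm_nonneg _) (norm_nonneg _), Complex.sq_norm, Complex.sq_norm,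
        Complex.normSq_apply, Complex.normSq_apply]
      simp
      nlinarith
    nlinarith [norm_nonneg (q / (1 + r))]
  have h := integral_inv_one_add_sq_sub_cos hx
  have e : ∀ θ : ℝ, (1 + (q / (1 + r)) ^ 2 - 2 * (q / (1 + r)) * Complex.cos θ)⁻¹ =
      ((1 + r) / 2) * (1 - q * Complex.cos θ)⁻¹ := by
    intro θ
    have : 1 + (q / (1 + r)) ^ 2 - 2 * (q / (1 + r)) * Complex.cos θ =
        (2 / (1 + r)) * (1 - q * Complex.cos θ) := by
      field_simp
      linear_combination hr2
    rw [this, mul_inv, inv_div]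
  have e' : 1 - (q / (1 + r)) ^ 2 = 2 * r / (1 + r) := by
    field_simp
    linear_combination -hr2
  simp only [e] at h
  rw [intervalIntegral.integral_const_mul, e', inv_div] at h
  have h12 : (1 + r) / 2 ≠ 0 := div_ne_zero h1r two_ne_zero
  refine mul_left_cancel₀ h12 (h.trans ?_)
  field_simp

open MeasureTheory Set in
/-- Cauchy's formula for the square root kernel: integrating against
`((z - τ)² - u²)^{-1/2}` along a circle around the segment `[τ - u, τ + u]` averages over the
segment with respect to the arcsine law. -/
theorem circleIntegral_div_sqrt {f : ℂ → ℂ} {τ u : ℂ} {r : ℝ} (hu : ‖u‖ < r)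
    (hf : ∀ z ∈ Metric.closedBall τ r, DifferentiableAt ℂ f z) :
    ∮ z in C(τ, r), f z / ((z - τ) * principalSqrt (1 - (u / (z - τ)) ^ 2)) =
      Complex.I * ∫ θ in (0 : ℝ)..2 * Real.pi, f (τ + u * Complex.cos θ) := by
  have hr : 0 < r := (norm_nonneg _).trans_lt hu
  have hcosn : ∀ θ : ℝ, ‖u * Complex.cos θ‖ < r := by
    intro θ
    rw [norm_mul, ← Complex.ofReal_cos, Complex.norm_real, Real.norm_eq_abs]
    have := Real.abs_cos_le_one θ
    nlinarith [norm_nonneg u]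
  -- The reciprocal root is the mean of the Cauchy kernels with poles `τ + u cos θ`, all inside the
  -- circle. After Fubini, Cauchy's formula evaluates each inner integral.
  have hker : ∀ z ∈ Metric.sphere τ r,
      ((z - τ) * principalSqrt (1 - (u / (z - τ)) ^ 2))⁻¹ =
        (2 * (Real.pi : ℂ))⁻¹ * ∫ θ in (0 : ℝ)..2 * Real.pi, (z - (τ + u * Complex.cos θ))⁻¹ := by
    intro z hz
    have hzn : ‖z - τ‖ = r := by simpa [dist_eq_norm] using hz
    have hz0 : z - τ ≠ 0 := by rw [← norm_pos_iff, hzn]; exact hr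
    have hq : ‖u / (z - τ)‖ < 1 := by rw [norm_div, hzn, div_lt_one hr]; exact hu
    have h := integral_inv_one_sub_mul_cos hq
    have e : ∀ θ : ℝ, (z - (τ + u * Complex.cos θ))⁻¹ =
        (z - τ)⁻¹ * (1 - u / (z - τ) * Complex.cos θ)⁻¹ := by
      intro θ
      rw [← mul_inv]
      congr 1
      field_simp
      ring
    simp only [e]
    rw [intervalIntegral.integral_const_mul, h, mul_inv]
    have hpi : (Real.pi : ℂ) ≠ 0 := by exact_mod_cast Real.pi_ne_zero
    field_simp
  have hne : ∀ t θ : ℝ, circleMap τ r t - (τ + u * Complex.cos θ) ≠ 0 := by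
    intro t θ h
    have h1 : circleMap τ r t - τ = u * Complex.cos θ := by linear_combination h
    have h2 : ‖circleMap τ r t - τ‖ = r := by simp [abs_of_pos hr]
    rw [h1] at h2
    exact (hcosn θ).ne h2
  have hfc : ContinuousOn f (Metric.closedBall τ r) :=
    fun z hz => (hf z hz).continuousAt.continuousWithinAt
  have hfcirc : Continuous fun t : ℝ => f (circleMap τ r t) :=
    hfc.comp_continuous (continuous_circleMap τ r) fun t =>
      Metric.sphere_subset_closedBall (circleMap_mem_sphere τ hr.le t)
  have step1 : ∮ z in C(τ, r), f z / ((z - τ) * principalSqrt (1 - (u / (z - τ)) ^ 2)) =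
      ∮ z in C(τ, r), (2 * (Real.pi : ℂ))⁻¹ * ∫ θ in (0 : ℝ)..2 * Real.pi,
        f z * (z - (τ + u * Complex.cos θ))⁻¹ := by
    refine circleIntegral.integral_congr hr.le fun z hz => ?_
    rw [div_eq_mul_inv, hker z hz, intervalIntegral.integral_const_mul]
    ring
  have step2 : ∀ θ : ℝ, ∮ z in C(τ, r), f z * (z - (τ + u * Complex.cos θ))⁻¹ =
      2 * Real.pi * Complex.I * f (τ + u * Complex.cos θ) := by
    intro θ
    have hd : DiffContOnCl ℂ f (Metric.ball τ r) := by
      refine DifferentiableOn.diffContOnCl fun z hz => (hf z ?_).differentiableWithinAt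
      rwa [closure_ball _ hr.ne'] at hz
    have := hd.circleIntegral_sub_inv_smul (w := τ + u * Complex.cos θ) (by
      simpa [dist_eq_norm] using hcosn θ)
    simp only [smul_eq_mul] at this
    rw [← this]
    congr 1
    ext z
    ring
  rw [step1]
  simp only [circleIntegral, smul_eq_mul] at step2 ⊢
  simp_rw [← intervalIntegral.integral_const_mul]
  have hswap : ∫ t in (0 : ℝ)..2 * Real.pi, ∫ θ in (0 : ℝ)..2 * Real.pi,
        deriv (circleMap τ r) t * ((2 * (Real.pi : ℂ))⁻¹ *
          (f (circleMap τ r t) * (circleMap τ r t - (τ + u * Complex.cos θ))⁻¹)) =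
      ∫ θ in (0 : ℝ)..2 * Real.pi, ∫ t in (0 : ℝ)..2 * Real.pi,
        deriv (circleMap τ r) t * ((2 * (Real.pi : ℂ))⁻¹ *
          (f (circleMap τ r t) * (circleMap τ r t - (τ + u * Complex.cos θ))⁻¹)) := by
    refine intervalIntegral_intervalIntegral_swap ?_
    refine IntegrableOn.mono_set (t := uIcc 0 (2 * Real.pi) ×ˢ uIcc 0 (2 * Real.pi)) ?_
      (prod_mono uIoc_subset_uIcc uIoc_subset_uIcc)
    refine ContinuousOn.integrableOn_compact (isCompact_uIcc.prod isCompact_uIcc)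
      (Continuous.continuousOn ?_)
    refine Continuous.mul ?_ (continuous_const.mul ((hfcirc.comp continuous_fst).mul
      (Continuous.inv₀ ?_ fun x => hne x.1 x.2)))
    · rw [show deriv (circleMap τ r) = fun t => circleMap 0 r t * Complex.I from
        funext fun t => deriv_circleMap τ r t]
      fun_prop
    · fun_prop
  rw [hswap]
  refine intervalIntegral.integral_congr fun θ _ => ?_
  have hpi : (Real.pi : ℂ) ≠ 0 := by exact_mod_cast Real.pi_ne_zero
  have : ∀ t : ℝ, deriv (circleMap τ r) t * ((2 * (Real.pi : ℂ))⁻¹ *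
          (f (circleMap τ r t) * (circleMap τ r t - (τ + u * Complex.cos θ))⁻¹)) =
      (2 * (Real.pi : ℂ))⁻¹ * (deriv (circleMap τ r) t *
          (f (circleMap τ r t) * (circleMap τ r t - (τ + u * Complex.cos θ))⁻¹)) := by
    intro t; ring
  simp only [this]
  rw [intervalIntegral.integral_const_mul, step2]
  field_simp

/-- The integral of a logarithmic derivative along a circle is an integer multiple of `2πi`. -/
theorem circleIntegral_logDeriv_mem_int {G φ : ℂ → ℂ} {c : ℂ} {r : ℝ} (hr : 0 ≤ r)
    (hG : ∀ z ∈ Metric.sphere c r, HasDerivAt G (φ z * G z) z)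
    (hG0 : ∀ z ∈ Metric.sphere c r, G z ≠ 0) (hφ : ContinuousOn φ (Metric.sphere c r)) :
    ∃ k : ℤ, ∮ z in C(c, r), φ z = k * (2 * Real.pi * Complex.I) := by
  have hm : ∀ t, circleMap c r t ∈ Metric.sphere c r := circleMap_mem_sphere c hr
  set h : ℝ → ℂ := fun t => deriv (circleMap c r) t * φ (circleMap c r t) with hh
  have hhc : Continuous h := by
    refine Continuous.mul ?_ (hφ.comp_continuous (continuous_circleMap c r) hm)
    rw [show deriv (circleMap c r) = fun t => circleMap 0 r t * Complex.I from
      funext fun t => deriv_circleMap c r t]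
    fun_prop
  have hI : ∀ t, HasDerivAt (fun t => ∫ s in (0 : ℝ)..t, h s) (h t) t := fun t =>
    hhc.integral_hasStrictDerivAt 0 t |>.hasDerivAt
  have hg : ∀ t, HasDerivAt (fun t => G (circleMap c r t)) (h t * G (circleMap c r t)) t := by
    intro t
    have := (hG _ (hm t)).scomp t (differentiable_circleMap c r t).hasDerivAt
    exact this.congr_deriv (by rw [hh, smul_eq_mul]; ring)
  -- `G` along the circle solves `g' = h g`, so `g * exp (-∫ h)` is constant. As `G` returns to its
  -- nonzero initial value, the exponential of the full integral is `1`.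
  have hconst : ∀ t, HasDerivAt
      (fun t => G (circleMap c r t) * Complex.exp (-∫ s in (0 : ℝ)..t, h s)) 0 t := by
    intro t
    exact ((hg t).mul ((hI t).neg.cexp)).congr_deriv (by ring)
  have heq := is_const_of_deriv_eq_zero (fun t => (hconst t).differentiableAt)
    (fun t => (hconst t).deriv) (2 * Real.pi) 0
  have hper : circleMap c r (2 * Real.pi) = circleMap c r 0 := by
    simpa using periodic_circleMap c r 0
  simp only [hper, intervalIntegral.integral_same, neg_zero, Complex.exp_zero] at heq
  have h1 : Complex.exp (-∫ s in (0 : ℝ)..2 * Real.pi, h s) = 1 :=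
    mul_left_cancel₀ (hG0 _ (hm 0)) heq
  rw [Complex.exp_neg, inv_eq_one] at h1
  exact Complex.exp_eq_one_iff.1 h1

/-! ### Laguerre's inequality and the band structure of a real polynomial. -/

/-- Laguerre's inequality for a product of real linear factors. -/
lemma laguerre_multiset_prod (s : Multiset ℝ) (x : ℝ) :
    let P : ℝ[X] := (s.map fun r => X - C r).prod
    0 ≤ (derivative P).eval x ^ 2 - P.eval x * (derivative (derivative P)).eval x ∧
      (s ≠ 0 → P.eval x ≠ 0 →
        0 < (derivative P).eval x ^ 2 - P.eval x * (derivative (derivative P)).eval x) := by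
  induction s using Multiset.induction_on with
  | empty => simp
  | cons r s ih =>
    simp only [Multiset.map_cons, Multiset.prod_cons] at ih ⊢
    set R : ℝ[X] := (s.map fun r => X - C r).prod
    -- The expression `L(P) = P' ^ 2 - P P''` obeys `L(P Q) = Q ^ 2 L(P) + P ^ 2 L(Q)`, and `L` of a
    -- monic linear factor is `1`.
    have h : (derivative ((X - C r) * R)).eval x ^ 2 -
        ((X - C r) * R).eval x * (derivative (derivative ((X - C r) * R))).eval x =
        R.eval x ^ 2 + (x - r) ^ 2 *
          ((derivative R).eval x ^ 2 - R.eval x * (derivative (derivative R)).eval x) := by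
      simp [derivative_mul]
      ring
    rw [h]
    have h1 := mul_nonneg (sq_nonneg (x - r)) ih.1
    refine ⟨by positivity, fun _ h0 => ?_⟩
    have : R.eval x ≠ 0 := by
      rw [eval_mul] at h0
      exact right_ne_zero_of_mul h0
    positivity

/-- Laguerre's inequality. -/
lemma Polynomial.Splits.laguerre {P : ℝ[X]} (hP : P.Splits) (hd : P.natDegree ≠ 0) {x : ℝ}
    (hx : P.eval x ≠ 0) :
    0 < (derivative P).eval x ^ 2 - P.eval x * (derivative (derivative P)).eval x := by
  have h0 : P.leadingCoeff ≠ 0 := by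
    rw [leadingCoeff_ne_zero]
    rintro rfl
    simp at hd
  have h := (laguerre_multiset_prod P.roots x).2
  have hcard : P.roots ≠ 0 := by
    intro h
    have := splits_iff_card_roots.1 hP
    rw [h] at this
    exact hd this.symm
  rw [hP.eq_prod_roots] at hx ⊢
  simp only [eval_mul, eval_C, derivative_mul, derivative_C, zero_mul, zero_add] at hx ⊢
  have := h hcard (right_ne_zero_of_mul hx)
  have := mul_pos (pow_pos (abs_pos.2 h0) 2) this
  rw [sq_abs] at this
  nlinarith

/-- If all the level sets of levels in `[-2, 2]` of a real polynomial are real, then it has no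
critical point with critical value in `(-2, 2)`. -/
lemma derivative_eval_ne_zero_of_real_levels {d : ℝ[X]} (hd : d.natDegree ≠ 0)
    (hreal : ∀ (z : ℂ) (c : ℝ), |c| ≤ 2 → (d.map Complex.ofRealHom).eval z = c → z.im = 0)
    {x : ℝ} (hx : |d.eval x| < 2) : (derivative d).eval x ≠ 0 := by
  intro h0
  -- All zeros of `d - c` are real, so at a critical point Laguerre's inequality forces `d - c` and
  -- `d''` to have opposite signs. At `c = 2` and `c = -2` the values `d - c` have opposite signs, a
  -- contradiction.
  have key : ∀ c : ℝ, |c| ≤ 2 → d.eval x ≠ c →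
      0 < -((d.eval x - c) * (derivative (derivative d)).eval x) := by
    intro c hc hne
    have hs : (d - C c).Splits := by
      refine Splits.of_splits_map Complex.ofRealHom (IsAlgClosed.splits _) fun z hz => ?_
      have hz' := (mem_roots'.1 hz).2
      rw [IsRoot.def, Polynomial.map_sub, eval_sub, map_C, eval_C, sub_eq_zero] at hz'
      exact ⟨z.re, Complex.ext (by simp) (by simp [hreal z c hc hz'])⟩
    have := hs.laguerre (x := x) (by rwa [natDegree_sub_C]) (by simpa [sub_eq_zero] using hne)
    simpa [h0] using this
  obtain ⟨h1, h2⟩ := abs_lt.1 hx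
  have e1 := key 2 (by norm_num) h2.ne
  have e2 := key (-2) (by norm_num) h1.ne'
  nlinarith

/-- If `Q` vanishes at its critical point `e`, the zero is double; otherwise the intermediate value
theorem gives one zero on each side. Collapsed and open gaps are thus treated together. -/
lemma exists_quadratic_dvd {Q : ℝ[X]} {x e y : ℝ} (hxe : x < e) (hey : e < y)
    (hx : Q.eval x < 0) (hy : Q.eval y < 0) (he : 0 ≤ Q.eval e) (he' : (derivative Q).eval e = 0) :
    ∃ r s : ℝ, x < r ∧ r ≤ e ∧ e ≤ s ∧ s < y ∧ (X - C r) * (X - C s) ∣ Q := by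
  rcases he.eq_or_lt with h | h
  · refine ⟨e, e, hxe, le_rfl, le_rfl, hey, ?_⟩
    have hQ : Q ≠ 0 := by rintro rfl; simp at hx
    rw [← pow_two, ← le_rootMultiplicity_iff hQ]
    exact (one_lt_rootMultiplicity_iff_isRoot hQ).2 ⟨h.symm, he'⟩
  · obtain ⟨r, hr, hr0⟩ := intermediate_value_Ioo hxe.le Q.continuous.continuousOn
      (Set.mem_Ioo.2 ⟨hx, h⟩)
    obtain ⟨s, hs, hs0⟩ := intermediate_value_Ioo' hey.le Q.continuous.continuousOn
      (Set.mem_Ioo.2 ⟨hy, h⟩)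
    refine ⟨r, s, hr.1, hr.2.le, hs.1.le, hs.2, IsCoprime.mul_dvd ?_ (dvd_iff_isRoot.2 hr0)
      (dvd_iff_isRoot.2 hs0)⟩
    exact isCoprime_X_sub_C_of_isUnit_sub (sub_ne_zero.2 (hr.2.trans hs.1).ne).isUnit

lemma isCoprime_X_sub_C_of_ne {a b : ℝ} (h : a ≠ b) : IsCoprime (X - C a) (X - C b) :=
  isCoprime_X_sub_C_of_isUnit_sub (sub_ne_zero.2 h).isUnit

/-- The roots of a real polynomial with real level sets, in increasing order. -/
lemma exists_strictMono_roots {d : ℝ[X]} {N : ℕ} (hd : d.natDegree = N) (hN : N ≠ 0)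
    (hreal : ∀ (z : ℂ) (c : ℝ), |c| ≤ 2 → (d.map Complex.ofRealHom).eval z = c → z.im = 0) :
    ∃ x : ℕ → ℝ, (∀ i j, i < j → j < N → x i < x j) ∧ ∀ j < N, d.eval (x j) = 0 := by
  have hs : d.Splits := by
    refine Splits.of_splits_map Complex.ofRealHom (IsAlgClosed.splits _) fun z hz => ?_
    have hz' := (mem_roots'.1 hz).2
    exact ⟨z.re, Complex.ext (by simp) (by simp [hreal z 0 (by norm_num) (by simpa using hz')])⟩
  have hd0 : d ≠ 0 := by rintro rfl; simp at hd; exact hN hd.symm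
  -- A multiple zero would be a critical point with value `0`, inside `(-2, 2)`.
  have hnd : d.roots.Nodup := by
    rw [Multiset.nodup_iff_count_le_one]
    intro a
    rw [count_roots]
    by_contra hcon
    obtain ⟨h2, h1⟩ := (one_lt_rootMultiplicity_iff_isRoot hd0).1 (not_le.1 hcon)
    exact derivative_eval_ne_zero_of_real_levels (by omega) hreal (x := a)
      (by rw [IsRoot.def.1 h2]; norm_num) h1
  have hcard : d.roots.toFinset.card = N := by
    rw [Multiset.toFinset_card_of_nodup hnd, splits_iff_card_roots.1 hs, hd]
  let f := d.roots.toFinset.orderEmbOfFin hcard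
  refine ⟨fun j => if h : j < N then f ⟨j, h⟩ else 0, fun i j hij hj => ?_, fun j hj => ?_⟩
  · simp only [hj, hij.trans hj, dif_pos]
    exact f.strictMono (by simpa using hij)
  · simp only [hj, dif_pos]
    have := Finset.orderEmbOfFin_mem d.roots.toFinset hcard ⟨j, hj⟩
    exact (mem_roots'.1 (Multiset.mem_toFinset.1 this)).2

/-- The band structure of a real polynomial `d` all of whose level sets of levels in `[-2, 2]` are
real: the zeros `l` of `d ^ 2 - 4` and the critical points `e` of `d`. -/
theorem exists_band_structure {d : ℝ[X]} {N : ℕ} (hd : d.natDegree = N) (hN : N ≠ 0)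
    (hreal : ∀ (z : ℂ) (c : ℝ), |c| ≤ 2 → (d.map Complex.ofRealHom).eval z = c → z.im = 0) :
    ∃ l e : ℕ → ℝ, (∀ j, 1 ≤ j → j ≤ N → l (2 * j - 1) < l (2 * j)) ∧
      (∀ m, 1 ≤ m → m ≤ N - 1 → l (2 * m) ≤ e m ∧ e m ≤ l (2 * m + 1)) ∧
      d ^ 2 - 4 = C (d.leadingCoeff ^ 2) * ((X - C (l 1)) * (X - C (l (2 * N))) *
        ∏ m ∈ Finset.Icc 1 (N - 1), ((X - C (l (2 * m))) * (X - C (l (2 * m + 1))))) ∧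
      derivative d = C (N * d.leadingCoeff) * ∏ m ∈ Finset.Icc 1 (N - 1), (X - C (e m)) := by
  obtain ⟨x, hxmono, hx0⟩ := exists_strictMono_roots hd hN hreal
  have hd0 : d ≠ 0 := by rintro rfl; simp at hd; exact hN hd.symm
  set Q := d ^ 2 - 4 with hQ
  have h4 : (4 : ℝ[X]) = C 4 := (map_ofNat C 4).symm
  have hQev : ∀ y, Q.eval y = d.eval y ^ 2 - 4 := fun y => by simp [hQ]
  have hQx : ∀ j < N, Q.eval (x j) < 0 := fun j hj => by
    rw [hQev, hx0 j hj]; norm_num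
  -- Rolle's theorem between consecutive zeros of `d`; the critical value cannot lie in `(-2, 2)`,
  -- hence `Q` is nonnegative there.
  have hcrit : ∀ m, 1 ≤ m → m ≤ N - 1 → ∃ e, x (m - 1) < e ∧ e < x m ∧
      (derivative d).eval e = 0 ∧ 0 ≤ Q.eval e := by
    intro m h1 h2
    obtain ⟨e, he, he0⟩ := exists_deriv_eq_zero (f := fun y => d.eval y)
      (hxmono (m - 1) m (by omega) (by omega)) d.continuous.continuousOn
      (by rw [hx0 _ (by omega), hx0 _ (by omega)])
    rw [Polynomial.deriv] at he0
    refine ⟨e, he.1, he.2, he0, ?_⟩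
    by_contra hcon
    rw [hQev, not_le] at hcon
    refine derivative_eval_ne_zero_of_real_levels (by omega) hreal (x := e) ?_ he0
    exact abs_lt_of_sq_lt_sq (by linarith) (by norm_num)
  choose! e he1 he2 he3 he4 using hcrit
  have hpair : ∀ m, 1 ≤ m → m ≤ N - 1 → ∃ r s : ℝ, x (m - 1) < r ∧ r ≤ e m ∧ e m ≤ s ∧ s < x m ∧
      (X - C r) * (X - C s) ∣ Q := by
    intro m h1 h2
    refine exists_quadratic_dvd (he1 m h1 h2) (he2 m h1 h2) (hQx _ (by omega)) (hQx _ (by omega))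
      (he4 m h1 h2) ?_
    simp [hQ, h4, derivative_pow, he3 m h1 h2]
  choose! r s hr1 hr2 hs1 hs2 hdvd using hpair
  have hdeg : 0 < d.degree := by
    rw [← natDegree_pos_iff_degree_pos]; omega
  -- Since `|d|` tends to infinity at both ends, `Q` changes sign once more beyond each extreme zero
  -- of `d`; this yields the two outer zeros `a` and `b`.
  have hends : ∀ (F : Filter ℝ) (_ : F.NeBot), Filter.Tendsto (fun y : ℝ => ‖y‖) F Filter.atTop →
      ∀ᶠ y in F, 0 < Q.eval y := by
    intro F _ hF
    filter_upwards [(d.tendsto_norm_atTop hdeg hF).eventually_gt_atTop 2] with y hy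
    rw [hQev, ← sq_abs, ← Real.norm_eq_abs]
    nlinarith
  obtain ⟨y₀, hy₀, hy₀'⟩ := ((hends Filter.atBot inferInstance
    Filter.tendsto_abs_atBot_atTop).and (Filter.eventually_lt_atBot (x 0))).exists
  obtain ⟨y₁, hy₁, hy₁'⟩ := ((hends Filter.atTop inferInstance
    Filter.tendsto_abs_atTop_atTop).and (Filter.eventually_gt_atTop (x (N - 1)))).exists
  obtain ⟨a, ha, ha0⟩ := intermediate_value_Ioo' hy₀'.le Q.continuous.continuousOn
      (Set.mem_Ioo.2 ⟨hQx 0 (by omega), hy₀⟩)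
  obtain ⟨b, hb, hb0⟩ := intermediate_value_Ioo hy₁'.le Q.continuous.continuousOn
      (Set.mem_Ioo.2 ⟨hQx (N - 1) (by omega), hy₁⟩)
  have hxle : ∀ i j, i ≤ j → j < N → x i ≤ x j := fun i j hij hj => by
    rcases hij.eq_or_lt with rfl | h
    · exact le_rfl
    · exact (hxmono i j h hj).le
  have hrs : ∀ m, 1 ≤ m → m ≤ N - 1 → r m ≤ s m := fun m h1 h2 =>
    (hr2 m h1 h2).trans (hs1 m h1 h2)
  have har : ∀ m, 1 ≤ m → m ≤ N - 1 → a < r m := fun m h1 h2 =>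
    ha.2.trans ((hxle 0 (m - 1) (by omega) (by omega)).trans_lt (hr1 m h1 h2))
  have hsb : ∀ m, 1 ≤ m → m ≤ N - 1 → s m < b := fun m h1 h2 =>
    (hs2 m h1 h2).trans_le ((hxle m (N - 1) h2 (by omega)).trans hb.1.le)
  have hab : a < b := ha.2.trans_le ((hxle 0 (N - 1) (by omega) (by omega)).trans hb.1.le)
  have hsr : ∀ m m', 1 ≤ m → m < m' → m' ≤ N - 1 → s m < r m' := fun m m' h1 h2 h3 =>
    (hs2 m h1 (by omega)).trans_le ((hxle m (m' - 1) (by omega) (by omega)).trans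
      (hr1 m' (by omega) h3).le)
  have hcop : ∀ m m', 1 ≤ m → m < m' → m' ≤ N - 1 →
      IsCoprime ((X - C (r m)) * (X - C (s m))) ((X - C (r m')) * (X - C (s m'))) := by
    intro m m' h1 h2 h3
    have e1 := hsr m m' h1 h2 h3
    have e2 := hrs m h1 (by omega)
    have e3 := hrs m' (by omega) h3
    refine IsCoprime.mul_left (IsCoprime.mul_right ?_ ?_) (IsCoprime.mul_right ?_ ?_) <;>
      refine isCoprime_X_sub_C_of_ne (ne_of_lt ?_) <;> linarith
  have hA : ∏ m ∈ Finset.Icc 1 (N - 1), ((X - C (r m)) * (X - C (s m))) ∣ Q := by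
    refine Finset.prod_dvd_of_coprime (fun m hm m' hm' hne => ?_) fun m hm => ?_
    · simp only [Finset.coe_Icc, Set.mem_Icc] at hm hm'
      rcases lt_or_gt_of_ne hne with h | h
      · exact hcop m m' hm.1 h hm'.2
      · exact (hcop m' m hm'.1 h hm.2).symm
    · rw [Finset.mem_Icc] at hm
      exact hdvd m hm.1 hm.2
  -- The `N - 1` pairs and the two outer zeros account for `2 * N` zeros, the full degree of `Q`. In
  -- the same way the `N - 1` distinct points `e m` exhaust the zeros of `d'`.
  have hall : (X - C a) * (X - C b) *
      ∏ m ∈ Finset.Icc 1 (N - 1), ((X - C (r m)) * (X - C (s m))) ∣ Q := by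
    refine IsCoprime.mul_dvd (IsCoprime.prod_right fun m hm => ?_)
      (IsCoprime.mul_dvd (isCoprime_X_sub_C_of_ne hab.ne) (dvd_iff_isRoot.2 ha0)
        (dvd_iff_isRoot.2 hb0)) hA
    rw [Finset.mem_Icc] at hm
    have e1 := har m hm.1 hm.2
    have e2 := hrs m hm.1 hm.2
    have e3 := hsb m hm.1 hm.2
    refine IsCoprime.mul_left (IsCoprime.mul_right ?_ ?_) (IsCoprime.mul_right ?_ ?_) <;>
      refine isCoprime_X_sub_C_of_ne ?_ <;> intro h <;> linarith
  have hmonic : ((X - C a) * (X - C b) *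
      ∏ m ∈ Finset.Icc 1 (N - 1), ((X - C (r m)) * (X - C (s m)))).Monic :=
    ((monic_X_sub_C a).mul (monic_X_sub_C b)).mul
      (monic_prod_of_monic _ _ fun m _ => (monic_X_sub_C _).mul (monic_X_sub_C _))
  have hmdeg : ((X - C a) * (X - C b) *
      ∏ m ∈ Finset.Icc 1 (N - 1), ((X - C (r m)) * (X - C (s m)))).natDegree = 2 * N := by
    rw [((monic_X_sub_C a).mul (monic_X_sub_C b)).natDegree_mul
      (monic_prod_of_monic _ _ fun m _ => (monic_X_sub_C _).mul (monic_X_sub_C _)),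
      (monic_X_sub_C a).natDegree_mul (monic_X_sub_C b), natDegree_prod_of_monic _ _
        fun m _ => (monic_X_sub_C _).mul (monic_X_sub_C _)]
    simp only [(monic_X_sub_C _).natDegree_mul (monic_X_sub_C _), natDegree_X_sub_C]
    simp
    omega
  have hQdeg : Q.natDegree = 2 * N := by
    rw [hQ, h4, natDegree_sub_C, natDegree_pow, hd]
  have hQlead : Q.leadingCoeff = d.leadingCoeff ^ 2 := by
    rw [← leadingCoeff_pow, leadingCoeff, leadingCoeff, hQdeg, natDegree_pow, hd, hQ, h4, coeff_sub,
      coeff_C, if_neg (by omega), sub_zero]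
  have hQeq := eq_leadingCoeff_mul_of_monic_of_dvd_of_natDegree_le hmonic hall
    (by rw [hmdeg, hQdeg])
  have hd'deg : (derivative d).natDegree = N - 1 := by
    rw [natDegree_derivative, hd]
  have hd'lead : (derivative d).leadingCoeff = N * d.leadingCoeff := by
    rw [leadingCoeff, hd'deg, coeff_derivative, Nat.sub_add_cancel (by omega), leadingCoeff, hd,
      mul_comm]
    congr 1
    rw [← Nat.cast_add_one, Nat.sub_add_cancel (by omega)]
  have hemonic : (∏ m ∈ Finset.Icc 1 (N - 1), (X - C (e m))).Monic :=
    monic_prod_of_monic _ _ fun m _ => monic_X_sub_C _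
  have hedvd : ∏ m ∈ Finset.Icc 1 (N - 1), (X - C (e m)) ∣ derivative d := by
    have hlt : ∀ m m', 1 ≤ m → m < m' → m' ≤ N - 1 → e m < e m' := fun m m' h1 h2 h3 =>
      (hs1 m h1 (by omega)).trans_lt ((hsr m m' h1 h2 h3).trans_le (hr2 m' (by omega) h3))
    refine Finset.prod_dvd_of_coprime (fun m hm m' hm' hne => ?_) fun m hm => ?_
    · simp only [Finset.coe_Icc, Set.mem_Icc] at hm hm'
      refine isCoprime_X_sub_C_of_ne ?_
      rcases lt_or_gt_of_ne hne with h | h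
      · exact (hlt m m' hm.1 h hm'.2).ne
      · exact (hlt m' m hm'.1 h hm.2).ne'
    · rw [Finset.mem_Icc] at hm
      exact dvd_iff_isRoot.2 (he3 m hm.1 hm.2)
  have hd'eq := eq_leadingCoeff_mul_of_monic_of_dvd_of_natDegree_le hemonic hedvd
    (by rw [natDegree_prod_of_monic _ _ fun m _ => monic_X_sub_C _, hd'deg]; simp)
  -- The indices `1` and `2 * N` are tested before parity, because `r` and `s` are meaningful only
  -- for `1 ≤ m ≤ N - 1`.
  let l : ℕ → ℝ := fun j => if j = 1 then a else if j = 2 * N then b else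
    if j % 2 = 0 then r (j / 2) else s (j / 2)
  have hl1 : l 1 = a := by simp [l]
  have hl2 : l (2 * N) = b := by
    simp only [l]; rw [if_neg (by omega), if_pos trivial]
  have hlr : ∀ m, 1 ≤ m → m ≤ N - 1 → l (2 * m) = r m := fun m h1 h2 => by
    simp only [l]
    rw [if_neg (by omega), if_neg (by omega), if_pos (by omega), Nat.mul_div_cancel_left _ two_pos]
  have hls : ∀ m, 1 ≤ m → m ≤ N - 1 → l (2 * m + 1) = s m := fun m h1 h2 => by
    simp only [l]
    rw [if_neg (by omega), if_neg (by omega), if_neg (by omega)]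
    congr 1
    omega
  refine ⟨l, e, fun j h1 h2 => ?_, fun m h1 h2 => ?_, ?_, ?_⟩
  -- The zero `x (j - 1)` of `d` lies strictly inside the `j`-th band and so separates its ends.
  · have e1 : l (2 * j - 1) < x (j - 1) := by
      rcases h1.eq_or_lt with rfl | h
      · simpa [hl1] using ha.2
      · rw [show 2 * j - 1 = 2 * (j - 1) + 1 by omega, hls _ (by omega) (by omega)]
        exact hs2 _ (by omega) (by omega)
    have e2 : x (j - 1) < l (2 * j) := by
      rcases h2.eq_or_lt with rfl | h
      · simpa [hl2] using hb.1
      · rw [hlr _ h1 (by omega)]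
        exact hr1 _ (by omega) (by omega)
    exact e1.trans e2
  · rw [hlr m h1 h2, hls m h1 h2]
    exact ⟨hr2 m h1 h2, hs1 m h1 h2⟩
  · rw [hl1, hl2, hQeq, hQlead]
    congr 2
    refine Finset.prod_congr rfl fun m hm => ?_
    rw [Finset.mem_Icc] at hm
    rw [hlr m hm.1 hm.2, hls m hm.1 hm.2]
  · rw [hd'eq, hd'lead]

/-! ### Floquet solutions and the reality of the spectrum. -/

namespace Toda

variable {N : ℕ}

lemma solution_eval_succ_succ (p : TodaSpace N) (u₀ u₁ z : ℂ) (k : ℕ)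
    (ha : p.2 ((k + 1 : ℕ) : ZMod N) ≠ 0) :
    p.2 ((k + 1 : ℕ) : ZMod N) * (solution p u₀ u₁ (k + 2)).eval z =
      (z - p.1 ((k + 1 : ℕ) : ZMod N)) * (solution p u₀ u₁ (k + 1)).eval z -
        p.2 (k : ZMod N) * (solution p u₀ u₁ k).eval z := by
  simp only [solution, eval_mul, eval_sub, eval_C, eval_X]
  rw [mul_inv_cancel_left₀ ha]

lemma solution_eval_linear (p : TodaSpace N) (u₀ u₁ z : ℂ) (k : ℕ) :
    (solution p u₀ u₁ k).eval z = u₀ * (y₁ p k).eval z + u₁ * (y₂ p k).eval z ∧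
      (solution p u₀ u₁ (k + 1)).eval z =
        u₀ * (y₁ p (k + 1)).eval z + u₁ * (y₂ p (k + 1)).eval z := by
  induction k with
  | zero => simp [solution, y₁, y₂]
  | succ k ih =>
    refine ⟨ih.2, ?_⟩
    have h : ∀ v₀ v₁, (solution p v₀ v₁ (k + 1 + 1)).eval z = (p.2 ((k + 1 : ℕ) : ZMod N))⁻¹ *
        ((z - p.1 ((k + 1 : ℕ) : ZMod N)) * (solution p v₀ v₁ (k + 1)).eval z -
          p.2 (k : ZMod N) * (solution p v₀ v₁ k).eval z) := by
      intro v₀ v₁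
      simp only [solution, eval_mul, eval_sub, eval_C, eval_X]
    simp only [y₁, y₂] at ih ⊢
    rw [h, ih.1, ih.2, h, h]
    ring

/-- The Wronskian identity. -/
lemma wronskian (p : TodaSpace N) (hp : ∀ k, p.2 k ≠ 0) (z : ℂ) (k : ℕ) :
    p.2 (k : ZMod N) * ((y₁ p k).eval z * (y₂ p (k + 1)).eval z -
      (y₁ p (k + 1)).eval z * (y₂ p k).eval z) = p.2 0 := by
  induction k with
  | zero => simp [solution, y₁, y₂]
  | succ k ih =>
    have h1 := solution_eval_succ_succ p 1 0 z k (hp _)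
    have h2 := solution_eval_succ_succ p 0 1 z k (hp _)
    rw [← ih]
    simp only [y₁, y₂] at *
    linear_combination (solution p 1 0 (k + 1)).eval z * h2 -
      (solution p 0 1 (k + 1)).eval z * h1

/-- At a point where the discriminant is `w + w⁻¹`, there is a Floquet solution with multiplier
`w`. -/
lemma exists_floquet [NeZero N] (p : TodaSpace N) (hp : ∀ k, p.2 k ≠ 0) {z w : ℂ}
    (hw : w ^ 2 - (discr p).eval z * w + 1 = 0) :
    ∃ u₀ u₁ : ℂ, (u₀ ≠ 0 ∨ u₁ ≠ 0) ∧ (solution p u₀ u₁ N).eval z = w * u₀ ∧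
      (solution p u₀ u₁ (N + 1)).eval z = w * u₁ := by
  have hW := wronskian p hp z N
  rw [ZMod.natCast_self] at hW
  have hW' := mul_left_cancel₀ (hp 0) (hW.trans (mul_one _).symm)
  rw [discr, eval_add] at hw
  -- The determinant is the characteristic polynomial of the monodromy matrix, whose trace is `Δ`
  -- and whose determinant is `1` by the Wronskian identity and periodicity of `a`.
  obtain ⟨v, hv0, hv⟩ := Matrix.exists_mulVec_eq_zero_iff.2
    (show (!![(y₁ p N).eval z - w, (y₂ p N).eval z;
      (y₁ p (N + 1)).eval z, (y₂ p (N + 1)).eval z - w]).det = 0 by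
      rw [Matrix.det_fin_two_of]
      linear_combination hw + hW')
  have h0 := congrFun hv 0
  have h1 := congrFun hv 1
  simp [Matrix.mulVec, dotProduct, Fin.sum_univ_two] at h0 h1
  refine ⟨v 0, v 1, ?_, ?_, ?_⟩
  · by_contra hcon
    push Not at hcon
    exact hv0 (funext fun i => by fin_cases i <;> simp [hcon.1, hcon.2])
  · rw [(solution_eval_linear p (v 0) (v 1) z N).1]
    linear_combination h0
  · rw [(solution_eval_linear p (v 0) (v 1) z N).2]
    linear_combination h1

/-- For real `(b, a)`, the spectrum `Δ⁻¹([-2, 2])` is real. -/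
theorem im_eq_zero_of_discr_eval [NeZero N] {p : TodaSpace N} (hp : p ∈ realPhase N) {z : ℂ}
    {c : ℝ} (hc : |c| ≤ 2) (hz : (discr p).eval z = c) : z.im = 0 := by
  have ha : ∀ k, p.2 k ≠ 0 := fun k h => by
    have := (hp k).2.2
    simp [h] at this
  have hc2 : 0 ≤ 1 - c ^ 2 / 4 := by nlinarith [abs_nonneg c, sq_abs c]
  set s := Real.sqrt (1 - c ^ 2 / 4) with hs
  have hs2 : s ^ 2 = 1 - c ^ 2 / 4 := Real.sq_sqrt hc2
  -- The root of `w ^ 2 - c w + 1` in the closed upper half plane; it has modulus one because `|c| ≤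
  -- 2`.
  set w : ℂ := ⟨c / 2, s⟩ with hwdef
  have hwn : Complex.normSq w = 1 := by
    rw [Complex.normSq_apply]
    simp only [hwdef]
    nlinarith
  have hw : w ^ 2 - (discr p).eval z * w + 1 = 0 := by
    rw [hz]
    apply Complex.ext
    · simp [hwdef, pow_two]; nlinarith
    · simp [hwdef, pow_two]; ring
  obtain ⟨u₀, u₁, hu, hN0, hN1⟩ := exists_floquet p ha hw
  by_contra him
  set Y : ℕ → ℂ := fun k => (solution p u₀ u₁ k).eval z with hY
  have hY0 : Y 0 = u₀ := by simp [hY, solution]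
  have hY1 : Y 1 = u₁ := by simp [hY, solution]
  -- The current, that is, the Wronskian of `Y` with its conjugate. It grows by `Im z * |Y| ^ 2` at
  -- each step, yet it is periodic because the multiplier has modulus one. If `Im z ≠ 0`, then `Y`
  -- vanishes on a whole period, contradicting nontriviality.
  set J : ℕ → ℝ := fun k => (p.2 (k : ZMod N)).re * (Y (k + 1) * starRingEnd ℂ (Y k)).im with hJ
  have hre : ∀ k, p.2 k = ((p.2 k).re : ℂ) := fun k => Complex.ext rfl (by simp [(hp k).2.1])
  have hstep : ∀ k, J (k + 1) - J k = z.im * Complex.normSq (Y (k + 1)) := by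
    intro k
    have h : p.2 ((k + 1 : ℕ) : ZMod N) * Y (k + 1 + 1) =
      (z - p.1 ((k + 1 : ℕ) : ZMod N)) * Y (k + 1) - p.2 (k : ZMod N) * Y k :=
      solution_eval_succ_succ p u₀ u₁ z k (ha _)
    clear_value Y
    have h' := congrArg (fun x => (x * starRingEnd ℂ (Y (k + 1))).im) h
    simp only [hJ]
    rw [hre ((k + 1 : ℕ) : ZMod N), hre (k : ZMod N)] at h'
    have hb : (p.1 ((k + 1 : ℕ) : ZMod N)).im = 0 := (hp _).1
    simp [Complex.normSq_apply] at h' ⊢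
    push_cast at hb
    rw [hb] at h'
    linear_combination h'
  have hsum : J N - J 0 = ∑ k ∈ Finset.range N, z.im * Complex.normSq (Y (k + 1)) := by
    rw [← Finset.sum_range_sub]
    exact Finset.sum_congr rfl fun k _ => hstep k
  have hJN : J N = J 0 := by
    simp only [hJ, ZMod.natCast_self, Nat.cast_zero]
    congr 1
    have e0 : Y N = w * u₀ := hN0
    have e1 : Y (N + 1) = w * u₁ := hN1
    rw [e0, e1, zero_add, hY0, hY1, map_mul,
      show w * u₁ * (starRingEnd ℂ w * starRingEnd ℂ u₀) =
        (w * starRingEnd ℂ w) * (u₁ * starRingEnd ℂ u₀) by ring, Complex.mul_conj, hwn]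
    simp
  rw [hJN, sub_self, ← Finset.mul_sum, eq_comm, mul_eq_zero, or_iff_right him,
    Finset.sum_eq_zero_iff_of_nonneg fun k _ => Complex.normSq_nonneg _] at hsum
  have hzero : ∀ k < N, Y (k + 1) = 0 := fun k hk =>
    Complex.normSq_eq_zero.1 (hsum k (Finset.mem_range.2 hk))
  have hNpos := NeZero.pos N
  have h1 : u₁ = 0 := by rw [← hY1]; exact hzero 0 hNpos
  have h2 : Y N = 0 := by
    have := hzero (N - 1) (by omega)
    rwa [Nat.sub_add_cancel hNpos] at this
  have h3 : w ≠ 0 := by rintro h; rw [h] at hwn; simp at hwn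
  have h4 : u₀ = 0 := by
    have : w * u₀ = 0 := hN0.symm.trans h2
    exact (mul_eq_zero.1 this).resolve_left h3
  tauto

lemma exists_real_solution {p : TodaSpace N} (hp : p ∈ realPhase N) (u₀ u₁ : ℝ) (k : ℕ) :
    (∃ d : ℝ[X], d.map Complex.ofRealHom = solution p u₀ u₁ k) ∧
      ∃ d : ℝ[X], d.map Complex.ofRealHom = solution p u₀ u₁ (k + 1) := by
  have ha : ∀ k, p.2 k = ((p.2 k).re : ℂ) := fun k => Complex.ext rfl (by simp [(hp k).2.1])
  have hb : ∀ k, p.1 k = ((p.1 k).re : ℂ) := fun k => Complex.ext rfl (by simp [(hp k).1])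
  induction k with
  | zero => exact ⟨⟨C u₀, by simp [solution]⟩, ⟨C u₁, by simp [solution]⟩⟩
  | succ k ih =>
    refine ⟨ih.2, ?_⟩
    obtain ⟨⟨d, hd⟩, ⟨e, he⟩⟩ := ih
    refine ⟨C ((p.2 ((k + 1 : ℕ) : ZMod N)).re)⁻¹ *
      ((X - C (p.1 ((k + 1 : ℕ) : ZMod N)).re) * e - C (p.2 (k : ZMod N)).re * d), ?_⟩
    simp only [solution, ← hd, ← he]
    rw [ha ((k + 1 : ℕ) : ZMod N), hb ((k + 1 : ℕ) : ZMod N), ha (k : ZMod N)]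
    simp

lemma exists_real_discr {p : TodaSpace N} (hp : p ∈ realPhase N) :
    ∃ d : ℝ[X], d.map Complex.ofRealHom = discr p := by
  obtain ⟨d, hd⟩ := (exists_real_solution hp 1 0 N).1
  obtain ⟨e, he⟩ := (exists_real_solution hp 0 1 N).2
  exact ⟨d + e, by rw [Polynomial.map_add, hd, he]; simp [discr, y₁, y₂]⟩

lemma realPhase_subset : realPhase N ⊆ complexPhase N := fun _ hp k => (hp k).2.2

lemma lexLe_ofReal {x y : ℝ} : lexLe x y ↔ x ≤ y := by
  rw [le_iff_lt_or_eq]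
  simp [lexLe]

lemma eigList_eq_of_sorted [NeZero N] {p : TodaSpace N} (hp : p ∈ complexPhase N) {l : List ℂ}
    (hl : l.Pairwise lexLe)
    (h : discr p ^ 2 - 4 = C (((∏ k, p.2 k)⁻¹) ^ 2) * (l.map fun a => X - C a).prod) :
    eigList p = l := by
  have h0 : ((∏ k, p.2 k)⁻¹) ^ 2 ≠ 0 := by
    refine pow_ne_zero _ (inv_ne_zero (Finset.prod_ne_zero_iff.2 fun k _ h => ?_))
    have := hp k
    simp [h] at this
  have hr : (discr p ^ 2 - 4).roots = (l : Multiset ℂ) := by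
    rw [h, roots_C_mul _ h0]
    have := roots_multiset_prod_X_sub_C (l : Multiset ℂ)
    rwa [Multiset.map_coe, Multiset.prod_coe] at this
  rw [eigList, hr]
  refine List.Perm.eq_of_pairwise' (Multiset.pairwise_sort _ _) hl ?_
  rw [← Multiset.coe_eq_coe, Multiset.sort_eq]

/-- For real `(b, a)`: the periodic eigenvalues are real, the bands have positive length, and `Δ`
has exactly one critical point in each closed gap. -/
theorem exists_real_eig [NeZero N] {p : TodaSpace N} (hp : p ∈ realPhase N) :
    ∃ l e : ℕ → ℝ, (∀ j, 1 ≤ j → j ≤ 2 * N → eig p j = l j) ∧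
      (∀ j, 1 ≤ j → j ≤ N → l (2 * j - 1) < l (2 * j)) ∧
      (∀ m, 1 ≤ m → m ≤ N - 1 → l (2 * m) ≤ e m ∧ e m ≤ l (2 * m + 1)) ∧
      derivative (discr p) =
        C (N * (∏ k, p.2 k)⁻¹) * ∏ m ∈ Finset.Icc 1 (N - 1), (X - C (e m : ℂ)) := by
  obtain ⟨d, hd⟩ := exists_real_discr hp
  have hN : N ≠ 0 := NeZero.ne N
  have hpc := realPhase_subset hp
  have ha : (∏ k, p.2 k)⁻¹ ≠ 0 := by
    refine inv_ne_zero (Finset.prod_ne_zero_iff.2 fun k _ h => ?_)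
    have := hpc k
    simp [h] at this
  obtain ⟨hdeg, hcoef⟩ := discr_natDegree_coeff p
  have hdegN : (discr p).natDegree = N :=
    natDegree_eq_of_le_of_coeff_ne_zero hdeg (by rw [hcoef]; exact ha)
  have hdd : d.natDegree = N := by
    rw [← hdegN, ← hd, natDegree_map]
  have hlead : (d.leadingCoeff : ℂ) = (∏ k, p.2 k)⁻¹ := by
    rw [← hcoef, ← hd, coeff_map, leadingCoeff, hdd]
    rfl
  obtain ⟨l, e, h1, h2, h3, h4⟩ := exists_band_structure hdd hN fun z c hc hz =>
    im_eq_zero_of_discr_eval hp hc (by rw [← hd]; exact hz)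
  refine ⟨l, e, ?_, h1, h2, ?_⟩
  · have hmono : ∀ i, 1 ≤ i → i + 1 ≤ 2 * N → l i ≤ l (i + 1) := by
      intro i hi hi'
      rcases Nat.even_or_odd' i with ⟨m, rfl | rfl⟩
      · exact (h2 m (by omega) (by omega)).1.trans (h2 m (by omega) (by omega)).2
      · have := h1 (m + 1) (by omega) (by omega)
        rw [show 2 * (m + 1) - 1 = 2 * m + 1 by omega] at this
        exact this.le
    have hmono' : ∀ i j, 1 ≤ i → i ≤ j → j ≤ 2 * N → l i ≤ l j := by
      intro i j hi hij hj
      induction j, hij using Nat.le_induction with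
      | base => exact le_rfl
      | succ j hij ih => exact (ih (by omega)).trans (hmono j (by omega) (by omega))
    have hL : eigList p = (List.range (2 * N)).map fun j => (l (j + 1) : ℂ) := by
      refine eigList_eq_of_sorted hpc ?_ ?_
      · rw [List.pairwise_map]
        refine List.Pairwise.imp_of_mem (R := (· < ·)) ?_ List.pairwise_lt_range
        intro i j hi hj hij
        rw [lexLe_ofReal]
        exact hmono' _ _ (by omega) (by omega) (by have := List.mem_range.1 hj; omega)
      · apply Polynomial.funext
        intro z
        have h3' := congrArg (fun q : ℝ[X] => (q.map Complex.ofRealHom).eval z) h3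
        obtain ⟨M, rfl⟩ : ∃ M, N = M + 1 := ⟨N - 1, by omega⟩
        have hpr := prod_pairs (fun j => z - (l j : ℂ)) M
        have e1 : eval z (((List.range (2 * (M + 1))).map fun j => (l (j + 1) : ℂ)).map
            fun a => X - C a).prod = ∏ j ∈ Finset.range (2 * (M + 1)), (z - (l (j + 1) : ℂ)) := by
          rw [eval_list_prod, List.map_map, List.map_map, Finset.prod_eq_multiset_prod,
            Finset.range_val, ← Multiset.coe_range, Multiset.map_coe, Multiset.prod_coe]
          simp [Function.comp_def]
        rw [eval_mul, eval_C, e1, hpr, ← hlead]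
        simp only [Polynomial.map_sub, Polynomial.map_pow, Polynomial.map_mul, hd, eval_sub,
          eval_pow, eval_mul, map_C, eval_C, Polynomial.map_ofNat, eval_ofNat, Polynomial.map_prod,
          eval_prod, map_X, eval_X] at h3'
        simp only [eval_sub, eval_pow, eval_ofNat]
        rw [h3']
        simp
    intro j hj hj'
    rw [eig, hL, List.getD_eq_getElem _ _ (by simp; omega)]
    simp [Nat.sub_add_cancel hj]
  · rw [← hd, derivative_map, h4, ← hlead]
    simp [Polynomial.map_prod]

end Toda

/-! ### Analytic dependence of the discriminant on the parameters. -/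

namespace Toda

variable {N : ℕ}

lemma ne_zero_of_mem_complexPhase {p : TodaSpace N} (hp : p ∈ complexPhase N) (k : ZMod N) :
    p.2 k ≠ 0 := fun h => by
  have := hp k
  simp [h] at this

lemma prod_inv_ne_zero [NeZero N] {p : TodaSpace N} (hp : p ∈ complexPhase N) :
    (∏ k, p.2 k)⁻¹ ≠ 0 :=
  inv_ne_zero (Finset.prod_ne_zero_iff.2 fun k _ => ne_zero_of_mem_complexPhase hp k)

lemma isOpen_complexPhase [NeZero N] : IsOpen (complexPhase N) := by
  have : complexPhase N = ⋂ k, {p : TodaSpace N | 0 < (p.2 k).re} := by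
    ext p; simp [complexPhase]
  rw [this]
  exact isOpen_iInter_of_finite fun k => isOpen_lt (by fun_prop) (by fun_prop)

lemma analyticAt_fst_apply [NeZero N] {E : Type*} [NormedAddCommGroup E] [NormedSpace ℂ E]
    {f : E → TodaSpace N} {x : E} (hf : AnalyticAt ℂ f x) (k : ZMod N) :
    AnalyticAt ℂ (fun y => (f y).1 k) x :=
  (((ContinuousLinearMap.proj k : (ZMod N → ℂ) →L[ℂ] ℂ).comp
    (ContinuousLinearMap.fst ℂ (ZMod N → ℂ) (ZMod N → ℂ))).analyticAt _).fun_comp hf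

lemma analyticAt_snd_apply [NeZero N] {E : Type*} [NormedAddCommGroup E] [NormedSpace ℂ E]
    {f : E → TodaSpace N} {x : E} (hf : AnalyticAt ℂ f x) (k : ZMod N) :
    AnalyticAt ℂ (fun y => (f y).2 k) x :=
  (((ContinuousLinearMap.proj k : (ZMod N → ℂ) →L[ℂ] ℂ).comp
    (ContinuousLinearMap.snd ℂ (ZMod N → ℂ) (ZMod N → ℂ))).analyticAt _).fun_comp hf

lemma analyticAt_solution_eval [NeZero N] {p₀ : TodaSpace N} (hp : p₀ ∈ complexPhase N)
    (u₀ u₁ z₀ : ℂ) (k : ℕ) :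
    (AnalyticAt ℂ (fun q : TodaSpace N × ℂ => (solution q.1 u₀ u₁ k).eval q.2) (p₀, z₀) ∧
      AnalyticAt ℂ (fun q : TodaSpace N × ℂ => (derivative (solution q.1 u₀ u₁ k)).eval q.2)
        (p₀, z₀)) ∧
    (AnalyticAt ℂ (fun q : TodaSpace N × ℂ => (solution q.1 u₀ u₁ (k + 1)).eval q.2) (p₀, z₀) ∧
      AnalyticAt ℂ (fun q : TodaSpace N × ℂ => (derivative (solution q.1 u₀ u₁ (k + 1))).eval q.2)
        (p₀, z₀)) := by
  induction k with
  | zero => simp [solution, analyticAt_const]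
  | succ k ih =>
    refine ⟨ih.2, ?_⟩
    obtain ⟨⟨h1, h2⟩, h3, h4⟩ := ih
    have hz : AnalyticAt ℂ (fun q : TodaSpace N × ℂ => q.2) (p₀, z₀) := analyticAt_snd
    have hb := analyticAt_fst_apply (N := N) (f := fun q : TodaSpace N × ℂ => q.1)
      (x := (p₀, z₀)) analyticAt_fst ((k + 1 : ℕ) : ZMod N)
    have ha := analyticAt_snd_apply (N := N) (f := fun q : TodaSpace N × ℂ => q.1)
      (x := (p₀, z₀)) analyticAt_fst (k : ZMod N)
    have ha' := (analyticAt_snd_apply (N := N) (f := fun q : TodaSpace N × ℂ => q.1)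
      (x := (p₀, z₀)) analyticAt_fst ((k + 1 : ℕ) : ZMod N)).inv
      (ne_zero_of_mem_complexPhase hp _)
    constructor
    · simp only [solution, eval_mul, eval_sub, eval_C, eval_X]
      exact ha'.mul (((hz.sub hb).mul h3).sub (ha.mul h1))
    · simp only [solution, derivative_mul, derivative_C, derivative_sub, derivative_X, zero_mul,
        zero_add, sub_zero, one_mul, eval_mul, eval_sub, eval_add, eval_C, eval_X]
      exact ha'.mul ((h3.add ((hz.sub hb).mul h4)).sub (ha.mul h2))

lemma analyticAt_discr_eval [NeZero N] {p₀ : TodaSpace N} (hp : p₀ ∈ complexPhase N) (z₀ : ℂ) :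
    AnalyticAt ℂ (fun q : TodaSpace N × ℂ => (discr q.1).eval q.2) (p₀, z₀) := by
  simp only [discr, eval_add]
  exact (analyticAt_solution_eval hp 1 0 z₀ N).1.1.add (analyticAt_solution_eval hp 0 1 z₀ N).2.1

lemma analyticAt_derivative_discr_eval [NeZero N] {p₀ : TodaSpace N} (hp : p₀ ∈ complexPhase N)
    (z₀ : ℂ) :
    AnalyticAt ℂ (fun q : TodaSpace N × ℂ => (derivative (discr q.1)).eval q.2) (p₀, z₀) := by
  simp only [discr, derivative_add, eval_add]
  exact (analyticAt_solution_eval hp 1 0 z₀ N).1.2.add (analyticAt_solution_eval hp 0 1 z₀ N).2.2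

/-! ### Continuity of the eigenvalues and analyticity of their symmetric functions. -/

lemma continuousAt_solution_coeff [NeZero N] {p₀ : TodaSpace N} (hp : p₀ ∈ complexPhase N)
    (u₀ u₁ : ℂ) (k : ℕ) :
    (∀ n, ContinuousAt (fun p : TodaSpace N => (solution p u₀ u₁ k).coeff n) p₀) ∧
      ∀ n, ContinuousAt (fun p : TodaSpace N => (solution p u₀ u₁ (k + 1)).coeff n) p₀ := by
  induction k with
  | zero => simp [solution, continuousAt_const]
  | succ k ih =>
    refine ⟨ih.2, fun n => ?_⟩
    have ha' : ContinuousAt (fun p : TodaSpace N => (p.2 ((k + 1 : ℕ) : ZMod N))⁻¹) p₀ :=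
      ContinuousAt.inv₀ (by fun_prop) (ne_zero_of_mem_complexPhase hp _)
    have ha : ContinuousAt (fun p : TodaSpace N => p.2 (k : ZMod N)) p₀ := by fun_prop
    have hb : ContinuousAt (fun p : TodaSpace N => p.1 ((k + 1 : ℕ) : ZMod N)) p₀ := by fun_prop
    simp only [solution, coeff_C_mul, coeff_sub, sub_mul]
    refine ha'.mul ((ContinuousAt.sub ?_ (hb.mul (ih.2 n))).sub (ha.mul (ih.1 n)))
    cases n with
    | zero => simp [continuousAt_const]
    | succ n => simpa only [coeff_X_mul] using ih.2 n

lemma continuousAt_discr_sq_coeff [NeZero N] {p₀ : TodaSpace N} (hp : p₀ ∈ complexPhase N)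
    (n : ℕ) : ContinuousAt (fun p : TodaSpace N => (discr p ^ 2 - 4).coeff n) p₀ := by
  have h : ∀ n, ContinuousAt (fun p : TodaSpace N => (discr p).coeff n) p₀ := fun n => by
    simp only [discr, coeff_add]
    exact ((continuousAt_solution_coeff hp 1 0 N).1 n).add
      ((continuousAt_solution_coeff hp 0 1 N).2 n)
  simp only [coeff_sub, pow_two, coeff_mul]
  refine ContinuousAt.sub ?_ continuousAt_const
  exact tendsto_finsetSum _ fun i _ => ((h i.1).mul (h i.2)).tendsto

lemma discr_sq_ne_zero [NeZero N] {p : TodaSpace N} (hp : p ∈ complexPhase N) :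
    discr p ^ 2 - 4 ≠ 0 := fun h => by
  have := (discr_sq_natDegree_leadingCoeff hp).2
  rw [h, leadingCoeff_zero] at this
  exact pow_ne_zero 2 (prod_inv_ne_zero hp) this.symm

lemma eig_mem_roots [NeZero N] {p : TodaSpace N} (hp : p ∈ complexPhase N) {j : ℕ} (h1 : 1 ≤ j)
    (h2 : j ≤ 2 * N) : eig p j ∈ (discr p ^ 2 - 4).roots := by
  have hlen := eigList_length hp
  rw [eig, List.getD_eq_getElem _ _ (by omega), ← Multiset.mem_sort lexLe]
  exact List.getElem_mem _

lemma eig_re_mono [NeZero N] {p : TodaSpace N} (hp : p ∈ complexPhase N) {i j : ℕ} (h1 : 1 ≤ i)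
    (hij : i ≤ j) (h2 : j ≤ 2 * N) : (eig p i).re ≤ (eig p j).re := by
  rcases hij.eq_or_lt with rfl | hlt
  · exact le_rfl
  have hlen := eigList_length hp
  have hs : (eigList p).Pairwise lexLe := Multiset.pairwise_sort _ _
  have := List.pairwise_iff_getElem.1 hs (i - 1) (j - 1) (by omega) (by omega) (by omega)
  rw [eig, eig, List.getD_eq_getElem _ _ (by omega), List.getD_eq_getElem _ _ (by omega)]
  rcases this with h | h
  · exact h.le
  · exact h.1.le

/-- Cauchy's root bound, with the maximum of the coefficients replaced by their sum, whose
continuity in `p` is immediate. It supplies the compactness for `continuousAt_eig`. -/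
lemma exists_bound_eig [NeZero N] {p₀ : TodaSpace N} (hp : p₀ ∈ complexPhase N) :
    ∃ R : ℝ, ∀ᶠ p in nhds p₀, ∀ j, 1 ≤ j → j ≤ 2 * N → ‖eig p j‖ ≤ R := by
  set g : TodaSpace N → ℝ := fun p =>
    (∑ i ∈ Finset.range (2 * N), ‖(discr p ^ 2 - 4).coeff i‖) / ‖(discr p ^ 2 - 4).coeff (2 * N)‖ + 1
  have hc : ∀ p ∈ complexPhase N, (discr p ^ 2 - 4).coeff (2 * N) ≠ 0 := fun p hp => by
    obtain ⟨h1, h2⟩ := discr_sq_natDegree_leadingCoeff hp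
    rw [leadingCoeff, h1] at h2
    rw [h2]
    exact pow_ne_zero 2 (prod_inv_ne_zero hp)
  have hg : ContinuousAt g p₀ := by
    refine ContinuousAt.add (ContinuousAt.div ?_ (continuousAt_discr_sq_coeff hp _).norm
      (norm_ne_zero_iff.2 (hc p₀ hp))) continuousAt_const
    exact tendsto_finsetSum _ fun i _ => (continuousAt_discr_sq_coeff hp i).norm
  refine ⟨g p₀ + 1, ?_⟩
  filter_upwards [isOpen_complexPhase.mem_nhds hp,
    hg.eventually_lt continuousAt_const (lt_add_one (g p₀))] with p hpc hlt j h1 h2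
  refine le_trans ?_ hlt.le
  obtain ⟨hdeg, hlead⟩ := discr_sq_natDegree_leadingCoeff hpc
  have hb := IsRoot.norm_lt_cauchyBound (discr_sq_ne_zero hpc)
    (mem_roots'.1 (eig_mem_roots hpc h1 h2)).2
  refine (show ‖eig p j‖ ≤ cauchyBound (discr p ^ 2 - 4) from by exact_mod_cast hb.le).trans ?_
  rw [cauchyBound, leadingCoeff, hdeg]
  push_cast
  simp only [g]
  gcongr
  have : ((Finset.range (2 * N)).sup fun i => ‖(discr p ^ 2 - 4).coeff i‖₊) ≤
      ∑ i ∈ Finset.range (2 * N), ‖(discr p ^ 2 - 4).coeff i‖₊ :=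
    Finset.sup_le fun i hi => Finset.single_le_sum (f := fun i => ‖(discr p ^ 2 - 4).coeff i‖₊)
      (fun _ _ => zero_le) hi
  simpa using NNReal.coe_le_coe.2 this

lemma prod_sub_eig [NeZero N] {p : TodaSpace N} (hp : p ∈ complexPhase N) (z : ℂ) :
    ∏ i : Fin (2 * N), (z - eig p (i + 1)) =
      ((∏ k, p.2 k)) ^ 2 * ((discr p).eval z ^ 2 - 4) := by
  rw [discr_sq_eval hp, Finset.prod_range, ← mul_assoc, ← mul_pow, mul_inv_cancel₀, one_pow, one_mul]
  exact fun h => prod_inv_ne_zero hp (by rw [h, inv_zero])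

open Filter Topology in
/-- The eigenvalues `λ_j` are continuous at the points of the real phase space. -/
theorem continuousAt_eig [NeZero N] {p₀ : TodaSpace N} (hp : p₀ ∈ realPhase N) {j : ℕ}
    (h1 : 1 ≤ j) (h2 : j ≤ 2 * N) : ContinuousAt (fun p => eig p j) p₀ := by
  have hpc := realPhase_subset hp
  obtain ⟨l, -, hl, -⟩ := exists_real_eig hp
  set V : TodaSpace N → Fin (2 * N) → ℂ := fun p i => eig p (i + 1) with hV
  suffices h : Tendsto V (𝓝 p₀) (𝓝 (V p₀)) by
    have := (continuous_apply (⟨j - 1, by omega⟩ : Fin (2 * N))).continuousAt.tendsto.comp h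
    simpa [hV, Function.comp_def, ContinuousAt, Nat.sub_add_cancel h1] using this
  rw [tendsto_iff_ultrafilter]
  intro g hg
  obtain ⟨R, hR⟩ := exists_bound_eig hpc
  have hcomp : IsCompact (Set.univ.pi fun _ : Fin (2 * N) => Metric.closedBall (0 : ℂ) R) :=
    isCompact_univ_pi fun _ => isCompact_closedBall 0 R
  -- By compactness the vector of eigenvalues converges along the ultrafilter; it remains to
  -- identify the limit `v`.
  obtain ⟨v, -, hv⟩ := hcomp.ultrafilter_le_nhds (g.map V) (by
    rw [le_principal_iff]
    have : ∀ᶠ p in (g : Filter (TodaSpace N)),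
        V p ∈ Set.univ.pi fun _ : Fin (2 * N) => Metric.closedBall (0 : ℂ) R := by
      filter_upwards [hg hR] with p hp i _
      simpa using hp (i + 1) (by omega) (by omega)
    exact this)
  have hvt : Tendsto V g (𝓝 v) := hv
  have hvi : ∀ i : Fin (2 * N), Tendsto (fun p : TodaSpace N => eig p (i + 1)) g (𝓝 (v i)) := fun i =>
    (tendsto_pi_nhds.1 hvt) i
  suffices hvV : v = V p₀ by rwa [hvV] at hvt
  have hpc_ev : ∀ᶠ p in (g : Filter (TodaSpace N)), p ∈ complexPhase N :=
    hg (isOpen_complexPhase.mem_nhds hpc)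
  -- The monic polynomial depends continuously on `p`, so `v` is a permutation of the eigenvalues at
  -- `p₀`.
  have hprod : ∀ z, ∏ i, (z - v i) = ∏ i, (z - V p₀ i) := by
    intro z
    have t1 : Tendsto (fun p : TodaSpace N => ∏ i : Fin (2 * N), (z - eig p (i + 1))) g (𝓝 (∏ i, (z - v i))) :=
      tendsto_finsetProd _ fun i _ => tendsto_const_nhds.sub (hvi i)
    have hz : ContinuousAt (fun p : TodaSpace N => (discr p).eval z) p₀ :=
      ContinuousAt.comp (g := fun q : TodaSpace N × ℂ => (discr q.1).eval q.2)
        (f := fun p => (p, z)) (analyticAt_discr_eval hpc z).continuousAt (by fun_prop)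
    have t2 : ContinuousAt (fun p : TodaSpace N => (∏ k, p.2 k) ^ 2 * ((discr p).eval z ^ 2 - 4))
        p₀ := by
      refine ContinuousAt.mul (ContinuousAt.pow ?_ 2) ((hz.pow 2).sub continuousAt_const)
      exact tendsto_finsetProd _ fun k _ => ContinuousAt.tendsto (by fun_prop)
    have t3 := (t2.tendsto.mono_left hg).congr' (hpc_ev.mono fun p hp => (prod_sub_eig hp z).symm)
    rw [← prod_sub_eig hpc] at t3
    exact tendsto_nhds_unique t1 t3
  have hmul : (List.ofFn v : Multiset ℂ) = (List.ofFn (V p₀) : Multiset ℂ) := by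
    have h : ((List.ofFn v).map fun a => X - C a).prod =
        ((List.ofFn (V p₀)).map fun a => X - C a).prod := by
      apply Polynomial.funext
      intro z
      rw [eval_list_prod, eval_list_prod]
      simp only [List.map_ofFn, List.prod_ofFn, Function.comp_def, eval_sub, eval_X, eval_C]
      exact hprod z
    have r1 := roots_multiset_prod_X_sub_C (List.ofFn v : Multiset ℂ)
    have r2 := roots_multiset_prod_X_sub_C (List.ofFn (V p₀) : Multiset ℂ)
    rw [Multiset.map_coe, Multiset.prod_coe] at r1 r2
    rw [← r1, ← r2, h]
  have hperm := Multiset.coe_eq_coe.1 hmul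
  have hVim : ∀ i, (V p₀ i).im = 0 := fun i => by
    simp only [hV]
    rw [hl _ (by omega) (by omega)]
    simp
  have hvim : ∀ i, (v i).im = 0 := fun i => by
    have : v i ∈ List.ofFn (V p₀) := hperm.subset (List.mem_ofFn.2 ⟨i, rfl⟩)
    obtain ⟨k, hk⟩ := List.mem_ofFn.1 this
    rw [← hk]
    exact hVim k
  -- The lexicographic order does not pass to limits, but the order of real parts does. Since `v` is
  -- real, this suffices for `v` to be sorted, and hence to equal the list at `p₀`.
  have hvmono : ∀ i k : Fin (2 * N), i ≤ k → (v i).re ≤ (v k).re := fun i k hik => by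
    refine le_of_tendsto_of_tendsto ((Complex.continuous_re.tendsto _).comp (hvi i))
      ((Complex.continuous_re.tendsto _).comp (hvi k)) (hpc_ev.mono fun p hp => ?_)
    have : (i : ℕ) ≤ k := hik
    exact eig_re_mono hp (by omega) (by omega) (by omega)
  have hlex : ∀ w : Fin (2 * N) → ℂ, (∀ i, (w i).im = 0) →
      (∀ i k, i ≤ k → (w i).re ≤ (w k).re) → (List.ofFn w).Pairwise lexLe := by
    intro w hw hm
    rw [List.pairwise_ofFn]
    intro i k hik
    rcases (hm i k hik.le).lt_or_eq with h | h
    · exact Or.inl h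
    · exact Or.inr ⟨h, by rw [hw, hw]⟩
  refine List.ofFn_injective (hperm.eq_of_pairwise' (hlex v hvim hvmono) (hlex _ hVim ?_))
  intro i k hik
  have : (i : ℕ) ≤ k := hik
  exact eig_re_mono hpc (by omega) (by omega) (by omega)

lemma logDeriv_discr_sq [NeZero N] {p : TodaSpace N} (hp : p ∈ complexPhase N) {z : ℂ}
    (hz : ∀ j ∈ Finset.Icc 1 (2 * N), z ≠ eig p j) :
    2 * (discr p).eval z * (derivative (discr p)).eval z / ((discr p).eval z ^ 2 - 4) =
      ∑ j ∈ Finset.Icc 1 (2 * N), (z - eig p j)⁻¹ := by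
  have h0 : (discr p ^ 2 - 4).eval z ≠ 0 := by
    intro h
    rw [eval_sub, eval_pow, eval_ofNat, discr_sq_eval hp, mul_eq_zero,
      or_iff_right (pow_ne_zero 2 (prod_inv_ne_zero hp)), Finset.prod_eq_zero_iff] at h
    obtain ⟨j, hj, h⟩ := h
    rw [Finset.mem_range] at hj
    exact hz (j + 1) (Finset.mem_Icc.2 ⟨by omega, by omega⟩) (sub_eq_zero.1 h)
  have h := (IsAlgClosed.splits (discr p ^ 2 - 4)).eval_derivative_div_eval_of_ne_zero h0
  have h4 : (4 : ℂ[X]) = C 4 := (map_ofNat C 4).symm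
  rw [show derivative (discr p ^ 2 - 4) = C 2 * discr p * derivative (discr p) by
    rw [h4, derivative_sub, derivative_C, sub_zero, derivative_pow]; simp] at h
  simp only [eval_mul, eval_C, eval_sub, eval_pow, eval_ofNat] at h
  rw [h]
  have h3 : (discr p ^ 2 - 4).roots = (eigList p : Multiset ℂ) := (Multiset.sort_eq _ _).symm
  have hIcc : Finset.Icc 1 (2 * N) = (Finset.range (2 * N)).map (addRightEmbedding 1) := by
    rw [Finset.range_eq_Ico, Finset.map_add_right_Ico]
    ext; simp
  rw [h3, Multiset.map_coe, Multiset.sum_coe, hIcc, Finset.sum_map, Finset.sum_range,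
    ← List.sum_ofFn]
  congr 1
  refine List.ext_getElem (by simp [eigList_length hp]) fun i h _ => ?_
  simp at h
  simp [eig, h]

lemma circleIntegral_pow_div_sub {c w : ℂ} {ρ : ℝ} (hρ : 0 < ρ) (k : ℕ) :
    (‖w - c‖ < ρ → ∮ z in C(c, ρ), z ^ k * (z - w)⁻¹ = 2 * Real.pi * Complex.I * w ^ k) ∧
      (ρ < ‖w - c‖ → ∮ z in C(c, ρ), z ^ k * (z - w)⁻¹ = 0) := by
  constructor
  · intro h
    have hd : DiffContOnCl ℂ (fun z : ℂ => z ^ k) (Metric.ball c ρ) :=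
      (differentiable_pow k).diffContOnCl
    have := hd.circleIntegral_sub_inv_smul (w := w) (by simpa [dist_eq_norm] using h)
    simp only [smul_eq_mul] at this
    rw [← this]
    congr 1
    ext z
    ring
  · intro h
    refine DiffContOnCl.circleIntegral_eq_zero hρ.le (DifferentiableOn.diffContOnCl fun z hz => ?_)
    rw [closure_ball _ hρ.ne', Metric.mem_closedBall, dist_eq_norm] at hz
    refine DifferentiableAt.differentiableWithinAt (DifferentiableAt.mul (by fun_prop)
      (DifferentiableAt.inv (by fun_prop) fun h0 => ?_))
    rw [sub_eq_zero.1 h0] at hz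
    linarith

open Filter Topology in
/-- The power sums of a cluster of eigenvalues are analytic near the real phase space. -/
theorem analyticAt_sum_eig_pow [NeZero N] {p₀ : TodaSpace N} (hp : p₀ ∈ realPhase N) {c : ℂ}
    {ρ : ℝ} (hρ : 0 < ρ) {J : Finset ℕ} (hJ : J ⊆ Finset.Icc 1 (2 * N))
    (hin : ∀ j ∈ J, ‖eig p₀ j - c‖ < ρ)
    (hout : ∀ j ∈ Finset.Icc 1 (2 * N) \ J, ρ < ‖eig p₀ j - c‖) (k : ℕ) :
    AnalyticAt ℂ (fun p => ∑ j ∈ J, eig p j ^ k) p₀ := by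
  have hpc := realPhase_subset hp
  have hne : ∀ p : TodaSpace N, (∀ j ∈ J, ‖eig p j - c‖ < ρ) →
      (∀ j ∈ Finset.Icc 1 (2 * N) \ J, ρ < ‖eig p j - c‖) → ∀ z ∈ Metric.sphere c ρ,
      ∀ j ∈ Finset.Icc 1 (2 * N), z ≠ eig p j := by
    rintro p h1 h2 z hz j hj rfl
    rw [Metric.mem_sphere, dist_eq_norm] at hz
    by_cases hjJ : j ∈ J
    · exact (h1 j hjJ).ne hz
    · exact (h2 j (Finset.mem_sdiff.2 ⟨hj, hjJ⟩)).ne' hz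
  -- The argument principle on a fixed circle: the integrand involves only `Δ` and `Δ'`, which are
  -- jointly analytic.
  have hA : AnalyticAt ℂ (fun p : TodaSpace N => (2 * Real.pi * Complex.I)⁻¹ *
      ∮ z in C(c, ρ), z ^ k * (2 * (discr p).eval z * (derivative (discr p)).eval z /
        ((discr p).eval z ^ 2 - 4))) p₀ := by
    refine analyticAt_const.mul (analyticAt_circleIntegral (c := fun _ => c)
      (f := fun q : TodaSpace N × ℂ => q.2 ^ k * (2 * (discr q.1).eval q.2 *
        (derivative (discr q.1)).eval q.2 / ((discr q.1).eval q.2 ^ 2 - 4))) hρ.le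
      analyticAt_const fun z hz => ?_)
    have hd := analyticAt_discr_eval hpc z
    refine (analyticAt_snd.pow k).mul (((analyticAt_const.mul hd).mul
      (analyticAt_derivative_discr_eval hpc z)).div ((hd.pow 2).sub analyticAt_const) ?_)
    change (discr p₀).eval z ^ 2 - 4 ≠ 0
    rw [discr_sq_eval hpc]
    refine mul_ne_zero (pow_ne_zero 2 (prod_inv_ne_zero hpc))
      (Finset.prod_ne_zero_iff.2 fun j hj => sub_ne_zero.2 ?_)
    rw [Finset.mem_range] at hj
    exact hne p₀ hin hout z hz (j + 1) (Finset.mem_Icc.2 ⟨by omega, by omega⟩)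
  refine hA.congr ?_
  have hcont : ∀ j ∈ Finset.Icc 1 (2 * N), ContinuousAt (fun p => ‖eig p j - c‖) p₀ :=
    fun j hj => by
      rw [Finset.mem_Icc] at hj
      exact ((continuousAt_eig hp hj.1 hj.2).sub continuousAt_const).norm
  -- Continuity of the individual eigenvalues keeps the cluster inside the circle labelled by the
  -- same index set `J`.
  have ev1 : ∀ᶠ p in 𝓝 p₀, ∀ j ∈ J, ‖eig p j - c‖ < ρ :=
    (Finset.eventually_all J).2 fun j hj =>
      (hcont j (hJ hj)).eventually_lt continuousAt_const (hin j hj)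
  have ev2 : ∀ᶠ p in 𝓝 p₀, ∀ j ∈ Finset.Icc 1 (2 * N) \ J, ρ < ‖eig p j - c‖ :=
    (Finset.eventually_all _).2 fun j hj =>
      continuousAt_const.eventually_lt (hcont j (Finset.mem_sdiff.1 hj).1) (hout j hj)
  filter_upwards [ev1, ev2, isOpen_complexPhase.mem_nhds hpc] with p h1 h2 hp'
  have hint : ∮ z in C(c, ρ), z ^ k * (2 * (discr p).eval z * (derivative (discr p)).eval z /
      ((discr p).eval z ^ 2 - 4)) =
      ∮ z in C(c, ρ), ∑ j ∈ Finset.Icc 1 (2 * N), z ^ k * (z - eig p j)⁻¹ := by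
    refine circleIntegral.integral_congr hρ.le fun z hz => ?_
    rw [logDeriv_discr_sq hp' (hne p h1 h2 z hz), Finset.mul_sum]
  rw [hint, circleIntegral.integral_fun_sum, ← Finset.sum_sdiff hJ]
  · rw [Finset.sum_eq_zero fun j hj => (circleIntegral_pow_div_sub hρ k).2 (h2 j hj), zero_add,
      Finset.sum_congr rfl fun j hj => (circleIntegral_pow_div_sub hρ k).1 (h1 j hj),
      ← Finset.mul_sum, inv_mul_cancel_left₀]
    have := Real.pi_ne_zero
    simp [Complex.I_ne_zero]
  · intro j hj
    refine ContinuousOn.circleIntegrable hρ.le ((continuousOn_id.pow k).mul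
      (ContinuousOn.inv₀ (by fun_prop) fun z hz => sub_ne_zero.2 (hne p h1 h2 z hz j hj)))

end Toda

/-! ### The canonical root near a gap. -/

namespace Toda

variable {N : ℕ}

/-- `z` lies off the branch cut of `gapRoot p m`. -/
def OffCut (p : TodaSpace N) (m : ℕ) (z : ℂ) : Prop :=
  z - mid p m ≠ 0 ∧ 1 - (gap p m / 2 / (z - mid p m)) ^ 2 ∈ Complex.slitPlane

/-- The number `1 - w ^ 2` leaves the slit plane only for real `w` with `|w| ≥ 1`. Then `z - τ = w⁻¹
γ / 2` with `w⁻¹` in `[-1, 1]`, which is a point of the segment. -/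
lemma offCut_of_notMem_segment {p : TodaSpace N} {m : ℕ} {z : ℂ}
    (hz : z ∉ segment ℝ (eig p (2 * m)) (eig p (2 * m + 1))) : OffCut p m z := by
  have key : ∀ t : ℝ, t ∈ Set.Icc (-1 : ℝ) 1 → z - mid p m ≠ t * (gap p m / 2) := by
    intro t ht h
    refine hz ⟨(1 - t) / 2, (1 + t) / 2, by linarith [ht.2], by linarith [ht.1], by ring, ?_⟩
    have : z = mid p m + t * (gap p m / 2) := by rw [← h]; ring
    rw [this, mid, gap]
    simp only [Complex.real_smul]
    push_cast
    ring
  have hne : z - mid p m ≠ 0 := by simpa using key 0 (by norm_num)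
  refine ⟨hne, ?_⟩
  set w := gap p m / 2 / (z - mid p m) with hw
  have hg : gap p m / 2 = w * (z - mid p m) := by rw [hw]; field_simp
  by_contra hcon
  rw [Complex.mem_slitPlane_iff, not_or, not_lt, not_not] at hcon
  obtain ⟨hre, him⟩ := hcon
  simp only [Complex.sub_re, Complex.sub_im, Complex.one_re, Complex.one_im, pow_two,
    Complex.mul_re, Complex.mul_im] at hre him
  have hwi : w.im = 0 := by
    rcases mul_eq_zero.1 (show w.re * w.im = 0 by linarith) with h | h
    · rw [h] at hre; nlinarith [mul_self_nonneg w.im]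
    · exact h
  rw [hwi] at hre
  have hsq : 1 ≤ w.re ^ 2 := by nlinarith
  have hwr : w.re ≠ 0 := by rintro h; rw [h] at hsq; norm_num at hsq
  have hwre : w = (w.re : ℂ) := Complex.ext rfl (by simp [hwi])
  refine key w.re⁻¹ ?_ ?_
  · rw [Set.mem_Icc, ← abs_le, abs_inv]
    exact inv_le_one_of_one_le₀ ((one_le_sq_iff_one_le_abs _).1 hsq)
  · rw [hg, Complex.ofReal_inv, ← hwre, inv_mul_cancel_left₀]
    rw [hwre]; exact_mod_cast hwr

lemma offCut_of_lt_norm {p : TodaSpace N} {m : ℕ} {z : ℂ} (hz : ‖gap p m‖ / 2 < ‖z - mid p m‖) :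
    OffCut p m z := by
  have h0 : 0 < ‖z - mid p m‖ := lt_of_le_of_lt (by positivity) hz
  refine ⟨norm_pos_iff.1 h0, one_sub_sq_mem_slitPlane ?_⟩
  rw [norm_div, norm_div, div_lt_one h0]
  simpa using hz

lemma OffCut.differentiableAt {p : TodaSpace N} {m : ℕ} {z : ℂ} (h : OffCut p m z) :
    DifferentiableAt ℂ (gapRoot p m) z := by
  have e₀ : DifferentiableAt ℂ (fun z => z - mid p m) z := differentiableAt_id.sub_const _
  exact e₀.mul (DifferentiableAt.cpow ((((differentiableAt_const _).div e₀ h.1).pow 2).const_sub 1)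
    (differentiableAt_const _) h.2)

lemma OffCut.gapRoot_ne_zero {p : TodaSpace N} {m : ℕ} {z : ℂ} (h : OffCut p m z) :
    gapRoot p m z ≠ 0 :=
  mul_ne_zero h.1 (principalSqrt_ne_zero (Complex.slitPlane_ne_zero h.2))

/-- The sum is `(z - τ) (1 + √·)`, and the principal root has positive real part. This keeps the
denominator in `actionQuotient` from vanishing. -/
lemma OffCut.add_gapRoot_ne_zero {p : TodaSpace N} {m : ℕ} {z : ℂ} (h : OffCut p m z) :
    z - mid p m + gapRoot p m z ≠ 0 := by
  rw [gapRoot, ← mul_one_add]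
  refine mul_ne_zero h.1 fun h0 => ?_
  have h1 := congrArg Complex.re h0
  have h2 := principalSqrt_re_pos h.2
  simp only [Complex.add_re, Complex.one_re, Complex.zero_re] at h1
  linarith

/-- The gap enters only through its square. This is essential: `gap` itself need not be analytic
where the two eigenvalues merge or exchange their labels. -/
lemma OffCut.analyticAt {p₀ : TodaSpace N} [NeZero N] {m : ℕ} {z : ℂ} (h : OffCut p₀ m z)
    (hmid : AnalyticAt ℂ (fun p => mid p m) p₀) (hgap : AnalyticAt ℂ (fun p => gap p m ^ 2) p₀) :
    AnalyticAt ℂ (fun q : TodaSpace N × ℂ => gapRoot q.1 m q.2) (p₀, z) := by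
  have hm : AnalyticAt ℂ (fun q : TodaSpace N × ℂ => q.2 - mid q.1 m) (p₀, z) :=
    analyticAt_snd.sub (AnalyticAt.fun_comp (g := fun p => mid p m) hmid analyticAt_fst)
  have hg : AnalyticAt ℂ (fun q : TodaSpace N × ℂ => gap q.1 m ^ 2) (p₀, z) :=
    AnalyticAt.fun_comp (g := fun p => gap p m ^ 2) hgap analyticAt_fst
  have hs : AnalyticAt ℂ (fun q : TodaSpace N × ℂ =>
      1 - gap q.1 m ^ 2 / 4 / (q.2 - mid q.1 m) ^ 2) (p₀, z) :=
    analyticAt_const.sub ((hg.div analyticAt_const (by norm_num)).div (hm.pow 2)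
      (pow_ne_zero 2 h.1))
  have e : ∀ q : TodaSpace N × ℂ, gapRoot q.1 m q.2 = (q.2 - mid q.1 m) *
      (1 - gap q.1 m ^ 2 / 4 / (q.2 - mid q.1 m) ^ 2) ^ (1 / 2 : ℂ) := by
    intro q
    rw [gapRoot, principalSqrt, div_pow, div_pow]
    norm_num
  simp only [e]
  refine hm.mul (hs.cpow analyticAt_const ?_)
  have := h.2
  rw [div_pow, div_pow] at this
  norm_num at this
  exact this

/-- The canonical root without its factor belonging to the `n`-th gap. -/
noncomputable def restRoot [NeZero N] (p : TodaSpace N) (n : ℕ) (z : ℂ) : ℂ :=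
  (∏ k, p.2 k)⁻¹ *
    (Complex.I * principalSqrt (z - eig p 1) * principalSqrt (eig p (2 * N) - z)) *
    ∏ m ∈ (Finset.Icc 1 (N - 1)).erase n, gapRoot p m z

lemma cRoot_eq_gapRoot_mul [NeZero N] (p : TodaSpace N) {n : ℕ} (h1 : 1 ≤ n) (h2 : n ≤ N - 1)
    (z : ℂ) : cRoot p z = gapRoot p n z * restRoot p n z := by
  rw [cRoot, restRoot, ← Finset.mul_prod_erase _ _ (Finset.mem_Icc.2 ⟨h1, h2⟩)]
  ring

/-- `z` lies in the vertical strip between `λ_{2n-1}` and `λ_{2n+2}`. -/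
def InStrip (p : TodaSpace N) (n : ℕ) (z : ℂ) : Prop :=
  (eig p (2 * n - 1)).re < z.re ∧ z.re < (eig p (2 * n + 2)).re

section Strip

variable [NeZero N] {p : TodaSpace N} {n : ℕ} {z : ℂ}

lemma InStrip.sub_eig_one (h : InStrip p n z) (hp : p ∈ complexPhase N) (h1 : 1 ≤ n)
    (h2 : n ≤ N - 1) : z - eig p 1 ∈ Complex.slitPlane := by
  refine Complex.mem_slitPlane_iff.2 (Or.inl ?_)
  have := eig_re_mono hp le_rfl (show 1 ≤ 2 * n - 1 by omega) (by omega)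
  rw [Complex.sub_re]
  linarith [h.1]

lemma InStrip.eig_last_sub (h : InStrip p n z) (hp : p ∈ complexPhase N) (h1 : 1 ≤ n)
    (h2 : n ≤ N - 1) : eig p (2 * N) - z ∈ Complex.slitPlane := by
  refine Complex.mem_slitPlane_iff.2 (Or.inl ?_)
  have := eig_re_mono hp (show 1 ≤ 2 * n + 2 by omega) (show 2 * n + 2 ≤ 2 * N by omega) le_rfl
  rw [Complex.sub_re]
  linarith [h.2]

/-- By the ordering of real parts and convexity, the other gaps lie in the closed half planes to the
left and right of the strip. -/
lemma InStrip.offCut (h : InStrip p n z) (hp : p ∈ complexPhase N) (h1 : 1 ≤ n)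
    (h2 : n ≤ N - 1) {m : ℕ} (hm : m ∈ (Finset.Icc 1 (N - 1)).erase n) : OffCut p m z := by
  rw [Finset.mem_erase, Finset.mem_Icc] at hm
  refine offCut_of_notMem_segment ?_
  rintro ⟨s, t, hs, ht, hst, rfl⟩
  obtain ⟨g1, g2⟩ := h
  simp only [Complex.add_re, Complex.smul_re, smul_eq_mul] at g1 g2
  rcases lt_or_gt_of_ne hm.1 with hlt | hlt
  · have e1 := eig_re_mono hp (show 1 ≤ 2 * m by omega) (show 2 * m ≤ 2 * n - 1 by omega) (by omega)
    have e2 := eig_re_mono hp (show 1 ≤ 2 * m + 1 by omega) (show 2 * m + 1 ≤ 2 * n - 1 by omega)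
      (by omega)
    have e3 := add_mul s t (eig p (2 * n - 1)).re
    rw [hst, one_mul] at e3
    linarith [mul_le_mul_of_nonneg_left e1 hs, mul_le_mul_of_nonneg_left e2 ht]
  · have e1 := eig_re_mono hp (show 1 ≤ 2 * n + 2 by omega) (show 2 * n + 2 ≤ 2 * m by omega)
      (by omega)
    have e2 := eig_re_mono hp (show 1 ≤ 2 * n + 2 by omega) (show 2 * n + 2 ≤ 2 * m + 1 by omega)
      (by omega)
    have e3 := add_mul s t (eig p (2 * n + 2)).re
    rw [hst, one_mul] at e3
    linarith [mul_le_mul_of_nonneg_left e1 hs, mul_le_mul_of_nonneg_left e2 ht]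

lemma InStrip.restRoot_ne_zero (h : InStrip p n z) (hp : p ∈ complexPhase N) (h1 : 1 ≤ n)
    (h2 : n ≤ N - 1) : restRoot p n z ≠ 0 := by
  refine mul_ne_zero (mul_ne_zero (prod_inv_ne_zero hp) (mul_ne_zero (mul_ne_zero Complex.I_ne_zero
    ?_) ?_)) (Finset.prod_ne_zero_iff.2 fun m hm => (h.offCut hp h1 h2 hm).gapRoot_ne_zero)
  · exact principalSqrt_ne_zero (Complex.slitPlane_ne_zero (h.sub_eig_one hp h1 h2))
  · exact principalSqrt_ne_zero (Complex.slitPlane_ne_zero (h.eig_last_sub hp h1 h2))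

lemma InStrip.restRoot_differentiableAt (h : InStrip p n z) (hp : p ∈ complexPhase N)
    (h1 : 1 ≤ n) (h2 : n ≤ N - 1) : DifferentiableAt ℂ (restRoot p n) z := by
  have e₁ : DifferentiableAt ℂ (fun z => principalSqrt (z - eig p 1)) z :=
    DifferentiableAt.cpow (by fun_prop) (by fun_prop) (h.sub_eig_one hp h1 h2)
  have e₂ : DifferentiableAt ℂ (fun z => principalSqrt (eig p (2 * N) - z)) z :=
    DifferentiableAt.cpow (by fun_prop) (by fun_prop) (h.eig_last_sub hp h1 h2)
  have e₃ : DifferentiableAt ℂ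
      (fun z => ∏ m ∈ (Finset.Icc 1 (N - 1)).erase n, gapRoot p m z) z :=
    DifferentiableAt.fun_finsetProd fun m hm => (h.offCut hp h1 h2 hm).differentiableAt
  unfold restRoot
  exact ((((differentiableAt_const _).mul e₁).mul e₂).const_mul _).mul e₃

lemma InStrip.restRoot_analyticAt (h : InStrip p n z) (hp : p ∈ complexPhase N)
    (h1 : 1 ≤ n) (h2 : n ≤ N - 1) (hfirst : AnalyticAt ℂ (fun p : TodaSpace N => eig p 1) p)
    (hlast : AnalyticAt ℂ (fun p : TodaSpace N => eig p (2 * N)) p)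
    (hmid : ∀ m ∈ Finset.Icc 1 (N - 1), AnalyticAt ℂ (fun p : TodaSpace N => mid p m) p)
    (hgap : ∀ m ∈ Finset.Icc 1 (N - 1), AnalyticAt ℂ (fun p : TodaSpace N => gap p m ^ 2) p) :
    AnalyticAt ℂ (fun q : TodaSpace N × ℂ => restRoot q.1 n q.2) (p, z) := by
  have e₀ : AnalyticAt ℂ (fun q : TodaSpace N × ℂ => (∏ k, q.1.2 k)⁻¹) (p, z) := by
    refine AnalyticAt.inv ?_ fun h0 => prod_inv_ne_zero hp (by rw [h0, inv_zero])
    exact Finset.analyticAt_fun_prod _ fun k _ => analyticAt_snd_apply analyticAt_fst k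
  have e₁ : AnalyticAt ℂ (fun q : TodaSpace N × ℂ => principalSqrt (q.2 - eig q.1 1)) (p, z) :=
    (analyticAt_snd.sub (AnalyticAt.fun_comp (g := fun p : TodaSpace N => eig p 1) hfirst
      analyticAt_fst)).cpow analyticAt_const (h.sub_eig_one hp h1 h2)
  have e₂ : AnalyticAt ℂ (fun q : TodaSpace N × ℂ => principalSqrt (eig q.1 (2 * N) - q.2))
      (p, z) :=
    ((AnalyticAt.fun_comp (g := fun p : TodaSpace N => eig p (2 * N)) hlast
      analyticAt_fst).sub analyticAt_snd).cpow analyticAt_const (h.eig_last_sub hp h1 h2)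
  have e₃ : AnalyticAt ℂ (fun q : TodaSpace N × ℂ =>
      ∏ m ∈ (Finset.Icc 1 (N - 1)).erase n, gapRoot q.1 m q.2) (p, z) :=
    Finset.analyticAt_fun_prod _ fun m hm => (h.offCut hp h1 h2 hm).analyticAt
      (hmid m (Finset.mem_of_mem_erase hm)) (hgap m (Finset.mem_of_mem_erase hm))
  unfold restRoot
  exact (e₀.mul ((analyticAt_const.mul e₁).mul e₂)).mul e₃

end Strip

/-! ### Contours isolating a gap, and integrality of the period. -/

/-- The circle around `τ_n` of radius `r` encloses the `n`-th gap and stays in the strip between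
the neighbouring eigenvalues. -/
structure Isolating (p : TodaSpace N) (n : ℕ) (r : ℝ) : Prop where
  gap_lt : ‖gap p n‖ / 2 < r
  left_lt : (eig p (2 * n - 1)).re + r < (mid p n).re
  lt_right : (mid p n).re + r < (eig p (2 * n + 2)).re

namespace Isolating

variable {p : TodaSpace N} {n : ℕ} {r : ℝ} {z : ℂ}

lemma pos (h : Isolating p n r) : 0 < r := lt_of_le_of_lt (by positivity) h.gap_lt

lemma inStrip (h : Isolating p n r) (hz : ‖z - mid p n‖ ≤ r) : InStrip p n z := by
  have h3 := (Complex.abs_re_le_norm (z - mid p n)).trans hz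
  rw [Complex.sub_re, abs_le] at h3
  exact ⟨by linarith [h.left_lt], by linarith [h.lt_right]⟩

/-- Circle integrals around the gap do not depend on the radius. -/
lemma circleIntegral_eq {r' : ℝ} (h : Isolating p n r) (h' : Isolating p n r') {f : ℂ → ℂ}
    (hf : ∀ z, ‖gap p n‖ / 2 < ‖z - mid p n‖ → InStrip p n z → DifferentiableAt ℂ f z) :
    ∮ z in C(mid p n, r), f z = ∮ z in C(mid p n, r'), f z := by
  wlog hle : r' ≤ r generalizing r r'
  · exact (this h' h (le_of_not_ge hle)).symm
  have hd : ∀ z ∈ Metric.closedBall (mid p n) r \ Metric.ball (mid p n) r',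
      DifferentiableAt ℂ f z := by
    rintro z ⟨hz1, hz2⟩
    rw [Metric.mem_closedBall, dist_eq_norm] at hz1
    rw [Metric.mem_ball, dist_eq_norm, not_lt] at hz2
    exact hf z (h'.gap_lt.trans_le hz2) (h.inStrip hz1)
  refine Complex.circleIntegral_eq_of_differentiable_on_annulus_off_countable h'.pos hle
    Set.countable_empty (fun z hz => (hd z hz).continuousAt.continuousWithinAt) fun z hz => ?_
  exact hd z ⟨Metric.ball_subset_closedBall hz.1.1,
    fun hb => hz.1.2 (Metric.ball_subset_closedBall hb)⟩

variable [NeZero N]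

lemma cRoot_ne_zero (h : Isolating p n r) (hp : p ∈ complexPhase N) (h1 : 1 ≤ n) (h2 : n ≤ N - 1)
    (hz : ‖z - mid p n‖ ≤ r) (hz' : ‖gap p n‖ / 2 < ‖z - mid p n‖) : cRoot p z ≠ 0 := by
  rw [cRoot_eq_gapRoot_mul p h1 h2]
  exact mul_ne_zero (offCut_of_lt_norm hz').gapRoot_ne_zero
    ((h.inStrip hz).restRoot_ne_zero hp h1 h2)

lemma cRoot_differentiableAt (h : Isolating p n r) (hp : p ∈ complexPhase N) (h1 : 1 ≤ n)
    (h2 : n ≤ N - 1) (hz : ‖z - mid p n‖ ≤ r) (hz' : ‖gap p n‖ / 2 < ‖z - mid p n‖) :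
    DifferentiableAt ℂ (cRoot p) z := by
  have : cRoot p = fun z => gapRoot p n z * restRoot p n z :=
    funext fun z => cRoot_eq_gapRoot_mul p h1 h2 z
  rw [this]
  exact (offCut_of_lt_norm hz').differentiableAt.mul
    ((h.inStrip hz).restRoot_differentiableAt hp h1 h2)

open Filter Topology in
-- Differentiate `cRoot ^ 2 = Δ ^ 2 - 4`, which holds in a neighbourhood of `z` because `z` differs
-- from all the midpoints.
lemma hasDerivAt_cRoot (h : Isolating p n r) (hp : p ∈ complexPhase N) (h1 : 1 ≤ n)
    (h2 : n ≤ N - 1) (hz : ‖z - mid p n‖ ≤ r) (hz' : ‖gap p n‖ / 2 < ‖z - mid p n‖) :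
    HasDerivAt (cRoot p) ((discr p).eval z * (derivative (discr p)).eval z / cRoot p z) z := by
  have hd := (h.cRoot_differentiableAt hp h1 h2 hz hz').hasDerivAt
  have hne := h.cRoot_ne_zero hp h1 h2 hz hz'
  have hmid : ∀ m ∈ Finset.Icc 1 (N - 1), z ≠ mid p m := by
    intro m hm
    by_cases hmn : m = n
    · subst hmn
      exact sub_ne_zero.1 (offCut_of_lt_norm hz').1
    · exact sub_ne_zero.1 ((h.inStrip hz).offCut hp h1 h2 (Finset.mem_erase.2 ⟨hmn, hm⟩)).1
  have hev : ∀ᶠ w in 𝓝 z, cRoot p w ^ 2 = (discr p).eval w ^ 2 - 4 := by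
    have : ∀ᶠ w in 𝓝 z, ∀ m ∈ Finset.Icc 1 (N - 1), w ≠ mid p m :=
      (Finset.eventually_all _).2 fun m hm => isOpen_ne.mem_nhds (hmid m hm)
    filter_upwards [this] with w hw
    exact cRoot_sq hp w fun m hm h => absurd h (hw m hm)
  have hs1 := (hd.pow 2).congr_of_eventuallyEq (f₁ := fun w => (discr p).eval w ^ 2 - 4)
    (hev.mono fun w hw => hw.symm)
  have hs2 := (((discr p).hasDerivAt z).pow 2).sub_const (4 : ℂ)
  have := hs1.unique hs2
  refine hd.congr_deriv ?_
  rw [eq_div_iff hne]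
  simp at this
  linear_combination this / 2

/-- `∮ Δ' / √(Δ² - 4)` is an integer multiple of `2πi`. -/
lemma exists_int (h : Isolating p n r) (hp : p ∈ complexPhase N) (h1 : 1 ≤ n) (h2 : n ≤ N - 1) :
    ∃ k : ℤ, ∮ z in C(mid p n, r), (derivative (discr p)).eval z / cRoot p z =
      k * (2 * Real.pi * Complex.I) := by
  have hs : ∀ z ∈ Metric.sphere (mid p n) r, ‖z - mid p n‖ = r := fun z hz => by
    rwa [Metric.mem_sphere, dist_eq_norm] at hz
  -- With `G = Δ + cRoot` one has `G' = (Δ' / cRoot) G`, and `G (Δ - cRoot) = 4` shows that `G` has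
  -- no zeros.
  refine circleIntegral_logDeriv_mem_int (G := fun z => (discr p).eval z + cRoot p z) h.pos.le
    (fun z hz => ?_) (fun z hz h0 => ?_) ?_
  · have hz1 : ‖z - mid p n‖ ≤ r := (hs z hz).le
    have hz2 : ‖gap p n‖ / 2 < ‖z - mid p n‖ := by rw [hs z hz]; exact h.gap_lt
    have hne := h.cRoot_ne_zero hp h1 h2 hz1 hz2
    refine (((discr p).hasDerivAt z).add (h.hasDerivAt_cRoot hp h1 h2 hz1 hz2)).congr_deriv ?_
    field_simp
    ring
  · have hz1 : ‖z - mid p n‖ ≤ r := (hs z hz).le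
    have hz2 : ‖gap p n‖ / 2 < ‖z - mid p n‖ := by rw [hs z hz]; exact h.gap_lt
    have hsq : cRoot p z ^ 2 = (discr p).eval z ^ 2 - 4 := by
      refine cRoot_sq hp z fun m hm hzm => absurd hzm ?_
      by_cases hmn : m = n
      · subst hmn
        exact sub_ne_zero.1 (offCut_of_lt_norm hz2).1
      · exact sub_ne_zero.1 ((h.inStrip hz1).offCut hp h1 h2 (Finset.mem_erase.2 ⟨hmn, hm⟩)).1
    have h4 : (4 : ℂ) = 0 := by
      linear_combination ((discr p).eval z - cRoot p z) * h0 + hsq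
    norm_num at h4
  · intro z hz
    have hz2 : ‖gap p n‖ / 2 < ‖z - mid p n‖ := by rw [hs z hz]; exact h.gap_lt
    exact (((derivative (discr p)).continuous.continuousAt).div
      (h.cRoot_differentiableAt hp h1 h2 (hs z hz).le hz2).continuousAt
      (h.cRoot_ne_zero hp h1 h2 (hs z hz).le hz2)).continuousWithinAt

end Isolating

/-! ### Division of the action by the squared gap. -/

/-- The analytic extension of `I_n / γ_n²`. -/
noncomputable def actionQuotient [NeZero N] (n : ℕ) (p : TodaSpace N) : ℂ :=
  (8 * Real.pi : ℂ)⁻¹ * ∮ z in C(mid p n, contourRadius p n),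
    (derivative (discr p)).eval z / (cRoot p z * (z - mid p n + gapRoot p n z))

/-- Write `z = τ + g + (z - τ - g)` with `g = gapRoot p n z`. The first term contributes a multiple
of the period, the second an integral of an analytic function, and the third equals `(γ ^ 2 / 4) /
(z - τ + g)`. The factor `1 / 4` and the prefactor `(2π)⁻¹` make up the `(8π)⁻¹` of
`actionQuotient`. -/
lemma Isolating.action_eq [NeZero N] {p : TodaSpace N} {n : ℕ}
    (h : Isolating p n (contourRadius p n)) (hp : p ∈ complexPhase N) (h1 : 1 ≤ n) (h2 : n ≤ N - 1)
    (h0 : ∮ z in C(mid p n, contourRadius p n), (derivative (discr p)).eval z / cRoot p z = 0) :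
    action p n = gap p n ^ 2 * actionQuotient n p := by
  set r := contourRadius p n with hr
  have hs : ∀ z ∈ Metric.sphere (mid p n) r, ‖z - mid p n‖ = r := fun z hz => by
    rwa [Metric.mem_sphere, dist_eq_norm] at hz
  have hcut : ∀ z ∈ Metric.sphere (mid p n) r, OffCut p n z := fun z hz =>
    offCut_of_lt_norm (by rw [hs z hz]; exact h.gap_lt)
  have hne : ∀ z ∈ Metric.sphere (mid p n) r, cRoot p z ≠ 0 := fun z hz =>
    h.cRoot_ne_zero hp h1 h2 (hs z hz).le (by rw [hs z hz]; exact h.gap_lt)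
  have hcc : ContinuousOn (cRoot p) (Metric.sphere (mid p n) r) := fun z hz =>
    (h.cRoot_differentiableAt hp h1 h2 (hs z hz).le
      (by rw [hs z hz]; exact h.gap_lt)).continuousAt.continuousWithinAt
  have hgc : ContinuousOn (gapRoot p n) (Metric.sphere (mid p n) r) := fun z hz =>
    (hcut z hz).differentiableAt.continuousAt.continuousWithinAt
  have hdc : ContinuousOn (fun z => (derivative (discr p)).eval z) (Metric.sphere (mid p n) r) :=
    (derivative (discr p)).continuous.continuousOn
  have hM : ∮ z in C(mid p n, r), (derivative (discr p)).eval z / restRoot p n z = 0 := by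
    refine DiffContOnCl.circleIntegral_eq_zero h.pos.le (DifferentiableOn.diffContOnCl fun z hz => ?_)
    rw [closure_ball _ h.pos.ne', Metric.mem_closedBall, dist_eq_norm] at hz
    exact ((derivative (discr p)).differentiableAt.div
      ((h.inStrip hz).restRoot_differentiableAt hp h1 h2)
      ((h.inStrip hz).restRoot_ne_zero hp h1 h2)).differentiableWithinAt
  have hrc : ContinuousOn (restRoot p n) (Metric.sphere (mid p n) r) := fun z hz =>
    ((h.inStrip (hs z hz).le).restRoot_differentiableAt hp h1 h2).continuousAt.continuousWithinAt
  have hrne : ∀ z ∈ Metric.sphere (mid p n) r, restRoot p n z ≠ 0 := fun z hz =>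
    (h.inStrip (hs z hz).le).restRoot_ne_zero hp h1 h2
  have hkey : ∮ z in C(mid p n, r), z * (derivative (discr p)).eval z / cRoot p z =
      ∮ z in C(mid p n, r), (mid p n * ((derivative (discr p)).eval z / cRoot p z) +
        (derivative (discr p)).eval z / restRoot p n z) + gap p n ^ 2 / 4 *
        ((derivative (discr p)).eval z / (cRoot p z * (z - mid p n + gapRoot p n z))) := by
    refine circleIntegral.integral_congr h.pos.le fun z hz => ?_
    have e1 := (hcut z hz).gapRoot_ne_zero
    have e2 := (hcut z hz).add_gapRoot_ne_zero
    have e3 := hrne z hz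
    have e4 := gapRoot_sq p n z fun h' => absurd (sub_eq_zero.2 h') (hcut z hz).1
    have e5 : gapRoot p n z ^ 2 = (z - mid p n) ^ 2 - gap p n ^ 2 / 4 := by
      rw [e4, mid, gap]; ring
    simp only [cRoot_eq_gapRoot_mul p h1 h2]
    have e6 : gap p n ^ 2 / 4 = (z - mid p n - gapRoot p n z) * (z - mid p n + gapRoot p n z) := by
      linear_combination e5
    rw [e6]
    field_simp
    ring
  rw [action, hkey, circleIntegral.integral_add, circleIntegral.integral_add,
    circleIntegral.integral_const_mul, circleIntegral.integral_const_mul, h0, hM, actionQuotient]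
  · have : (Real.pi : ℂ) ≠ 0 := by exact_mod_cast Real.pi_ne_zero
    field_simp
    ring
  · exact (continuousOn_const.mul (hdc.div hcc hne)).circleIntegrable h.pos.le
  · exact (hdc.div hrc hrne).circleIntegrable h.pos.le
  · exact ((continuousOn_const.mul (hdc.div hcc hne)).add (hdc.div hrc hrne)).circleIntegrable
      h.pos.le
  · refine (continuousOn_const.mul (hdc.div (hcc.mul ((continuousOn_id.sub continuousOn_const).add
      hgc)) fun z hz => ?_)).circleIntegrable h.pos.le
    exact mul_ne_zero (hne z hz) (hcut z hz).add_gapRoot_ne_zero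

end Toda

/-! ### Analytic data near real points. -/

namespace Toda

variable {N : ℕ}

/-- Outside the gap, `gapRoot` has the sign of `x - τ`, which is also that of `x - e` for every `e`
in the gap. This lets the factors of `Δ'` be matched with those of the canonical root. -/
lemma exists_gapRoot_eq {p : TodaSpace N} {m : ℕ} {a b e x : ℝ} (ha : eig p (2 * m) = a)
    (hb : eig p (2 * m + 1) = b) (hae : a ≤ e) (heb : e ≤ b) (hx : x < a ∨ b < x) :
    ∃ g : ℝ, 0 < g ∧ gapRoot p m x = (x - e) * g := by
  have hab := hae.trans heb
  have hsq : ((b - a) / 2) ^ 2 < (x - (a + b) / 2) ^ 2 := by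
    rcases hx with h | h <;> nlinarith
  have hτ : x - (a + b) / 2 ≠ 0 := by
    rcases hx with h | h
    · exact (show x - (a + b) / 2 < 0 by linarith).ne
    · exact (show 0 < x - (a + b) / 2 by linarith).ne'
  have hxe : x - e ≠ 0 := by
    rcases hx with h | h
    · exact (show x - e < 0 by linarith).ne
    · exact (show 0 < x - e by linarith).ne'
  have hratio : 0 < (x - (a + b) / 2) / (x - e) := by
    rcases hx with h | h
    · exact div_pos_of_neg_of_neg (by linarith) (by linarith)
    · exact div_pos (by linarith) (by linarith)
  have hq : 0 < 1 - ((b - a) / 2 / (x - (a + b) / 2)) ^ 2 := by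
    rw [div_pow, sub_pos, div_lt_one (by positivity)]
    exact hsq
  obtain ⟨s, hs, hs'⟩ := principalSqrt_ofReal hq
  refine ⟨(x - (a + b) / 2) / (x - e) * s, mul_pos hratio hs, ?_⟩
  have hxe' : (x : ℂ) - e ≠ 0 := by exact_mod_cast hxe
  rw [gapRoot, mid, gap, ha, hb, show (1 : ℂ) - (((b : ℂ) - a) / 2 / (x - (a + b) / 2)) ^ 2 =
    ((1 - ((b - a) / 2 / (x - (a + b) / 2)) ^ 2 : ℝ) : ℂ) by push_cast; rfl, hs']
  push_cast
  field_simp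

variable [NeZero N]

lemma isolating_contourRadius {p : TodaSpace N} (hp : p ∈ realPhase N) {n : ℕ} (h1 : 1 ≤ n)
    (h2 : n ≤ N - 1) : Isolating p n (contourRadius p n) := by
  obtain ⟨l, e, hl, hband, hcrit, -⟩ := exists_real_eig hp
  have e1 := hband n h1 (by omega)
  have e2 := hband (n + 1) (by omega) (by omega)
  rw [show 2 * (n + 1) - 1 = 2 * n + 1 by omega, show 2 * (n + 1) = 2 * n + 2 by omega] at e2
  have e3 := (hcrit n h1 h2).1.trans (hcrit n h1 h2).2
  have g1 : gap p n = ((l (2 * n + 1) - l (2 * n) : ℝ) : ℂ) := by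
    rw [gap, hl _ (by omega) (by omega), hl _ (by omega) (by omega)]; push_cast; rfl
  have g2 : mid p n = (((l (2 * n) + l (2 * n + 1)) / 2 : ℝ) : ℂ) := by
    rw [mid, hl _ (by omega) (by omega), hl _ (by omega) (by omega)]; push_cast; rfl
  have g3 : ‖gap p n‖ = l (2 * n + 1) - l (2 * n) := by
    rw [g1, Complex.norm_real, Real.norm_eq_abs, abs_of_nonneg (by linarith)]
  have g4 : ‖mid p n - eig p (2 * n - 1)‖ =
      (l (2 * n) + l (2 * n + 1)) / 2 - l (2 * n - 1) := by
    rw [g2, hl _ (by omega) (by omega), ← Complex.ofReal_sub, Complex.norm_real, Real.norm_eq_abs,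
      abs_of_nonneg (by linarith)]
  have g5 : ‖eig p (2 * n + 2) - mid p n‖ =
      l (2 * n + 2) - (l (2 * n) + l (2 * n + 1)) / 2 := by
    rw [g2, hl _ (by omega) (by omega), ← Complex.ofReal_sub, Complex.norm_real, Real.norm_eq_abs,
      abs_of_nonneg (by linarith)]
  have m1 := min_le_left ((l (2 * n) + l (2 * n + 1)) / 2 - l (2 * n - 1))
    (l (2 * n + 2) - (l (2 * n) + l (2 * n + 1)) / 2)
  have m2 := min_le_right ((l (2 * n) + l (2 * n + 1)) / 2 - l (2 * n - 1))
    (l (2 * n + 2) - (l (2 * n) + l (2 * n + 1)) / 2)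
  have m3 : (l (2 * n + 1) - l (2 * n)) / 2 < min ((l (2 * n) + l (2 * n + 1)) / 2 - l (2 * n - 1))
    (l (2 * n + 2) - (l (2 * n) + l (2 * n + 1)) / 2) := lt_min (by linarith) (by linarith)
  constructor
  · rw [contourRadius, g3, g4, g5]; linarith
  · rw [contourRadius, g3, g4, g5, g2, hl _ (by omega) (by omega), Complex.ofReal_re,
      Complex.ofReal_re]
    linarith
  · rw [contourRadius, g3, g4, g5, g2, hl _ (by omega) (by omega), Complex.ofReal_re,
      Complex.ofReal_re]
    linarith

section Analytic

variable {p₀ : TodaSpace N}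

lemma analyticAt_sum_gap_eig_pow (hp : p₀ ∈ realPhase N) {m : ℕ} (h1 : 1 ≤ m) (h2 : m ≤ N - 1)
    (k : ℕ) : AnalyticAt ℂ (fun p : TodaSpace N => eig p (2 * m) ^ k + eig p (2 * m + 1) ^ k)
      p₀ := by
  have hpc := realPhase_subset hp
  have hI := isolating_contourRadius hp h1 h2
  have := analyticAt_sum_eig_pow hp (c := mid p₀ m) hI.pos (J := {2 * m, 2 * m + 1}) ?_ ?_ ?_ k
  · simpa using this
  · intro j hj
    simp only [Finset.mem_insert, Finset.mem_singleton] at hj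
    rw [Finset.mem_Icc]
    omega
  · intro j hj
    refine lt_of_eq_of_lt ?_ hI.gap_lt
    simp only [Finset.mem_insert, Finset.mem_singleton] at hj
    rcases hj with rfl | rfl
    · rw [show eig p₀ (2 * m) - mid p₀ m = -(gap p₀ m / 2) by rw [mid, gap]; ring, norm_neg,
        norm_div]
      simp
    · rw [show eig p₀ (2 * m + 1) - mid p₀ m = gap p₀ m / 2 by rw [mid, gap]; ring, norm_div]
      simp
  · intro j hj
    simp only [Finset.mem_sdiff, Finset.mem_Icc, Finset.mem_insert, Finset.mem_singleton] at hj
    refine lt_of_lt_of_le ?_ (Complex.abs_re_le_norm _)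
    rw [Complex.sub_re, lt_abs]
    rcases lt_or_gt_of_ne (show j ≠ 2 * m by omega) with h | h
    · right
      have := eig_re_mono hpc hj.1.1 (show j ≤ 2 * m - 1 by omega) (by omega)
      linarith [hI.left_lt]
    · left
      have := eig_re_mono hpc (show 1 ≤ 2 * m + 2 by omega) (show 2 * m + 2 ≤ j by omega) hj.1.2
      linarith [hI.lt_right]

lemma analyticAt_mid (hp : p₀ ∈ realPhase N) {m : ℕ} (h1 : 1 ≤ m) (h2 : m ≤ N - 1) :
    AnalyticAt ℂ (fun p : TodaSpace N => mid p m) p₀ := by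
  have := (analyticAt_sum_gap_eig_pow hp h1 h2 1).div analyticAt_const (two_ne_zero' ℂ)
  refine this.congr (Filter.Eventually.of_forall fun p => ?_)
  simp [mid]

/-- The squared gap is symmetric in the two eigenvalues: twice the sum of squares minus the square
of the sum. -/
lemma analyticAt_gap_sq (hp : p₀ ∈ realPhase N) {m : ℕ} (h1 : 1 ≤ m) (h2 : m ≤ N - 1) :
    AnalyticAt ℂ (fun p : TodaSpace N => gap p m ^ 2) p₀ := by
  have := ((analyticAt_const (v := (2 : ℂ))).mul (analyticAt_sum_gap_eig_pow hp h1 h2 2)).sub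
    ((analyticAt_sum_gap_eig_pow hp h1 h2 1).pow 2)
  refine this.congr (Filter.Eventually.of_forall fun p => ?_)
  simp only [Pi.sub_apply, Pi.mul_apply, Pi.pow_apply, gap]
  ring

lemma eig_re_lt (hp : p₀ ∈ realPhase N) {j : ℕ} (h1 : 1 ≤ j) (h2 : j ≤ N) :
    (eig p₀ (2 * j - 1)).re < (eig p₀ (2 * j)).re := by
  obtain ⟨l, e, hl, hband, -⟩ := exists_real_eig hp
  rw [hl _ (by omega) (by omega), hl _ (by omega) (by omega), Complex.ofReal_re, Complex.ofReal_re]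
  exact hband j h1 h2

/-- The first band has positive length, so `λ_1` is simple and forms a cluster by itself. The last
band does the same for `λ_{2N}`. -/
lemma analyticAt_eig_one (hp : p₀ ∈ realPhase N) :
    AnalyticAt ℂ (fun p : TodaSpace N => eig p 1) p₀ := by
  have hN := NeZero.pos N
  have hpc := realPhase_subset hp
  have hlt := eig_re_lt hp (j := 1) le_rfl hN
  have := analyticAt_sum_eig_pow hp (c := eig p₀ 1)
    (ρ := ((eig p₀ 2).re - (eig p₀ 1).re) / 2) (by simpa using hlt) (J := {1}) ?_ ?_ ?_ 1
  · simpa using this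
  · simp; omega
  · simpa using hlt
  · intro j hj
    simp only [Finset.mem_sdiff, Finset.mem_Icc, Finset.mem_singleton] at hj
    refine lt_of_lt_of_le ?_ (Complex.abs_re_le_norm _)
    rw [Complex.sub_re, lt_abs]
    left
    have := eig_re_mono hpc (show 1 ≤ 2 by omega) (show 2 ≤ j by omega) hj.1.2
    norm_num at hlt
    linarith

lemma analyticAt_eig_last (hp : p₀ ∈ realPhase N) :
    AnalyticAt ℂ (fun p : TodaSpace N => eig p (2 * N)) p₀ := by
  have hN := NeZero.pos N
  have hpc := realPhase_subset hp
  have hlt := eig_re_lt hp (j := N) hN le_rfl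
  have := analyticAt_sum_eig_pow hp (c := eig p₀ (2 * N))
    (ρ := ((eig p₀ (2 * N)).re - (eig p₀ (2 * N - 1)).re) / 2) (by simpa using hlt)
    (J := {2 * N}) ?_ ?_ ?_ 1
  · simpa using this
  · simp; omega
  · simpa using hlt
  · intro j hj
    simp only [Finset.mem_sdiff, Finset.mem_Icc, Finset.mem_singleton] at hj
    refine lt_of_lt_of_le ?_ (Complex.abs_re_le_norm _)
    rw [Complex.sub_re, lt_abs]
    right
    have := eig_re_mono hpc hj.1.1 (show j ≤ 2 * N - 1 by omega) (by omega)
    linarith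

lemma continuousAt_gap (hp : p₀ ∈ realPhase N) {n : ℕ} (h1 : 1 ≤ n) (h2 : n ≤ N - 1) :
    ContinuousAt (fun p : TodaSpace N => gap p n) p₀ :=
  (continuousAt_eig hp (by omega) (by omega)).sub (continuousAt_eig hp (by omega) (by omega))

lemma continuousAt_contourRadius (hp : p₀ ∈ realPhase N) {n : ℕ} (h1 : 1 ≤ n) (h2 : n ≤ N - 1) :
    ContinuousAt (fun p : TodaSpace N => contourRadius p n) p₀ := by
  have hm := (analyticAt_mid hp h1 h2).continuousAt
  have hl : ContinuousAt (fun p : TodaSpace N => eig p (2 * n - 1)) p₀ :=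
    continuousAt_eig hp (by omega) (by omega)
  have hr : ContinuousAt (fun p : TodaSpace N => eig p (2 * n + 2)) p₀ :=
    continuousAt_eig hp (by omega) (by omega)
  exact (((continuousAt_gap hp h1 h2).norm.div_const 2).add
    ((hm.sub hl).norm.min (hr.sub hm).norm)).div_const 2

open Filter Topology in
-- The radius may vary continuously, because both the frozen radius at `p₀` and `contourRadius`
-- itself are needed.
lemma eventually_isolating (hp : p₀ ∈ realPhase N) {n : ℕ} (h1 : 1 ≤ n) (h2 : n ≤ N - 1)
    {r : TodaSpace N → ℝ} (hr : ContinuousAt r p₀) (hI : Isolating p₀ n (r p₀)) :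
    ∀ᶠ p in 𝓝 p₀, Isolating p n (r p) := by
  have hm := Complex.continuous_re.continuousAt.comp (analyticAt_mid hp h1 h2).continuousAt
  have hl := Complex.continuous_re.continuousAt.comp
    (continuousAt_eig hp (j := 2 * n - 1) (by omega) (by omega))
  have hr' := Complex.continuous_re.continuousAt.comp
    (continuousAt_eig hp (j := 2 * n + 2) (by omega) (by omega))
  filter_upwards [((continuousAt_gap hp h1 h2).norm.div_const 2).eventually_lt hr hI.gap_lt,
    (hl.add hr).eventually_lt hm hI.left_lt, (hm.add hr).eventually_lt hr' hI.lt_right]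
    with p g1 g2 g3
  exact ⟨g1, g2, g3⟩

lemma analyticAt_cRoot_integrands (hp : p₀ ∈ realPhase N) {n : ℕ} (h1 : 1 ≤ n) (h2 : n ≤ N - 1)
    {z : ℂ} (hz : ‖gap p₀ n‖ / 2 < ‖z - mid p₀ n‖) (hstrip : InStrip p₀ n z) :
    AnalyticAt ℂ (fun q : TodaSpace N × ℂ => (derivative (discr q.1)).eval q.2 / cRoot q.1 q.2)
      (p₀, z) ∧
    AnalyticAt ℂ (fun q : TodaSpace N × ℂ => (derivative (discr q.1)).eval q.2 /
      (cRoot q.1 q.2 * (q.2 - mid q.1 n + gapRoot q.1 n q.2))) (p₀, z) := by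
  have hpc := realPhase_subset hp
  have hcut := offCut_of_lt_norm hz
  have hd := analyticAt_derivative_discr_eval hpc z
  have hg := hcut.analyticAt (analyticAt_mid hp h1 h2) (analyticAt_gap_sq hp h1 h2)
  have hr := hstrip.restRoot_analyticAt hpc h1 h2 (analyticAt_eig_one hp) (analyticAt_eig_last hp)
    (fun m hm => analyticAt_mid hp (Finset.mem_Icc.1 hm).1 (Finset.mem_Icc.1 hm).2)
    (fun m hm => analyticAt_gap_sq hp (Finset.mem_Icc.1 hm).1 (Finset.mem_Icc.1 hm).2)
  have hm : AnalyticAt ℂ (fun q : TodaSpace N × ℂ => q.2 - mid q.1 n) (p₀, z) :=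
    analyticAt_snd.sub (AnalyticAt.fun_comp (g := fun p => mid p n) (analyticAt_mid hp h1 h2)
      analyticAt_fst)
  have hne : gapRoot p₀ n z * restRoot p₀ n z ≠ 0 :=
    mul_ne_zero hcut.gapRoot_ne_zero (hstrip.restRoot_ne_zero hpc h1 h2)
  simp only [cRoot_eq_gapRoot_mul _ h1 h2]
  exact ⟨hd.div (hg.mul hr) hne,
    hd.div ((hg.mul hr).mul (hm.add hg)) (mul_ne_zero hne hcut.add_gapRoot_ne_zero)⟩

end Analytic

section Radius

variable {p : TodaSpace N} {n : ℕ}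

lemma differentiableAt_cRoot_integrands (hp : p ∈ complexPhase N) (h1 : 1 ≤ n) (h2 : n ≤ N - 1)
    {z : ℂ} (hz : ‖gap p n‖ / 2 < ‖z - mid p n‖) (hstrip : InStrip p n z) :
    DifferentiableAt ℂ (fun z => (derivative (discr p)).eval z / cRoot p z) z ∧
    DifferentiableAt ℂ (fun z => (derivative (discr p)).eval z /
      (cRoot p z * (z - mid p n + gapRoot p n z))) z := by
  have hcut := offCut_of_lt_norm hz
  have hd : DifferentiableAt ℂ (fun z => (derivative (discr p)).eval z) z :=
    (derivative (discr p)).differentiableAt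
  have hg := hcut.differentiableAt
  have hr := hstrip.restRoot_differentiableAt hp h1 h2
  have hm : DifferentiableAt ℂ (fun z => z - mid p n) z := differentiableAt_id.sub_const _
  have hne : gapRoot p n z * restRoot p n z ≠ 0 :=
    mul_ne_zero hcut.gapRoot_ne_zero (hstrip.restRoot_ne_zero hp h1 h2)
  simp only [cRoot_eq_gapRoot_mul _ h1 h2]
  exact ⟨hd.div (hg.mul hr) hne,
    hd.div ((hg.mul hr).mul (hm.add hg)) (mul_ne_zero hne hcut.add_gapRoot_ne_zero)⟩

end Radius

/-! ### Signs on the real gaps. -/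

section Real

variable {p : TodaSpace N}

/-- For every other gap, the factor `x - e m` of `Δ'` cancels against `gapRoot p m x` up to a
positive number. What remains of `restRoot` is `i` times two positive outer roots. -/
lemma exists_div_restRoot_eq (hp : p ∈ realPhase N) {n : ℕ} (h1 : 1 ≤ n) (h2 : n ≤ N - 1)
    {l e : ℕ → ℝ} (hl : ∀ j, 1 ≤ j → j ≤ 2 * N → eig p j = l j)
    (hband : ∀ j, 1 ≤ j → j ≤ N → l (2 * j - 1) < l (2 * j))
    (hcrit : ∀ m, 1 ≤ m → m ≤ N - 1 → l (2 * m) ≤ e m ∧ e m ≤ l (2 * m + 1))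
    {x : ℝ} (hx1 : l (2 * n) ≤ x) (hx2 : x ≤ l (2 * n + 1)) :
    ∃ y : ℝ, 0 < y ∧ N * (∏ k, p.2 k)⁻¹ * (∏ m ∈ (Finset.Icc 1 (N - 1)).erase n, ((x : ℂ) - e m)) /
      restRoot p n x = -Complex.I * y := by
  have hpc := realPhase_subset hp
  have hN := NeZero.pos N
  have hmono : ∀ i j, 1 ≤ i → i ≤ j → j ≤ 2 * N → l i ≤ l j := fun i j hi hij hj => by
    have := eig_re_mono hpc hi hij hj
    rwa [hl i hi (by omega), hl j (by omega) hj, Complex.ofReal_re, Complex.ofReal_re] at this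
  have b1 := hband n h1 (by omega)
  have b2 := hband (n + 1) (by omega) (by omega)
  rw [show 2 * (n + 1) - 1 = 2 * n + 1 by omega, show 2 * (n + 1) = 2 * n + 2 by omega] at b2
  have hg : ∀ m ∈ (Finset.Icc 1 (N - 1)).erase n,
      ∃ g : ℝ, 0 < g ∧ gapRoot p m x = (x - e m) * g := by
    intro m hm
    rw [Finset.mem_erase, Finset.mem_Icc] at hm
    refine exists_gapRoot_eq (hl _ (by omega) (by omega)) (hl _ (by omega) (by omega))
      (hcrit m hm.2.1 hm.2.2).1 (hcrit m hm.2.1 hm.2.2).2 ?_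
    rcases lt_or_gt_of_ne hm.1 with h | h
    · right
      have := hmono (2 * m + 1) (2 * n - 1) (by omega) (by omega) (by omega)
      linarith
    · left
      have := hmono (2 * n + 2) (2 * m) (by omega) (by omega) (by omega)
      linarith
  choose! g hg0 hg1 using hg
  have hlo := hmono 1 (2 * n - 1) le_rfl (by omega) (by omega)
  have hhi := hmono (2 * n + 2) (2 * N) (by omega) (by omega) le_rfl
  obtain ⟨u, hu, hu'⟩ := principalSqrt_ofReal (show 0 < x - l 1 by linarith)
  obtain ⟨v, hv, hv'⟩ := principalSqrt_ofReal (show 0 < l (2 * N) - x by linarith)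
  have hG : 0 < ∏ m ∈ (Finset.Icc 1 (N - 1)).erase n, g m := Finset.prod_pos hg0
  have hstrip : InStrip p n x := by
    constructor
    · rw [hl _ (by omega) (by omega), Complex.ofReal_re, Complex.ofReal_re]; linarith
    · rw [hl _ (by omega) (by omega), Complex.ofReal_re, Complex.ofReal_re]; linarith
  have hne := hstrip.restRoot_ne_zero hpc h1 h2
  have hrest : restRoot p n x = (∏ k, p.2 k)⁻¹ * (Complex.I * u * v) *
      ((∏ m ∈ (Finset.Icc 1 (N - 1)).erase n, ((x : ℂ) - e m)) *
        ((∏ m ∈ (Finset.Icc 1 (N - 1)).erase n, g m : ℝ) : ℂ)) := by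
    rw [restRoot, Finset.prod_congr rfl hg1, Finset.prod_mul_distrib, hl 1 le_rfl (by omega),
      hl (2 * N) (by omega) le_rfl, ← Complex.ofReal_sub, ← Complex.ofReal_sub, hu', hv']
    push_cast
    rfl
  refine ⟨N / (u * v * ∏ m ∈ (Finset.Icc 1 (N - 1)).erase n, g m), by positivity, ?_⟩
  rw [div_eq_iff hne, hrest]
  have e1 : (u : ℂ) ≠ 0 := by exact_mod_cast hu.ne'
  have e2 : (v : ℂ) ≠ 0 := by exact_mod_cast hv.ne'
  have e3 : ((∏ m ∈ (Finset.Icc 1 (N - 1)).erase n, g m : ℝ) : ℂ) ≠ 0 := by exact_mod_cast hG.ne'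
  rw [Complex.ofReal_div, Complex.ofReal_mul, Complex.ofReal_mul, Complex.ofReal_natCast]
  generalize ((∏ m ∈ (Finset.Icc 1 (N - 1)).erase n, g m : ℝ) : ℂ) = G at e3 ⊢
  generalize (∏ m ∈ (Finset.Icc 1 (N - 1)).erase n, ((x : ℂ) - e m)) = P
  generalize (∏ k, p.2 k)⁻¹ = A
  field_simp
  linear_combination (N * A * P) * Complex.I_sq

end Real

end Toda

/-! ### Vanishing of the period and positivity of the quotient at real points. -/

namespace Toda

variable {N : ℕ} {p : TodaSpace N} {n : ℕ}

lemma gapRoot_eq (p : TodaSpace N) (n : ℕ) (z : ℂ) :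
    gapRoot p n z =
      (z - mid p n) * principalSqrt (1 - (gap p n / 2 / (z - mid p n)) ^ 2) := rfl

/-- The parametrisation of a closed real gap. -/
lemma mid_add_gap_cos {l : ℕ → ℝ} (hl : ∀ j, 1 ≤ j → j ≤ 2 * N → eig p j = l j) (h1 : 1 ≤ n)
    (h2 : n ≤ N - 1) (hle : l (2 * n) ≤ l (2 * n + 1)) (θ : ℝ) :
    ∃ x : ℝ, l (2 * n) ≤ x ∧ x ≤ l (2 * n + 1) ∧
      x = (l (2 * n) + l (2 * n + 1)) / 2 + (l (2 * n + 1) - l (2 * n)) / 2 * Real.cos θ ∧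
      mid p n + gap p n / 2 * Complex.cos θ = x := by
  have c1 := Real.neg_one_le_cos θ
  have c2 := Real.cos_le_one θ
  refine ⟨_, ?_, ?_, rfl, ?_⟩
  · nlinarith
  · nlinarith
  · rw [mid, gap, hl _ (by omega) (by omega), hl _ (by omega) (by omega)]
    push_cast
    ring

variable [NeZero N]

/-- Integrals of the form `∮ f / √(Δ² - 4)` around the `n`-th gap as averages over the gap. -/
lemma Isolating.circleIntegral_div_cRoot {r : ℝ} (h : Isolating p n r) (hp : p ∈ complexPhase N)
    (h1 : 1 ≤ n) (h2 : n ≤ N - 1) {f : ℂ → ℂ} (hf : Differentiable ℂ f) :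
    ∮ z in C(mid p n, r), f z / cRoot p z = Complex.I * ∫ θ in (0 : ℝ)..2 * Real.pi,
      f (mid p n + gap p n / 2 * Complex.cos θ) /
        restRoot p n (mid p n + gap p n / 2 * Complex.cos θ) := by
  have h := circleIntegral_div_sqrt (f := fun z => f z / restRoot p n z) (τ := mid p n)
    (u := gap p n / 2) (r := r) (by simpa using h.gap_lt) fun z hz => by
      rw [Metric.mem_closedBall, dist_eq_norm] at hz
      exact (hf z).div ((h.inStrip hz).restRoot_differentiableAt hp h1 h2)
        ((h.inStrip hz).restRoot_ne_zero hp h1 h2)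
  rw [← h]
  simp only [cRoot_eq_gapRoot_mul p h1 h2, gapRoot_eq, div_div, mul_comm]

lemma derivative_discr_eval_eq {e : ℕ → ℝ} (h1 : 1 ≤ n) (h2 : n ≤ N - 1)
    (hder : derivative (discr p) =
      C (N * (∏ k, p.2 k)⁻¹) * ∏ m ∈ Finset.Icc 1 (N - 1), (X - C (e m : ℂ))) (z : ℂ) :
    (derivative (discr p)).eval z = (z - e n) *
      (N * (∏ k, p.2 k)⁻¹ * ∏ m ∈ (Finset.Icc 1 (N - 1)).erase n, (z - e m)) := by
  rw [hder, eval_mul, eval_C, eval_prod, ← Finset.mul_prod_erase _ _ (Finset.mem_Icc.2 ⟨h1, h2⟩)]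
  simp only [eval_sub, eval_X, eval_C]
  ring

/-- For real `(b, a)`, the differential `Δ' / √(Δ² - 4)` has no period around a gap. -/
lemma circleIntegral_eq_zero_of_real (hp : p ∈ realPhase N) (h1 : 1 ≤ n) (h2 : n ≤ N - 1) :
    ∮ z in C(mid p n, contourRadius p n), (derivative (discr p)).eval z / cRoot p z = 0 := by
  have hpc := realPhase_subset hp
  have hI := isolating_contourRadius hp h1 h2
  obtain ⟨l, e, hl, hband, hcrit, hder⟩ := exists_real_eig hp
  obtain ⟨k, hk⟩ := hI.exists_int hpc h1 h2
  have h := hI.circleIntegral_div_cRoot hpc h1 h2 (f := fun z => (derivative (discr p)).eval z)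
    (derivative (discr p)).differentiable
  have hre : ∀ θ : ℝ, ∃ y : ℝ, (derivative (discr p)).eval (mid p n + gap p n / 2 * Complex.cos θ) /
      restRoot p n (mid p n + gap p n / 2 * Complex.cos θ) = -Complex.I * y := by
    intro θ
    obtain ⟨x, hx1, hx2, -, hx⟩ := mid_add_gap_cos hl h1 h2
      ((hcrit n h1 h2).1.trans (hcrit n h1 h2).2) θ
    obtain ⟨y, -, hy⟩ := exists_div_restRoot_eq hp h1 h2 hl hband hcrit hx1 hx2
    refine ⟨(x - e n) * y, ?_⟩
    rw [hx, derivative_discr_eval_eq h1 h2 hder, mul_div_assoc, hy]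
    push_cast
    ring
  choose y hy using hre
  simp only [hy] at h
  rw [intervalIntegral.integral_const_mul, intervalIntegral.integral_ofReal, ← mul_assoc,
    mul_neg, Complex.I_mul_I, neg_neg, one_mul] at h
  -- The period is `2πi k`, while the gap average just computed is real; hence `k = 0`.
  have him := congrArg Complex.im (hk.symm.trans h)
  simp [Real.pi_ne_zero] at him
  rw [hk, him]
  simp

lemma actionQuotient_re_pos (hp : p ∈ realPhase N) (h1 : 1 ≤ n) (h2 : n ≤ N - 1) :
    0 < (actionQuotient n p).re := by
  have hpc := realPhase_subset hp
  have hI := isolating_contourRadius hp h1 h2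
  obtain ⟨l, e, hl, hband, hcrit, hder⟩ := exists_real_eig hp
  have h0 := circleIntegral_eq_zero_of_real hp h1 h2
  have hle := (hcrit n h1 h2).1.trans (hcrit n h1 h2).2
  have hgap : gap p n = ((l (2 * n + 1) - l (2 * n) : ℝ) : ℂ) := by
    rw [gap, hl _ (by omega) (by omega), hl _ (by omega) (by omega)]; push_cast; rfl
  have hpi : (Real.pi : ℂ) ≠ 0 := by exact_mod_cast Real.pi_ne_zero
  by_cases hg : gap p n = 0
  -- Collapsed gap: `gapRoot` is `z - τ`, so the denominator contributes `2 (z - τ)`, which cancels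
  -- the zero of `Δ'` at `e n = τ`. The average is over a single point and the value is `y / 8`.
  · have hll : l (2 * n + 1) = l (2 * n) := by
      rw [hgap] at hg
      exact sub_eq_zero.1 (by exact_mod_cast hg)
    have hen : e n = l (2 * n) :=
      le_antisymm ((hcrit n h1 h2).2.trans hll.le) (hcrit n h1 h2).1
    have hmid : mid p n = (l (2 * n) : ℂ) := by
      rw [mid, hl _ (by omega) (by omega), hl _ (by omega) (by omega), hll]; ring
    obtain ⟨y, hy0, hy⟩ := exists_div_restRoot_eq hp h1 h2 hl hband hcrit le_rfl hle
    have h := hI.circleIntegral_div_cRoot hpc h1 h2 (f := fun z => N * (∏ k, p.2 k)⁻¹ *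
      (∏ m ∈ (Finset.Icc 1 (N - 1)).erase n, (z - e m))) (by fun_prop)
    have hcongr : ∮ z in C(mid p n, contourRadius p n),
        (derivative (discr p)).eval z / (cRoot p z * (z - mid p n + gapRoot p n z)) =
        ∮ z in C(mid p n, contourRadius p n), (2 : ℂ)⁻¹ * (N * (∏ k, p.2 k)⁻¹ *
          (∏ m ∈ (Finset.Icc 1 (N - 1)).erase n, (z - e m)) / cRoot p z) := by
      refine circleIntegral.integral_congr hI.pos.le fun z hz => ?_
      rw [Metric.mem_sphere, dist_eq_norm] at hz
      have hz0 : z - mid p n ≠ 0 := by rw [← norm_pos_iff, hz]; exact hI.pos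
      have hgr : gapRoot p n z = z - mid p n := by
        rw [gapRoot, hg]; simp [principalSqrt]
      rw [hgr, derivative_discr_eval_eq h1 h2 hder, hen, ← hmid]
      field_simp
      ring
    rw [actionQuotient, hcongr, circleIntegral.integral_const_mul, h]
    simp only [hg, zero_div, zero_mul, add_zero]
    rw [hmid, hy, intervalIntegral.integral_const]
    have : (8 * (Real.pi : ℂ))⁻¹ * (2⁻¹ * (Complex.I * ((2 * Real.pi - 0) • (-Complex.I * (y : ℂ))))) =
        ((y / 8 : ℝ) : ℂ) := by
      rw [Complex.real_smul]
      push_cast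
      field_simp
      linear_combination (-2 * (Real.pi : ℂ) * (y : ℂ)) * Complex.I_sq
    rw [this, Complex.ofReal_re]
    positivity
  · have hlt : l (2 * n) < l (2 * n + 1) := by
      refine lt_of_le_of_ne hle fun h => hg ?_
      rw [hgap, h]; simp
    have hact := hI.action_eq hpc h1 h2 h0
    -- Open gap: since the period vanishes, `z` may be replaced by `z - e n` in the action, which
    -- makes the integrand a square times a positive factor.
    have h := hI.circleIntegral_div_cRoot hpc h1 h2
      (f := fun z => (z - e n) * (derivative (discr p)).eval z)
      ((differentiable_id.sub_const _).mul (derivative (discr p)).differentiable)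
    have hre : ∀ θ : ℝ, ∃ y : ℝ, 0 < y ∧
        (mid p n + gap p n / 2 * Complex.cos θ - e n) *
          (derivative (discr p)).eval (mid p n + gap p n / 2 * Complex.cos θ) /
        restRoot p n (mid p n + gap p n / 2 * Complex.cos θ) = -Complex.I *
          (((((l (2 * n) + l (2 * n + 1)) / 2 + (l (2 * n + 1) - l (2 * n)) / 2 * Real.cos θ) -
            e n) ^ 2 * y : ℝ) : ℂ) := by
      intro θ
      obtain ⟨x, hx1, hx2, hxdef, hx⟩ := mid_add_gap_cos hl h1 h2 hle θ
      obtain ⟨y, hy0, hy⟩ := exists_div_restRoot_eq hp h1 h2 hl hband hcrit hx1 hx2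
      refine ⟨y, hy0, ?_⟩
      rw [hx, derivative_discr_eval_eq h1 h2 hder, ← mul_assoc, mul_div_assoc, hy, ← hxdef]
      push_cast
      ring
    choose y hy0 hy using hre
    set Y : ℝ → ℝ := fun θ =>
      (((l (2 * n) + l (2 * n + 1)) / 2 + (l (2 * n + 1) - l (2 * n)) / 2 * Real.cos θ) -
        e n) ^ 2 * y θ with hY
    -- The factor `y` was obtained by choice, so continuity is read off from the closed formula for
    -- the integrand.
    have hYc : Continuous Y := by
      have : Y = fun θ : ℝ => (Complex.I * ((mid p n + gap p n / 2 * Complex.cos θ - e n) *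
          (derivative (discr p)).eval (mid p n + gap p n / 2 * Complex.cos θ) /
          restRoot p n (mid p n + gap p n / 2 * Complex.cos θ))).re := by
        funext θ
        rw [hy, ← mul_assoc, mul_neg, Complex.I_mul_I, neg_neg, one_mul, Complex.ofReal_re]
      rw [this]
      refine Complex.continuous_re.comp (continuous_const.mul (Continuous.div ?_ ?_ fun θ => ?_))
      · exact Continuous.mul (by fun_prop) ((derivative (discr p)).continuous.comp (by fun_prop))
      · have hin : ∀ θ : ℝ, InStrip p n (mid p n + gap p n / 2 * Complex.cos θ) := fun θ =>
          hI.inStrip (by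
            rw [add_sub_cancel_left, norm_mul, ← Complex.ofReal_cos, Complex.norm_real,
              Real.norm_eq_abs]
            have := Real.abs_cos_le_one θ
            have := hI.gap_lt
            have e1 : ‖gap p n / 2‖ = ‖gap p n‖ / 2 := by simp
            nlinarith [norm_nonneg (gap p n / 2)])
        refine continuous_iff_continuousAt.2 fun θ => ContinuousAt.comp
          (g := restRoot p n) (f := fun θ : ℝ => mid p n + gap p n / 2 * Complex.cos θ)
          ((hin θ).restRoot_differentiableAt hpc h1 h2).continuousAt
          (Continuous.continuousAt (by fun_prop))
      · refine InStrip.restRoot_ne_zero (hI.inStrip ?_) hpc h1 h2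
        rw [add_sub_cancel_left, norm_mul, ← Complex.ofReal_cos, Complex.norm_real,
          Real.norm_eq_abs]
        have := Real.abs_cos_le_one θ
        have := hI.gap_lt
        have e1 : ‖gap p n / 2‖ = ‖gap p n‖ / 2 := by simp
        nlinarith [norm_nonneg (gap p n / 2)]
    have hpos : 0 < ∫ θ in (0 : ℝ)..2 * Real.pi, Y θ := by
      refine intervalIntegral.integral_pos Real.two_pi_pos hYc.continuousOn
        (fun θ _ => mul_nonneg (sq_nonneg _) (hy0 θ).le) ?_
      -- The angles `0` and `π` correspond to the two ends of the gap, and `e n` differs from at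
      -- least one of them.
      by_cases he : e n = l (2 * n)
      · refine ⟨0, ⟨le_rfl, Real.two_pi_pos.le⟩, mul_pos ?_ (hy0 0)⟩
        rw [Real.cos_zero, he]
        have : 0 < l (2 * n + 1) - l (2 * n) := by linarith
        refine pow_pos (by linarith) 2
      · refine ⟨Real.pi, ⟨Real.pi_pos.le, by linarith [Real.pi_pos]⟩, mul_pos ?_ (hy0 _)⟩
        rw [Real.cos_pi]
        have : l (2 * n) - e n ≠ 0 := fun h => he (by linarith)
        rw [show (l (2 * n) + l (2 * n + 1)) / 2 + (l (2 * n + 1) - l (2 * n)) / 2 * -1 - e n =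
          l (2 * n) - e n by ring]
        positivity
    simp only [hy] at h
    rw [intervalIntegral.integral_const_mul, intervalIntegral.integral_ofReal, ← mul_assoc,
      mul_neg, Complex.I_mul_I, neg_neg, one_mul] at h
    have hsplit : ∮ z in C(mid p n, contourRadius p n),
        (z - e n) * (derivative (discr p)).eval z / cRoot p z =
        (∮ z in C(mid p n, contourRadius p n), z * (derivative (discr p)).eval z / cRoot p z) -
          ∮ z in C(mid p n, contourRadius p n),
            (e n : ℂ) * ((derivative (discr p)).eval z / cRoot p z) := by
      have hc : ContinuousOn (fun z => (derivative (discr p)).eval z / cRoot p z)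
          (Metric.sphere (mid p n) (contourRadius p n)) := fun z hz => by
        rw [Metric.mem_sphere, dist_eq_norm] at hz
        exact (differentiableAt_cRoot_integrands hpc h1 h2 (by rw [hz]; exact hI.gap_lt)
          (hI.inStrip hz.le)).1.continuousAt.continuousWithinAt
      rw [← circleIntegral.integral_sub]
      · congr 1
        ext z
        ring
      · simp only [mul_div_assoc]
        exact (continuousOn_id.mul hc).circleIntegrable hI.pos.le
      · exact (continuousOn_const.mul hc).circleIntegrable hI.pos.le
    rw [hsplit, circleIntegral.integral_const_mul, h0, mul_zero, sub_zero] at h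
    rw [action, h, hgap] at hact
    have hγ : 0 < l (2 * n + 1) - l (2 * n) := by linarith
    have hγ' : ((l (2 * n + 1) - l (2 * n) : ℝ) : ℂ) ≠ 0 := by exact_mod_cast hγ.ne'
    have hval : actionQuotient n p = (((2 * Real.pi)⁻¹ * (∫ θ in (0 : ℝ)..2 * Real.pi, Y θ) /
        (l (2 * n + 1) - l (2 * n)) ^ 2 : ℝ) : ℂ) := by
      rw [Complex.ofReal_div, eq_div_iff (by exact_mod_cast (pow_pos hγ 2).ne')]
      push_cast at hact ⊢
      rw [hact]
      ring
    rw [hval, Complex.ofReal_re]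
    positivity

/-! ### Extension to a complex neighbourhood. -/

open Filter Topology in
/-- Near a point of the real phase space, `actionQuotient` is analytic, has positive real part, and
equals `I_n / γ_n²` wherever `γ_n ≠ 0`. -/
theorem eventually_actionQuotient {p₀ : TodaSpace N} (hp : p₀ ∈ realPhase N) (h1 : 1 ≤ n)
    (h2 : n ≤ N - 1) :
    ∀ᶠ p in 𝓝 p₀, AnalyticAt ℂ (actionQuotient n) p ∧ 0 < (actionQuotient n p).re ∧
      (gap p n ≠ 0 → actionQuotient n p = action p n / gap p n ^ 2) := by
  have hpc := realPhase_subset hp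
  have hI := isolating_contourRadius hp h1 h2
  set R := contourRadius p₀ n with hR
  have ev0 := isOpen_complexPhase.mem_nhds hpc
  have ev1 := eventually_isolating hp h1 h2 (r := fun _ => R) continuousAt_const hI
  have ev2 := eventually_isolating hp h1 h2 (continuousAt_contourRadius hp h1 h2) hI
  have hmid := analyticAt_mid hp h1 h2
  have hsphere : ∀ z ∈ Metric.sphere (mid p₀ n) R,
      ‖gap p₀ n‖ / 2 < ‖z - mid p₀ n‖ ∧ InStrip p₀ n z := fun z hz => by
    rw [Metric.mem_sphere, dist_eq_norm] at hz
    exact ⟨by rw [hz]; exact hI.gap_lt, hI.inStrip hz.le⟩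
  have hF : AnalyticAt ℂ (actionQuotient n) p₀ := by
    have h := (analyticAt_const (v := (8 * Real.pi : ℂ)⁻¹)).mul (analyticAt_circleIntegral
      hI.pos.le hmid fun z hz =>
        (analyticAt_cRoot_integrands hp h1 h2 (hsphere z hz).1 (hsphere z hz).2).2)
    -- The analytic expression uses the frozen radius `R`; contour deformation identifies it with
    -- the integral over the moving circle.
    refine h.congr ?_
    filter_upwards [ev0, ev1, ev2] with p g0 g1 g2
    rw [actionQuotient, Pi.mul_apply, g1.circleIntegral_eq g2 fun z hz hz' =>
      (differentiableAt_cRoot_integrands g0 h1 h2 hz hz').2]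
  have hper := analyticAt_circleIntegral hI.pos.le hmid fun z hz =>
    (analyticAt_cRoot_integrands hp h1 h2 (hsphere z hz).1 (hsphere z hz).2).1
  have ev3 : ∀ᶠ p in 𝓝 p₀, ‖∮ z in C(mid p n, R), (derivative (discr p)).eval z / cRoot p z‖ <
      2 * Real.pi := by
    refine hper.continuousAt.norm.eventually_lt continuousAt_const ?_
    change ‖∮ z in C(mid p₀ n, R), (derivative (discr p₀)).eval z / cRoot p₀ z‖ < _
    rw [circleIntegral_eq_zero_of_real hp h1 h2, norm_zero]
    exact Real.two_pi_pos
  have ev4 : ∀ᶠ p in 𝓝 p₀, 0 < (actionQuotient n p).re :=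
    continuousAt_const.eventually_lt (Complex.continuous_re.continuousAt.comp hF.continuousAt)
      (actionQuotient_re_pos hp h1 h2)
  filter_upwards [ev0, ev1, ev2, ev3, ev4, hF.eventually_analyticAt] with p g0 g1 g2 g3 g4 g5
  refine ⟨g5, g4, fun hg => ?_⟩
  -- An integer multiple of `2πi` of modulus below `2π` is zero, so the vanishing of the period
  -- spreads from `p₀` to nearby complex points.
  have hzero : ∮ z in C(mid p n, R), (derivative (discr p)).eval z / cRoot p z = 0 := by
    obtain ⟨k, hk⟩ := g1.exists_int g0 h1 h2
    rw [hk] at g3 ⊢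
    have hn : ‖(2 * Real.pi * Complex.I : ℂ)‖ = 2 * Real.pi := by
      simp [abs_of_pos Real.pi_pos]
    rw [norm_mul, hn, Complex.norm_intCast, mul_lt_iff_lt_one_left Real.two_pi_pos] at g3
    have : k = 0 := Int.abs_lt_one_iff.1 (by exact_mod_cast g3)
    simp [this]
  rw [g1.circleIntegral_eq g2 fun z hz hz' =>
    (differentiableAt_cRoot_integrands g0 h1 h2 hz hz').1] at hzero
  rw [g2.action_eq g0 h1 h2 hzero, mul_div_cancel_left₀ _ (pow_ne_zero 2 hg)]

end Toda

theorem proposition3p5 (N : ℕ) [NeZero N] (hN : 2 ≤ N) :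
    ∃ W : Set (TodaSpace N), IsOpen W ∧ realPhase N ⊆ W ∧ W ⊆ complexPhase N ∧
      ∀ n : ℕ, 1 ≤ n → n ≤ N - 1 →
        ∃ F : TodaSpace N → ℂ,
          (∀ p ∈ realPhase N \ Toda.collapsed N n, F p = Toda.action p n / Toda.gap p n ^ 2) ∧
          (∀ p ∈ W \ Toda.collapsed N n, F p = Toda.action p n / Toda.gap p n ^ 2) ∧
          AnalyticOnNhd ℂ F W ∧
          (∀ p ∈ W, 0 < (F p).re) ∧
          AnalyticOnNhd ℂ (fun p => principalSqrt (2 * F p)) W ∧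
          ∀ p ∈ W, principalSqrt (2 * F p) ≠ 0 := by
  -- The interior of the set of good points serves for all `n` at once; real points are interior
  -- because only finitely many `n` are involved.
  set S : Set (TodaSpace N) := {p | p ∈ complexPhase N ∧ ∀ n ∈ Finset.Icc 1 (N - 1),
    AnalyticAt ℂ (Toda.actionQuotient n) p ∧ 0 < (Toda.actionQuotient n p).re ∧
      (Toda.gap p n ≠ 0 → Toda.actionQuotient n p = Toda.action p n / Toda.gap p n ^ 2)} with hS
  have hreal : realPhase N ⊆ interior S := by
    intro p₀ hp
    rw [mem_interior_iff_mem_nhds]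
    have h : ∀ᶠ p in nhds p₀, ∀ n ∈ Finset.Icc 1 (N - 1),
        AnalyticAt ℂ (Toda.actionQuotient n) p ∧ 0 < (Toda.actionQuotient n p).re ∧
        (Toda.gap p n ≠ 0 → Toda.actionQuotient n p = Toda.action p n / Toda.gap p n ^ 2) :=
      (Finset.eventually_all _).2 fun n hn =>
        Toda.eventually_actionQuotient hp (Finset.mem_Icc.1 hn).1 (Finset.mem_Icc.1 hn).2
    filter_upwards [h, Toda.isOpen_complexPhase.mem_nhds (Toda.realPhase_subset hp)] with p g1 g2
    exact ⟨g2, g1⟩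
  refine ⟨interior S, isOpen_interior, hreal, fun p hp => (interior_subset hp).1,
    fun n h1 h2 => ?_⟩
  have key : ∀ p ∈ interior S, AnalyticAt ℂ (Toda.actionQuotient n) p ∧
      0 < (Toda.actionQuotient n p).re ∧
      (Toda.gap p n ≠ 0 → Toda.actionQuotient n p = Toda.action p n / Toda.gap p n ^ 2) :=
    fun p hp => (interior_subset hp).2 n (Finset.mem_Icc.2 ⟨h1, h2⟩)
  have hslit : ∀ p ∈ interior S, 2 * Toda.actionQuotient n p ∈ Complex.slitPlane := by
    intro p hp
    refine Complex.mem_slitPlane_iff.2 (Or.inl ?_)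
    have := (key p hp).2.1
    simpa using this
  exact ⟨Toda.actionQuotient n, fun p hp => (key p (hreal hp.1)).2.2 hp.2,
    fun p hp => (key p hp.1).2.2 hp.2, fun p hp => (key p hp).1, fun p hp => (key p hp).2.1,
    fun p hp => (analyticAt_const.mul (key p hp).1).cpow analyticAt_const (hslit p hp),
    fun p hp => principalSqrt_ne_zero (Complex.slitPlane_ne_zero (hslit p hp))⟩
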